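/- **Lemma.** Let $M$ be a smooth manifold with a pair of complementary smooth distributions $\widetilde{\mathcal D}$ (rank $n$) and $\mathcal D$ (rank $p$), $TM=\widetilde{\mathcal D}\oplus\mathcal D$, and let $X=X^\top+X^\perp$ be the corresponding decomposition of a vector. Let $g_t$ ($|t|<\varepsilon$) be a smooth $g^\perp$-variation of a pseudo-Riemannian metric $g=g_0$: a family of pseudo-Riemannian metrics on $M$, smooth in $(t,x)$, such that $\widetilde{\mathcal D}\perp\mathcal D$ for every $g_t$ and $g_t(X^\top,Y^\top)=g_0(X^\top,Y^\top)$ for all $t$. Put $B=\partial_t g_t$. For a metric $g=g_t$ with Levi-Civita connection $\nabla$, and local orthonormal frames $E_a$ of $\widetilde{\mathcal D}$ and $\mathcal E_i$ of $\mathcal D$ with $\epsilon_a=g(E_a,E_a)$, $\epsilon_i=g(\mathcal E_i,\mathcal E_i)$, let, for $X,Y\in\widetilde{\mathcal D}$ and $Z\in\mathcal D$, $$h(X,Y)=\tfrac12(\nabla_XY+\nabla_YX)^\perp,\quad T(X,Y)=\tfrac12[X,Y]^\perp,\quad H=\sum_a\epsilon_a h(E_a,E_a),$$ $$g(A_ZX,Y)=g(h(X,Y),Z),\qquad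 g(T^\sharp_ZX,Y)=g(T(X,Y),Z),$$ $$\langle h,h\rangle=\sum_{a,b}\epsilon_a\epsilon_b\,g(h(E_a,E_b),h(E_a,E_b)),\quad \langle T,T\rangle=\sum_{a,b}\epsilon_a\epsilon_b\,g(T(E_a,E_b),T(E_a,E_b)),\quad \mathrm S_{\rm ex}=g(H,H)-\langle h,h\rangle,$$ where $h,T,A,T^\sharp$ are extended to $TM$ by zero (using the projections). Let $\tilde h,\tilde T,\tilde H,\tilde A,\tilde T^\sharp,\langle\tilde T,\tilde T\rangle,\widetilde{\mathrm S}_{\rm ex}$ be the same objects with the roles of $\widetilde{\mathcal D}$ and $\mathcal D$ exchanged, and let $$\widetilde{\mathcal T}=\sum_a\epsilon_a(\tilde T^\sharp_{E_a})^2,\qquad \widetilde{\mathcal K}=\sum_a\epsilon_a(\tilde T^\sharp_{E_a}\tilde A_{E_a}-\tilde A_{E_a}\tilde T^\sharp_{E_a}).$$ For a $(1,1)$-tensor $L$ put $L^\flat(X,Y)=g(LX,Y)$; for $(0,2)$-tensors let $g(C^\sharp X,Y)=C(X,Y)$, $\langle C,B\rangle=\operatorname{Tr}(C^\sharp B^\sharp)$,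 $\operatorname{Tr}_gB=\operatorname{Tr}B^\sharp$; let $g^\perp(X,Y)=g(X^\perp,Y^\perp)$, $\operatorname{div}\xi=\operatorname{Tr}(\nabla\xi)$, and, with sums over an orthonormal frame $e_\mu$ of $TM$, $\epsilon_\mu=g(e_\mu,e_\mu)$, $$(\operatorname{div}\tilde h)(X,Y)=\sum_\mu\epsilon_\mu\,g((\nabla_{e_\mu}\tilde h)(X,Y),e_\mu),\qquad \langle\tilde h,B\rangle=\sum_{\mu,\nu}\epsilon_\mu\epsilon_\nu\,B(e_\mu,e_\nu)\,\tilde h(e_\mu,e_\nu).$$ Finally let $\Phi_h=H^\flat\otimes H^\flat-\sum_{a,b}\epsilon_a\epsilon_b\,h(E_a,E_b)^\flat\otimes h(E_a,E_b)^\flat$ and $\Phi_T=-\sum_{a,b}\epsilon_a\epsilon_b\,T(E_a,E_b)^\flat\otimes T(E_a,E_b)^\flat$, where $X^\flat=g(X,\cdot)$; equivalently, for symmetric $(0,2)$-tensors $B$, $\langle\Phi_h,B\rangle=B(H,H)-\sum_{a,b}\epsilon_a\epsilon_bB(h(E_a,E_b),h(E_a,E_b))$ and $\langle\Phi_T,B\rangle=-\sum_{a,b}\epsilon_a\epsilon_bB(T(E_a,E_b),T(E_a,E_b))$.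 Then at every point of $M$ and for every $|t|<\varepsilon$ (in particular at $t=0$) the following derivatives exist and, with all objects on the right-hand sides taken with respect to $g_t$, $$\partial_t\widetilde{\mathrm S}_{\rm ex}=\big\langle(\operatorname{div}\tilde H)\,g^\perp-\operatorname{div}\tilde h-\widetilde{\mathcal K}^\flat,\,B\big\rangle+\operatorname{div}\big(\langle\tilde h,B\rangle-(\operatorname{Tr}_gB)\,\tilde H\big),$$ $$\partial_t\mathrm S_{\rm ex}=-\langle\Phi_h,B\rangle,\qquad \partial_t\langle\tilde T,\tilde T\rangle=\langle2\,\widetilde{\mathcal T}^\flat,B\rangle,\qquad \partial_t\langle T,T\rangle=-\langle\Phi_T,B\rangle.$$ -/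

import Mathlib

open Set Bundle Module
open scoped Manifold ContDiff Topology

noncomputable section

namespace AlmostProduct

/-! ### Metric contraction on a vector space -/

section LinearAlgebra

variable {V : Type*} [AddCommGroup V] [Module ℝ V] [FiniteDimensional ℝ V] {F : Type*} [AddCommGroup F] [Module ℝ F]

/-- The contraction `∑ᵢⱼ Gⁱʲ β(bᵢ, bⱼ)` of a bilinear map `β` over a subspace `W` with respect to a
bilinear form `γ`, where `b` is a basis of `W` and `(Gⁱʲ)` is the inverse of the Gram matrix
`(γ(bᵢ, bⱼ))`.  When `γ` is non-degenerate on `W` this is the usual `∑ₐ εₐ β(eₐ, eₐ)` over any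
`γ`-orthonormal basis of `W`, see `metricTrace_eq_sum_orthonormal`. -/
def metricTrace (γ : V → V → ℝ) (W : Submodule ℝ V) (β : V → V → F) : F :=
  ∑ i, ∑ j,
    (Matrix.of fun i j => γ (finBasis ℝ W i : V) (finBasis ℝ W j : V))⁻¹ i j •
      β (finBasis ℝ W i : V) (finBasis ℝ W j : V)

theorem metricTrace_eq_sum_orthonormal (γ : V →ₗ[ℝ] V →ₗ[ℝ] ℝ) (W : Submodule ℝ V)
    (β : V →ₗ[ℝ] V →ₗ[ℝ] F) {k : ℕ} (e : Basis (Fin k) ℝ W)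
    (ε : Fin k → ℝ) (hε : ∀ a, ε a = 1 ∨ ε a = -1)
    (he : ∀ a b, γ (e a : V) (e b : V) = if a = b then ε a else 0) :
    metricTrace (fun u v => γ u v) W (fun u v => β u v)
      = ∑ a, ε a • β (e a : V) (e a : V) := by
  set b := finBasis ℝ W with hb
  set P := e.toMatrix b with hP
  set Q := b.toMatrix e with hQ
  have hPQ : P * Q = 1 := Basis.toMatrix_mul_toMatrix_flip e b
  have hQP : Q * P = 1 := Basis.toMatrix_mul_toMatrix_flip b e
  have hbe : ∀ i, (b i : V) = ∑ a, P a i • (e a : V) := by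
    intro i
    have := congrArg (fun w : W => (w : V)) (e.sum_toMatrix_smul_self b i)
    rw [← this]
    simp only [AddSubmonoidClass.coe_finsetSum, Submodule.coe_smul, hP]
  have heb : ∀ a, (e a : V) = ∑ i, Q i a • (b i : V) := by
    intro a
    have := congrArg (fun w : W => (w : V)) (b.sum_toMatrix_smul_self e a)
    rw [← this]
    simp only [AddSubmonoidClass.coe_finsetSum, Submodule.coe_smul, hQ]
  have hG : (Matrix.of fun i j => γ (b i : V) (b j : V)) = P.transpose * Matrix.diagonal ε * P := by
    ext i j
    rw [Matrix.of_apply, hbe i, hbe j, Matrix.mul_apply]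
    simp only [Matrix.mul_diagonal, Matrix.transpose_apply, map_sum, map_smul,
      LinearMap.sum_apply, LinearMap.smul_apply, he, smul_eq_mul]
    simp only [mul_ite, mul_zero, Finset.sum_ite_eq', Finset.mem_univ, if_true]
    exact Finset.sum_congr rfl fun a _ => by ring
  have hD : Matrix.diagonal ε * Matrix.diagonal ε = 1 := by
    rw [Matrix.diagonal_mul_diagonal, ← Matrix.diagonal_one]
    congr 1
    funext a
    rcases hε a with h | h <;> simp [h]
  have hinv : (Matrix.of fun i j => γ (b i : V) (b j : V))⁻¹
      = Q * Matrix.diagonal ε * Q.transpose := by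
    apply Matrix.inv_eq_right_inv
    calc (Matrix.of fun i j => γ (b i : V) (b j : V)) * (Q * Matrix.diagonal ε * Q.transpose)
        = P.transpose * Matrix.diagonal ε * (P * Q) * Matrix.diagonal ε * Q.transpose := by
          rw [hG]; simp only [Matrix.mul_assoc]
      _ = P.transpose * (Matrix.diagonal ε * Matrix.diagonal ε) * Q.transpose := by
          rw [hPQ]; simp only [Matrix.mul_assoc, Matrix.one_mul]
      _ = 1 := by
          rw [hD, Matrix.mul_one, ← Matrix.transpose_mul, hQP, Matrix.transpose_one]
  unfold metricTrace
  rw [← hb]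
  have hent : ∀ i j, (Q * Matrix.diagonal ε * Q.transpose) i j = ∑ a, Q i a * ε a * Q j a := by
    intro i j
    rw [Matrix.mul_apply]
    simp only [Matrix.mul_diagonal, Matrix.transpose_apply]
  simp only [hinv, hent]
  have hR : ∀ a, β (e a : V) (e a : V) = ∑ i, ∑ j, (Q i a * Q j a) • β (b i : V) (b j : V) := by
    intro a
    conv_lhs => rw [heb a]
    simp only [map_sum, map_smul, LinearMap.sum_apply, LinearMap.smul_apply, smul_smul,
      Finset.smul_sum]
    rw [Finset.sum_comm]
    exact Finset.sum_congr rfl fun i _ => Finset.sum_congr rfl fun j _ => by rw [mul_comm]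
  simp only [hR, Finset.smul_sum, Finset.sum_smul, smul_smul]
  rw [Finset.sum_comm' (t' := Finset.univ) (s' := fun _ => Finset.univ) (by simp)]
  rw [Finset.sum_comm]
  conv_rhs => rw [Finset.sum_comm]
  refine Finset.sum_congr rfl fun i _ => ?_
  conv_rhs => rw [Finset.sum_comm]
  refine Finset.sum_congr rfl fun j _ => Finset.sum_congr rfl fun a _ => ?_
  congr 1
  ring

end LinearAlgebra

/-! ### Tensors and the Levi-Civita connection on a pseudo-Riemannian manifold -/

section Geometry

variable {E : Type*} [NormedAddCommGroup E] [NormedSpace ℝ E] [FiniteDimensional ℝ E]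
  {M : Type*} [TopologicalSpace M] [ChartedSpace E M]

instance instFiniteDimensionalTangentSpace (x : M) :
    FiniteDimensional ℝ (TangentSpace 𝓘(ℝ, E) x) :=
  inferInstanceAs (FiniteDimensional ℝ E)

/-- Fields of bilinear forms on the tangent spaces which are continuous on each tangent space;
metrics are of this type. -/
abbrev FormField (E : Type*) [NormedAddCommGroup E] [NormedSpace ℝ E]
    (M : Type*) [TopologicalSpace M] [ChartedSpace E M] : Type _ :=
  ∀ x : M, TangentSpace 𝓘(ℝ, E) x →L[ℝ] TangentSpace 𝓘(ℝ, E) x →L[ℝ] ℝ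

/-- Vector fields (no regularity is required). -/
abbrev VField (E : Type*) [NormedAddCommGroup E] [NormedSpace ℝ E]
    (M : Type*) [TopologicalSpace M] [ChartedSpace E M] : Type _ :=
  ∀ x : M, TangentSpace 𝓘(ℝ, E) x

/-- `(0,2)`-tensor fields, written as functions of two tangent vectors. -/
abbrev Tensor02 (E : Type*) [NormedAddCommGroup E] [NormedSpace ℝ E]
    (M : Type*) [TopologicalSpace M] [ChartedSpace E M] : Type _ :=
  ∀ x : M, TangentSpace 𝓘(ℝ, E) x → TangentSpace 𝓘(ℝ, E) x → ℝ

/-- `(1,2)`-tensor fields, written as vector-valued functions of two tangent vectors. -/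
abbrev Tensor12 (E : Type*) [NormedAddCommGroup E] [NormedSpace ℝ E]
    (M : Type*) [TopologicalSpace M] [ChartedSpace E M] : Type _ :=
  ∀ x : M, TangentSpace 𝓘(ℝ, E) x → TangentSpace 𝓘(ℝ, E) x → TangentSpace 𝓘(ℝ, E) x

/-- `(1,1)`-tensor fields, written as vector-valued functions of a tangent vector. -/
abbrev Tensor11 (E : Type*) [NormedAddCommGroup E] [NormedSpace ℝ E]
    (M : Type*) [TopologicalSpace M] [ChartedSpace E M] : Type _ :=
  ∀ x : M, TangentSpace 𝓘(ℝ, E) x → TangentSpace 𝓘(ℝ, E) x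

/-- The contraction `∑ₐ εₐ β(eₐ, eₐ)` over a `g`-orthonormal basis of the subspace `W` of `T_x M`. -/
def trOn {F : Type*} [AddCommGroup F] [Module ℝ F] (g : FormField E M) (x : M)
    (W : Submodule ℝ (TangentSpace 𝓘(ℝ, E) x))
    (β : TangentSpace 𝓘(ℝ, E) x → TangentSpace 𝓘(ℝ, E) x → F) : F :=
  metricTrace (fun u v => g x u v) W β

/-- `Tr_g B = Tr B^♯`, the full metric trace of a `(0,2)`-tensor. -/
def trG (g : FormField E M) (B : Tensor02 E M) (x : M) : ℝ :=
  trOn g x ⊤ (B x)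

/-- The vector `η^♯` of a linear form `η`, with `g(η^♯, w) = η(w)`; in an orthonormal basis, `η^♯ = ∑ ε η(e) e`. -/
def sharp (g : FormField E M) (x : M) (η : TangentSpace 𝓘(ℝ, E) x → ℝ) :
    TangentSpace 𝓘(ℝ, E) x :=
  trOn g x ⊤ (fun w w' => η w • w')

/-- `B^♯`, the `(1,1)`-tensor with `g(B^♯ u, v) = B(u, v)`. -/
def sharpTensor (g : FormField E M) (B : Tensor02 E M) : Tensor11 E M :=
  fun x u => sharp g x (B x u)

/-- `L^♭`, the `(0,2)`-tensor `L^♭(u, v) = g(L u, v)`. -/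
def flatTensor (g : FormField E M) (L : Tensor11 E M) : Tensor02 E M :=
  fun x u v => g x (L x u) v

/-- The trace `Tr L = ∑ ε g(L e, e)` of a `(1,1)`-tensor. -/
def trEnd (g : FormField E M) (L : Tensor11 E M) (x : M) : ℝ :=
  trG g (flatTensor g L) x

/-- `⟨A, B⟩ = Tr (A^♯ B^♯)` for `(0,2)`-tensors. -/
def pairing (g : FormField E M) (A B : Tensor02 E M) (x : M) : ℝ :=
  trEnd g (fun y u => sharpTensor g A y (sharpTensor g B y u)) x

/-- The vector field `⟨P, B⟩ = ∑ ε_μ ε_ν B(e_μ, e_ν) P(e_μ, e_ν)` for a `(1,2)`-tensor `P` and a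
`(0,2)`-tensor `B`. -/
def pairingVec (g : FormField E M) (P : Tensor12 E M) (B : Tensor02 E M) : VField E M :=
  fun x => trOn g x ⊤ fun u u' => trOn g x ⊤ fun v v' => B x u v • P x u' v'

theorem trOn_add {F : Type*} [AddCommGroup F] [Module ℝ F] (g : FormField E M) (x : M)
    (W : Submodule ℝ (TangentSpace 𝓘(ℝ, E) x))
    (β β' : TangentSpace 𝓘(ℝ, E) x → TangentSpace 𝓘(ℝ, E) x → F) :
    trOn g x W (fun u v => β u v + β' u v) = trOn g x W β + trOn g x W β' := by
  simp only [trOn, metricTrace, smul_add, Finset.sum_add_distrib]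

theorem trOn_neg {F : Type*} [AddCommGroup F] [Module ℝ F] (g : FormField E M) (x : M)
    (W : Submodule ℝ (TangentSpace 𝓘(ℝ, E) x))
    (β : TangentSpace 𝓘(ℝ, E) x → TangentSpace 𝓘(ℝ, E) x → F) :
    trOn g x W (fun u v => - β u v) = - trOn g x W β := by
  simp only [trOn, metricTrace, smul_neg, Finset.sum_neg_distrib]

theorem trOn_mul (g : FormField E M) (x : M) (W : Submodule ℝ (TangentSpace 𝓘(ℝ, E) x)) (c : ℝ)
    (β : TangentSpace 𝓘(ℝ, E) x → TangentSpace 𝓘(ℝ, E) x → ℝ) :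
    trOn g x W (fun u v => c * β u v) = c * trOn g x W β := by
  simp only [trOn, metricTrace, smul_eq_mul, Finset.mul_sum, mul_left_comm c]

theorem trOn_comm {F : Type*} [AddCommGroup F] [Module ℝ F] (g : FormField E M) (x : M)
    (W W' : Submodule ℝ (TangentSpace 𝓘(ℝ, E) x))
    (β : TangentSpace 𝓘(ℝ, E) x → TangentSpace 𝓘(ℝ, E) x →
      TangentSpace 𝓘(ℝ, E) x → TangentSpace 𝓘(ℝ, E) x → F) :
    trOn g x W (fun u v => trOn g x W' (fun a b => β u v a b))
      = trOn g x W' (fun a b => trOn g x W (fun u v => β u v a b)) := by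
  simp only [trOn, metricTrace, Finset.smul_sum, smul_smul]
  rw [Finset.sum_congr rfl fun i _ => Finset.sum_comm, Finset.sum_comm]
  refine Finset.sum_congr rfl fun k _ => ?_
  rw [Finset.sum_congr rfl fun i _ => Finset.sum_comm, Finset.sum_comm]
  refine Finset.sum_congr rfl fun l _ => Finset.sum_congr rfl fun i _ =>
    Finset.sum_congr rfl fun j _ => ?_
  rw [mul_comm]

/-- The defining property of `η^♯`. -/
theorem apply_sharp (g : FormField E M) (x : M)
    (hn : ∀ u, (∀ v, g x u v = 0) → u = 0) (η : TangentSpace 𝓘(ℝ, E) x →ₗ[ℝ] ℝ)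
    (v : TangentSpace 𝓘(ℝ, E) x) : g x (sharp g x (fun w => η w)) v = η v := by
  set b := finBasis ℝ (⊤ : Submodule ℝ (TangentSpace 𝓘(ℝ, E) x)) with hb
  set G := Matrix.of fun i j => g x (b i : TangentSpace 𝓘(ℝ, E) x) (b j) with hG
  have hdet : G⁻¹ * G = 1 := by
    apply Matrix.nonsing_inv_mul
    rw [isUnit_iff_ne_zero]
    intro h0
    obtain ⟨c, hc, hcG⟩ := Matrix.exists_vecMul_eq_zero_iff.mpr h0
    apply hc
    have hz : (∑ i, c i • b i) = 0 := by
      apply Subtype.ext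
      apply hn
      intro v
      have hv : v = ((∑ j, b.repr ⟨v, trivial⟩ j • b j :
          (⊤ : Submodule ℝ (TangentSpace 𝓘(ℝ, E) x))) : TangentSpace 𝓘(ℝ, E) x) := by
        rw [b.sum_repr]
      have hj : ∀ j, g x ((∑ i, c i • b i :
          (⊤ : Submodule ℝ (TangentSpace 𝓘(ℝ, E) x))) : TangentSpace 𝓘(ℝ, E) x) (b j) = 0 := by
        intro j
        have := congrFun hcG j
        simp only [Matrix.vecMul, dotProduct, hG, Matrix.of_apply, Pi.zero_apply] at this
        simpa using this
      generalize ((∑ i, c i • b i : (⊤ : Submodule ℝ (TangentSpace 𝓘(ℝ, E) x))) :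
        TangentSpace 𝓘(ℝ, E) x) = w at hj ⊢
      rw [hv]
      generalize b.repr ⟨v, trivial⟩ = d
      rw [AddSubmonoidClass.coe_finsetSum, map_sum]
      refine Finset.sum_eq_zero fun j _ => ?_
      rw [Submodule.coe_smul, map_smul, hj, smul_zero]
    funext i
    exact Fintype.linearIndependent_iff.mp b.linearIndependent c hz i
  have hbj : ∀ j, g x (sharp g x (fun w => η w)) (b j) = η (b j) := by
    intro j
    have : g x (sharp g x (fun w => η w)) (b j)
        = ∑ i, (∑ k, G⁻¹ i k * G k j) * η (b i) := by
      simp only [sharp, trOn, metricTrace, ← hb, ← hG, map_sum, map_smul]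
      simp only [_root_.sum_apply, _root_.smul_apply, smul_eq_mul,
        Finset.sum_mul]
      refine Finset.sum_congr rfl fun i _ => Finset.sum_congr rfl fun k _ => ?_
      rw [hG, Matrix.of_apply]
      ring
    have h2 : ∀ i, ∑ k, G⁻¹ i k * G k j = (1 : Matrix _ _ ℝ) i j := by
      intro i
      rw [← hdet, Matrix.mul_apply]
    rw [this]
    simp [h2, Matrix.one_apply]
  have hv : v = ((∑ j, b.repr ⟨v, trivial⟩ j • b j :
      (⊤ : Submodule ℝ (TangentSpace 𝓘(ℝ, E) x))) : TangentSpace 𝓘(ℝ, E) x) := by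
    rw [b.sum_repr]
  rw [hv]
  generalize b.repr ⟨v, trivial⟩ = d
  rw [AddSubmonoidClass.coe_finsetSum, map_sum, map_sum η]
  refine Finset.sum_congr rfl fun j _ => ?_
  rw [Submodule.coe_smul, map_smul, map_smul, hbj]

/-- `⟨A, B⟩ = ∑ ε A(B^♯ e, e)`. -/
theorem pairing_eq (g : FormField E M) (x : M)
    (hn : ∀ u, (∀ v, g x u v = 0) → u = 0) (A B : Tensor02 E M)
    (hA : ∀ u, IsLinearMap ℝ (A x u)) :
    pairing g A B x = trOn g x ⊤ (fun u v => A x (sharpTensor g B x u) v) := by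
  have : ∀ u v, g x (sharpTensor g A x (sharpTensor g B x u)) v = A x (sharpTensor g B x u) v :=
    fun u v => apply_sharp g x hn ((hA (sharpTensor g B x u)).mk' _) v
  simp only [pairing, trEnd, trG]
  exact congrArg _ (funext fun u => funext fun v => this u v)

/-- `⟨a^♭ ⊗ a'^♭, B⟩ = B(a, a')` for symmetric `B`. -/
theorem trOn_flat_mul_flat (g : FormField E M) (x : M) (hs : ∀ u v, g x u v = g x v u)
    (hn : ∀ u, (∀ v, g x u v = 0) → u = 0) (B : Tensor02 E M)
    (β : TangentSpace 𝓘(ℝ, E) x →ₗ[ℝ] TangentSpace 𝓘(ℝ, E) x →ₗ[ℝ] ℝ)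
    (hB : ∀ u v, B x u v = β u v) (hBs : ∀ u v, B x u v = B x v u)
    (a a' : TangentSpace 𝓘(ℝ, E) x) :
    trOn g x ⊤ (fun u v => g x a (sharpTensor g B x u) * g x a' v) = B x a a' := by
  have h1 : ∀ u, g x a (sharpTensor g B x u) = β u a := by
    intro u
    rw [hs, sharpTensor, show B x u = fun v => β u v from funext (hB u)]
    exact apply_sharp g x hn (β u) a
  have h2 : ∀ c, g x (sharp g x (fun w => (β.flip a) w)) c = (β.flip a) c :=
    apply_sharp g x hn (β.flip a)
  have h3 : trOn g x ⊤ (fun u v => g x a (sharpTensor g B x u) * g x a' v)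
      = g x a' (sharp g x (fun w => (β.flip a) w)) := by
    simp only [h1, sharp, trOn, metricTrace, map_sum, map_smul, smul_eq_mul, LinearMap.flip_apply]
  rw [h3, hs, h2, hBs, hB, LinearMap.flip_apply]

variable [IsManifold 𝓘(ℝ, E) ∞ M]

/-- A vector field extending a tangent vector at `x`, smooth near `x` (it has constant components in
the chart at `x`).  It is only used inside expressions that depend on its value at `x` alone. -/
def ext {x : M} (v : TangentSpace 𝓘(ℝ, E) x) : VField E M :=
  FiberBundle.extend E v

/-- The derivative `X(f)` of a function along a tangent vector. -/
def dirDeriv {x : M} (v : TangentSpace 𝓘(ℝ, E) x) (f : M → ℝ) : ℝ :=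
  mvfderiv 𝓘(ℝ, E) f x v

/-- The right-hand side of the Koszul formula `2 g(∇_X Y, Z) = ⋯`. -/
def koszul (g : FormField E M) (X Y Z : VField E M) (x : M) : ℝ :=
  dirDeriv (X x) (fun y => g y (Y y) (Z y)) + dirDeriv (Y x) (fun y => g y (X y) (Z y))
    - dirDeriv (Z x) (fun y => g y (X y) (Y y))
    + g x (VectorField.mlieBracket 𝓘(ℝ, E) X Y x) (Z x)
    - g x (VectorField.mlieBracket 𝓘(ℝ, E) X Z x) (Y x)
    - g x (VectorField.mlieBracket 𝓘(ℝ, E) Y Z x) (X x)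

/-- The Levi-Civita connection of `g`: `∇_v Y` at `x`, for a tangent vector `v` at `x` and a vector
field `Y`, is the vector with `g(∇_v Y, w) = ½ koszul(X, Y, Z)` for any `X`, `Z` extending
`v`, `w`. -/
def nabla (g : FormField E M) {x : M} (v : TangentSpace 𝓘(ℝ, E) x) (Y : VField E M) :
    TangentSpace 𝓘(ℝ, E) x :=
  sharp g x fun w => (1 / 2) * koszul g (ext v) Y (ext w) x

/-- `div ξ = Tr (∇ ξ)`. -/
def divField (g : FormField E M) (ξ : VField E M) (x : M) : ℝ :=
  trEnd g (fun _ u => nabla g u ξ) x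

/-- `(∇_v P)(u, w) = ∇_v (P(U, W)) - P(∇_v U, w) - P(u, ∇_v W)` at `x`, where `U`, `W` extend
`u`, `w`. -/
def nablaTensor (g : FormField E M) (P : Tensor12 E M) {x : M}
    (v u w : TangentSpace 𝓘(ℝ, E) x) : TangentSpace 𝓘(ℝ, E) x :=
  nabla g v (fun y => P y (ext u y) (ext w y)) - P x (nabla g v (ext u)) w
    - P x u (nabla g v (ext w))

/-- The divergence of a `(1,2)`-tensor: `(div P)(u, w) = ∑ ε_μ g((∇_{e_μ} P)(u, w), e_μ)`, the sum
being over an orthonormal basis of the whole tangent space. -/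
def divTensor (g : FormField E M) (P : Tensor12 E M) : Tensor02 E M :=
  fun x u w => trOn g x ⊤ fun e e' => g x (nablaTensor g P e u w) e'

/-! ### Almost-product structures -/

/-- `D` is a smooth distribution (subbundle of `TM`) of rank `k`: near every point it has a frame
made of `k` smooth vector fields. -/
def IsSmoothDistribution (k : ℕ) (D : ∀ x : M, Submodule ℝ (TangentSpace 𝓘(ℝ, E) x)) : Prop :=
  ∀ x : M, ∃ U ∈ 𝓝 x, ∃ X : Fin k → VField E M,
    (∀ i, ContMDiffOn 𝓘(ℝ, E) 𝓘(ℝ, E).tangent ∞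
      (fun y => (⟨y, X i y⟩ : TangentBundle 𝓘(ℝ, E) M)) U) ∧
    ∀ y ∈ U, LinearIndependent ℝ (fun i => X i y) ∧
      Submodule.span ℝ (Set.range fun i => X i y) = D y

/-- A pair of complementary smooth distributions `top = D̃` and `perp = D` of ranks `n` and `p`. -/
structure Splitting (E : Type*) [NormedAddCommGroup E] [NormedSpace ℝ E]
    (M : Type*) [TopologicalSpace M] [ChartedSpace E M] [IsManifold 𝓘(ℝ, E) ∞ M] (n p : ℕ) where
  top : ∀ x : M, Submodule ℝ (TangentSpace 𝓘(ℝ, E) x)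
  perp : ∀ x : M, Submodule ℝ (TangentSpace 𝓘(ℝ, E) x)
  smooth_top : IsSmoothDistribution n top
  smooth_perp : IsSmoothDistribution p perp
  isCompl : ∀ x, IsCompl (top x) (perp x)

namespace Splitting

variable {n p : ℕ} (S : Splitting E M n p)

/-- The same pair with the roles of the two distributions exchanged.  Every notion below is defined
for `D̃ = S.top`; the notion marked with a tilde, i.e. the one of `D = S.perp`, is its instance at
`S.swap`. -/
def swap : Splitting E M p n where
  top := S.perp
  perp := S.top
  smooth_top := S.smooth_perp
  smooth_perp := S.smooth_top
  isCompl x := (S.isCompl x).symm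

/-- `v ↦ v^⊤`, the projection onto `D̃` along `D`. -/
def projTop (x : M) : TangentSpace 𝓘(ℝ, E) x →ₗ[ℝ] TangentSpace 𝓘(ℝ, E) x :=
  (S.top x).projection (S.perp x) (S.isCompl x)

/-- `v ↦ v^⊥`, the projection onto `D` along `D̃`. -/
def projPerp (x : M) : TangentSpace 𝓘(ℝ, E) x →ₗ[ℝ] TangentSpace 𝓘(ℝ, E) x :=
  (S.perp x).projection (S.top x) (S.isCompl x).symm

/-- A section of `D̃`, smooth near `x`, whose value at `x` is `v^⊤`. -/
def extTop {x : M} (v : TangentSpace 𝓘(ℝ, E) x) : VField E M :=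
  fun y => S.projTop y (ext v y)

/-- The component `g^⊥(u, v) = g(u^⊥, v^⊥)` of the metric. -/
def gPerp (g : FormField E M) : Tensor02 E M :=
  fun x u v => g x (S.projPerp x u) (S.projPerp x v)

/-- The integrability tensor `T(X, Y) = ½ [X, Y]^⊥` of `D̃`, `X, Y ∈ D̃`, extended to `TM` by
`T(u, v) = T(u^⊤, v^⊤)`. -/
def T : Tensor12 E M :=
  fun x u v => (1 / 2 : ℝ) •
    S.projPerp x (VectorField.mlieBracket 𝓘(ℝ, E) (S.extTop u) (S.extTop v) x)

/-- The second fundamental form `h(X, Y) = ½ (∇_X Y + ∇_Y X)^⊥` of `D̃`, `X, Y ∈ D̃`, extended to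
`TM` by `h(u, v) = h(u^⊤, v^⊤)`. -/
def h (g : FormField E M) : Tensor12 E M :=
  fun x u v => (1 / 2 : ℝ) •
    S.projPerp x (nabla g (S.projTop x u) (S.extTop v) + nabla g (S.projTop x v) (S.extTop u))

/-- The mean curvature vector field `H = ∑ₐ εₐ h(Eₐ, Eₐ)` of `D̃`. -/
def H (g : FormField E M) : VField E M :=
  fun x => trOn g x (S.top x) (S.h g x)

/-- `⟨P, P⟩ = ∑ₐᵦ εₐ εᵦ g(P(Eₐ, Eᵦ), P(Eₐ, Eᵦ))` over an orthonormal frame of `D̃`. -/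
def normSq (g : FormField E M) (P : Tensor12 E M) (x : M) : ℝ :=
  trOn g x (S.top x) fun a a' => trOn g x (S.top x) fun b b' => g x (P x a b) (P x a' b')

/-- The extrinsic scalar curvature `S_ex = g(H, H) - ⟨h, h⟩` of `D̃`. -/
def Sex (g : FormField E M) (x : M) : ℝ :=
  g x (S.H g x) (S.H g x) - S.normSq g (S.h g) x

/-- The Weingarten operator `A_z` of `D̃`: `g(A_z u, v) = g(h(u, v), z)`. -/
def A (g : FormField E M) {x : M} (z u : TangentSpace 𝓘(ℝ, E) x) : TangentSpace 𝓘(ℝ, E) x :=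
  sharp g x fun v => g x (S.h g x u v) z

/-- The operator `T^♯_z` of `D̃`: `g(T^♯_z u, v) = g(T(u, v), z)`. -/
def TSharp (g : FormField E M) {x : M} (z u : TangentSpace 𝓘(ℝ, E) x) :
    TangentSpace 𝓘(ℝ, E) x :=
  sharp g x fun v => g x (S.T x u v) z

/-- `𝓣 = ∑ᵢ εᵢ (T^♯ᵢ)²` over an orthonormal frame of `D`. -/
def TT (g : FormField E M) : Tensor11 E M :=
  fun x u => trOn g x (S.perp x) fun z z' => S.TSharp g z (S.TSharp g z' u)

/-- `𝓚 = ∑ᵢ εᵢ (T^♯ᵢ Aᵢ - Aᵢ T^♯ᵢ)` over an orthonormal frame of `D`. -/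
def KK (g : FormField E M) : Tensor11 E M :=
  fun x u => trOn g x (S.perp x) fun z z' =>
    S.TSharp g z (S.A g z' u) - S.A g z (S.TSharp g z' u)

/-- The symmetric `(0,2)`-tensor `Φ_h = H^♭ ⊗ H^♭ - ∑ₐᵦ εₐ εᵦ h(Eₐ, Eᵦ)^♭ ⊗ h(Eₐ, Eᵦ)^♭`, i.e. the
one with `⟨Φ_h, B⟩ = B(H, H) - ∑ₐᵦ εₐ εᵦ B(h(Eₐ, Eᵦ), h(Eₐ, Eᵦ))`, see `pairing_PhiH`. -/
def PhiH (g : FormField E M) : Tensor02 E M :=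
  fun x u v => g x (S.H g x) u * g x (S.H g x) v
    - trOn g x (S.top x) fun a a' => trOn g x (S.top x) fun b b' =>
        g x (S.h g x a b) u * g x (S.h g x a' b') v

/-- The symmetric `(0,2)`-tensor `Φ_T = - ∑ₐᵦ εₐ εᵦ T(Eₐ, Eᵦ)^♭ ⊗ T(Eₐ, Eᵦ)^♭`, i.e. the one with
`⟨Φ_T, B⟩ = - ∑ₐᵦ εₐ εᵦ B(T(Eₐ, Eᵦ), T(Eₐ, Eᵦ))`, see `pairing_PhiT`. -/
def PhiT (g : FormField E M) : Tensor02 E M :=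
  fun x u v => - trOn g x (S.top x) fun a a' => trOn g x (S.top x) fun b b' =>
    g x (S.T x a b) u * g x (S.T x a' b') v

theorem pairing_PhiT (g : FormField E M) (x : M) (hs : ∀ u v, g x u v = g x v u)
    (hn : ∀ u, (∀ v, g x u v = 0) → u = 0) (B : Tensor02 E M)
    (β : TangentSpace 𝓘(ℝ, E) x →ₗ[ℝ] TangentSpace 𝓘(ℝ, E) x →ₗ[ℝ] ℝ)
    (hB : ∀ u v, B x u v = β u v) (hBs : ∀ u v, B x u v = B x v u) :
    pairing g (S.PhiT g) B x = - trOn g x (S.top x) fun a a' => trOn g x (S.top x) fun b b' =>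
      B x (S.T x a b) (S.T x a' b') := by
  rw [pairing_eq g x hn]
  · simp only [PhiT, trOn_neg]
    rw [trOn_comm]
    simp only [trOn_comm g x ⊤, trOn_flat_mul_flat g x hs hn B β hB hBs]
  · intro u
    constructor
    · intro v w
      simp only [PhiT, map_add, mul_add, trOn_add, neg_add]
    · intro c v
      simp only [PhiT, map_smul, smul_eq_mul, mul_left_comm _ c, trOn_mul, mul_neg]

theorem pairing_PhiH (g : FormField E M) (x : M) (hs : ∀ u v, g x u v = g x v u)
    (hn : ∀ u, (∀ v, g x u v = 0) → u = 0) (B : Tensor02 E M)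
    (β : TangentSpace 𝓘(ℝ, E) x →ₗ[ℝ] TangentSpace 𝓘(ℝ, E) x →ₗ[ℝ] ℝ)
    (hB : ∀ u v, B x u v = β u v) (hBs : ∀ u v, B x u v = B x v u) :
    pairing g (S.PhiH g) B x = B x (S.H g x) (S.H g x)
      - trOn g x (S.top x) fun a a' => trOn g x (S.top x) fun b b' =>
        B x (S.h g x a b) (S.h g x a' b') := by
  rw [pairing_eq g x hn]
  · simp only [PhiH, sub_eq_add_neg, trOn_add, trOn_neg]
    rw [trOn_flat_mul_flat g x hs hn B β hB hBs, trOn_comm]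
    simp only [trOn_comm g x ⊤, trOn_flat_mul_flat g x hs hn B β hB hBs]
  · intro u
    constructor
    · intro v w
      simp only [PhiH, map_add, mul_add, trOn_add]
      ring
    · intro c v
      simp only [PhiH, map_smul, smul_eq_mul, mul_left_comm _ c, trOn_mul, mul_sub]

/-- `g_t` (`|t| < ε`) is a smooth `g^⊥`-variation of the metric `g_0`: a family of pseudo-Riemannian
metrics, smooth in `(t, x)`, adapted to the splitting (`D̃ ⊥ D` for every `g_t`), whose component
`g̃_t` along `D̃` does not depend on `t`. -/
structure IsPerpVariation (ε : ℝ) (g : ℝ → FormField E M) : Prop where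
  pos : 0 < ε
  smooth : ContMDiffOn (𝓘(ℝ, ℝ).prod 𝓘(ℝ, E)) (𝓘(ℝ, E).prod 𝓘(ℝ, E →L[ℝ] E →L[ℝ] ℝ)) ∞
    (fun q : ℝ × M => TotalSpace.mk' (E →L[ℝ] E →L[ℝ] ℝ)
      (E := fun x : M => TangentSpace 𝓘(ℝ, E) x →L[ℝ] TangentSpace 𝓘(ℝ, E) x →L[ℝ] ℝ)
      q.2 (g q.1 q.2)) (Ioo (-ε) ε ×ˢ univ)
  symm : ∀ t ∈ Ioo (-ε) ε, ∀ x u v, g t x u v = g t x v u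
  nondegenerate : ∀ t ∈ Ioo (-ε) ε, ∀ x u, (∀ v, g t x u v = 0) → u = 0
  adapted : ∀ t ∈ Ioo (-ε) ε, ∀ x, ∀ u ∈ S.top x, ∀ v ∈ S.perp x, g t x u v = 0
  top_const : ∀ t ∈ Ioo (-ε) ε, ∀ x, ∀ u ∈ S.top x, ∀ v ∈ S.top x, g t x u v = g 0 x u v

end Splitting

/-- The infinitesimal variation `B_t = ∂_t g_t`. -/
def infVar (g : ℝ → FormField E M) (t : ℝ) : Tensor02 E M :=
  fun x u v => deriv (fun s => g s x u v) t

end Geometry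

end AlmostProduct

end

/-! Everything is written in bases and local frames chosen independently of the metric, so that time
derivatives fall only on Gram matrices. Let `S.top` be the distribution whose tensors `h` and `T`
are considered, `b` a basis of it at `x`, `c` a basis of `S.perp x`, `G` and `K` their Gram
matrices, `ηₐ` and `τₐ` the matrices of the components of `h` and `T` along `c a`. Then `S_ex = ∑
Kᵃᵃ' (tr(G⁻¹ηₐ) tr(G⁻¹ηₐ') - tr(G⁻¹ηₐG⁻¹ηₐ'))` (`Sex_eq`), and `⟨T, T⟩` has a similar form
(`normSq_eq`). The tensor `T` is a Lie bracket and needs no metric, while `h` is minus half a Lie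
derivative of the metric: `ηₐ = -½(cₐ(G) - Cₐᵀ G - G Cₐ)`, where `Cₐ` comes from Lie brackets alone
(`compMatrix_h_eq`).

There are two regimes. If the metric varies only on `S.top` (`PerpConst S`, used for the tilded
objects through `S.swap`), then `K` and `τₐ` are constant, `G' = B`, and since the time derivative
commutes with directional derivatives (`mixed_partial`), `ηₐ' = -½(cₐ(B) - Cₐᵀ B - B Cₐ)`. On the
other side, the Leibniz rule applied to `div(⟨h, B⟩ - (Tr B) H)` produces the derivatives of
`G⁻¹BG⁻¹` and of `Tr B` along `D` (`divField_variation`), together with multiples of `div H` and of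
the divergences of the fields `h(Xᵢ, Xⱼ)`; these multiples cancel against `⟨(div H) g^⊥ - div h, B⟩`
(`pairing_variation`). The connection coefficients inside `div h` bring in `T`, because `∇_Z X = [Z,
X] + ∇_X Z`, and the term `𝓚` removes that contribution. What remains is two trace identities,
`two_mul_trace_deriv` and `neg_two_mul_trace_deriv`. For `⟨T, T⟩` only `G⁻¹` moves, which gives `2
𝓣`.

If the metric varies only on `S.perp` (`PerpConst S.swap`), the contractions over `S.top` are
constant. The vectors `T(u, v)` are fixed, so their scalar products vary by `+B`. The vectors `h(u,
v)` move, but the linear forms `g(h(u, v), ·)` on `S.perp` are fixed (`metric_h_eq`), so their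
scalar products vary through the inverse metric, that is by `-B` (`hasDerivAt_metric`). -/

noncomputable section

set_option linter.unusedSectionVars false

namespace AlmostProduct

/-! ### Bilinear maps and metric contractions in arbitrary bases. -/

section LinearAlgebra

variable {V : Type*} [AddCommGroup V] [Module ℝ V] {F : Type*} [AddCommGroup F] [Module ℝ F]

/-- A function of two vectors which is linear in each of them. -/
structure IsBilin (β : V → V → F) : Prop where
  left : ∀ v, IsLinearMap ℝ (fun u => β u v)
  right : ∀ u, IsLinearMap ℝ (β u)

namespace IsBilin

theorem sum_left {β : V → V → F} (hβ : IsBilin β) {ι : Type*} (s : Finset ι) (c : ι → ℝ)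
    (u : ι → V) (v : V) : β (∑ i ∈ s, c i • u i) v = ∑ i ∈ s, c i • β (u i) v := by
  refine (map_sum ((hβ.left v).mk' _) (fun i => c i • u i) s).trans ?_
  exact Finset.sum_congr rfl fun i _ => (hβ.left v).map_smul _ _

theorem sum_right {β : V → V → F} (hβ : IsBilin β) {ι : Type*} (s : Finset ι) (c : ι → ℝ)
    (u : V) (v : ι → V) : β u (∑ i ∈ s, c i • v i) = ∑ i ∈ s, c i • β u (v i) := by
  refine (map_sum ((hβ.right u).mk' _) (fun i => c i • v i) s).trans ?_
  exact Finset.sum_congr rfl fun i _ => (hβ.right u).map_smul _ _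

theorem zero_left {β : V → V → F} (hβ : IsBilin β) (v : V) : β 0 v = 0 := (hβ.left v).map_zero
theorem zero_right {β : V → V → F} (hβ : IsBilin β) (v : V) : β v 0 = 0 := (hβ.right v).map_zero

theorem add {β β' : V → V → F} (h : IsBilin β) (h' : IsBilin β') :
    IsBilin (fun u v => β u v + β' u v) :=
  ⟨fun v => ⟨fun a b => by simp only [(h.left v).map_add, (h'.left v).map_add]; abel,
      fun c a => by simp only [(h.left v).map_smul, (h'.left v).map_smul, smul_add]⟩,
    fun u => ⟨fun a b => by simp only [(h.right u).map_add, (h'.right u).map_add]; abel,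
      fun c a => by simp only [(h.right u).map_smul, (h'.right u).map_smul, smul_add]⟩⟩

theorem smul {β : V → V → F} (h : IsBilin β) (r : ℝ) : IsBilin (fun u v => r • β u v) :=
  ⟨fun v => ⟨fun a b => by simp only [(h.left v).map_add, smul_add],
      fun c a => by simp only [(h.left v).map_smul, smul_comm r]⟩,
    fun u => ⟨fun a b => by simp only [(h.right u).map_add, smul_add],
      fun c a => by simp only [(h.right u).map_smul, smul_comm r]⟩⟩

theorem neg {β : V → V → F} (h : IsBilin β) : IsBilin (fun u v => - β u v) := by
  simpa using h.smul (-1)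

theorem sub {β β' : V → V → F} (h : IsBilin β) (h' : IsBilin β') :
    IsBilin (fun u v => β u v - β' u v) := by
  simpa [sub_eq_add_neg] using h.add h'.neg

theorem comp {β : V → V → F} (h : IsBilin β) {l l' : V → V} (hl : IsLinearMap ℝ l)
    (hl' : IsLinearMap ℝ l') : IsBilin (fun u v => β (l u) (l' v)) :=
  ⟨fun v => ⟨fun a b => by simp only [hl.map_add, (h.left _).map_add],
      fun c a => by simp only [hl.map_smul, (h.left _).map_smul]⟩,
    fun u => ⟨fun a b => by simp only [hl'.map_add, (h.right _).map_add],
      fun c a => by simp only [hl'.map_smul, (h.right _).map_smul]⟩⟩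

theorem map {F' : Type*} [AddCommGroup F'] [Module ℝ F'] {β : V → V → F} (h : IsBilin β)
    {l : F → F'} (hl : IsLinearMap ℝ l) : IsBilin (fun u v => l (β u v)) :=
  ⟨fun v => ⟨fun a b => by simp only [(h.left v).map_add, hl.map_add],
      fun c a => by simp only [(h.left v).map_smul, hl.map_smul]⟩,
    fun u => ⟨fun a b => by simp only [(h.right u).map_add, hl.map_add],
      fun c a => by simp only [(h.right u).map_smul, hl.map_smul]⟩⟩

theorem sum {ι : Type*} (s : Finset ι) {β : ι → V → V → F} (h : ∀ i, IsBilin (β i)) :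
    IsBilin (fun u v => ∑ i ∈ s, β i u v) :=
  ⟨fun v => ⟨fun a b => by simp only [((h _).left v).map_add, Finset.sum_add_distrib],
      fun c a => by simp only [((h _).left v).map_smul, Finset.smul_sum]⟩,
    fun u => ⟨fun a b => by simp only [((h _).right u).map_add, Finset.sum_add_distrib],
      fun c a => by simp only [((h _).right u).map_smul, Finset.smul_sum]⟩⟩

end IsBilin

variable [FiniteDimensional ℝ V]

/-- Under a change of basis `P` with inverse `Q`, the Gram matrix becomes `Pᵀ G P`, whose inverse is
`Q G⁻¹ Qᵀ`; the factors `Q` are absorbed by the bilinear map. This frees contractions from the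
arbitrary `finBasis` and from orthonormality. -/
theorem metricTrace_eq_sum_basis {γ : V → V → ℝ} (hγ : IsBilin γ) (W : Submodule ℝ V)
    {β : V → V → F} (hβ : IsBilin β) {ι : Type*} [Fintype ι] [DecidableEq ι] (e : Basis ι ℝ W)
    (hdet : IsUnit (Matrix.of fun i j => γ (e i : V) (e j : V)).det) :
    metricTrace γ W β = ∑ i, ∑ j, (Matrix.of fun i j => γ (e i : V) (e j : V))⁻¹ i j •
      β (e i : V) (e j : V) := by
  set b := finBasis ℝ W with hb
  set P := e.toMatrix b with hP
  set Q := b.toMatrix e with hQ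
  set G := Matrix.of fun i j => γ (e i : V) (e j : V) with hG
  have hPQ : P * Q = 1 := Basis.toMatrix_mul_toMatrix_flip e b
  have hQP : Q * P = 1 := Basis.toMatrix_mul_toMatrix_flip b e
  have hbe : ∀ i, (b i : V) = ∑ a, P a i • (e a : V) := by
    intro i
    have := congrArg (fun w : W => (w : V)) (e.sum_toMatrix_smul_self b i)
    rw [← this]
    simp only [AddSubmonoidClass.coe_finsetSum, Submodule.coe_smul, hP]
  have heb : ∀ a, (e a : V) = ∑ i, Q i a • (b i : V) := by
    intro a
    have := congrArg (fun w : W => (w : V)) (b.sum_toMatrix_smul_self e a)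
    rw [← this]
    simp only [AddSubmonoidClass.coe_finsetSum, Submodule.coe_smul, hQ]
  have hG0 : (Matrix.of fun i j => γ (b i : V) (b j : V)) = P.transpose * G * P := by
    ext i j
    rw [Matrix.of_apply, hbe i, hbe j, hγ.sum_left, Matrix.mul_apply]
    simp only [hγ.sum_right, Matrix.mul_apply, Matrix.transpose_apply, hG, Matrix.of_apply,
      smul_eq_mul, Finset.sum_mul, Finset.mul_sum]
    rw [Finset.sum_comm]
    exact Finset.sum_congr rfl fun a _ => Finset.sum_congr rfl fun c _ => by ring
  have hinv : (Matrix.of fun i j => γ (b i : V) (b j : V))⁻¹ = Q * G⁻¹ * Q.transpose := by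
    apply Matrix.inv_eq_right_inv
    calc (Matrix.of fun i j => γ (b i : V) (b j : V)) * (Q * G⁻¹ * Q.transpose)
        = P.transpose * G * (P * Q) * G⁻¹ * Q.transpose := by
          rw [hG0]; simp only [Matrix.mul_assoc]
      _ = P.transpose * (G * G⁻¹) * Q.transpose := by
          rw [hPQ]; simp only [Matrix.mul_assoc, Matrix.one_mul]
      _ = 1 := by
          rw [Matrix.mul_nonsing_inv _ hdet, Matrix.mul_one, ← Matrix.transpose_mul, hQP,
            Matrix.transpose_one]
  unfold metricTrace
  rw [← hb]
  have hent : ∀ i j, (Q * G⁻¹ * Q.transpose) i j = ∑ a, ∑ c, Q i a * G⁻¹ a c * Q j c := by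
    intro i j
    simp only [Matrix.mul_apply, Matrix.transpose_apply, Finset.sum_mul]
    rw [Finset.sum_comm]
  have hR : ∀ a c, β (e a : V) (e c : V) = ∑ i, ∑ j, (Q i a * Q j c) • β (b i : V) (b j : V) := by
    intro a c
    conv_lhs => rw [heb a, heb c, hβ.sum_left]
    simp only [hβ.sum_right, Finset.smul_sum, smul_smul]
  simp only [hinv, hent, hR, Finset.smul_sum, Finset.sum_smul, smul_smul]
  rw [Finset.sum_congr rfl fun i _ => Finset.sum_comm]
  rw [Finset.sum_comm]
  refine Finset.sum_congr rfl fun a _ => ?_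
  rw [Finset.sum_congr rfl fun i _ => Finset.sum_comm]
  rw [Finset.sum_comm]
  refine Finset.sum_congr rfl fun c _ => Finset.sum_congr rfl fun i _ =>
    Finset.sum_congr rfl fun j _ => ?_
  congr 1
  ring

/-- The basis of `V` obtained from bases of two complementary subspaces. -/
def complBasis {W N : Submodule ℝ V} (h : IsCompl W N) {ι κ : Type*} (e : Basis ι ℝ W)
    (f : Basis κ ℝ N) : Basis (ι ⊕ κ) ℝ V :=
  (e.prod f).map (Submodule.prodEquivOfIsCompl W N h)

theorem complBasis_inl {W N : Submodule ℝ V} (h : IsCompl W N) {ι κ : Type*} (e : Basis ι ℝ W)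
    (f : Basis κ ℝ N) (i : ι) : complBasis h e f (Sum.inl i) = (e i : V) := by
  simp [complBasis]

theorem complBasis_inr {W N : Submodule ℝ V} (h : IsCompl W N) {ι κ : Type*} (e : Basis ι ℝ W)
    (f : Basis κ ℝ N) (i : κ) : complBasis h e f (Sum.inr i) = (f i : V) := by
  simp [complBasis]

/-- The Gram matrix of a basis of a subspace on which the form is non-degenerate is invertible. -/
theorem isUnit_det_gram {γ : V → V → ℝ} (hγ : IsBilin γ) {W : Submodule ℝ V}
    (hn : ∀ u ∈ W, (∀ v ∈ W, γ u v = 0) → u = 0)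
    {ι : Type*} [Fintype ι] [DecidableEq ι] (e : Basis ι ℝ W) :
    IsUnit (Matrix.of fun i j => γ (e i : V) (e j : V)).det := by
  rw [isUnit_iff_ne_zero]
  intro h0
  obtain ⟨c, hc, hcG⟩ := Matrix.exists_vecMul_eq_zero_iff.mpr h0
  apply hc
  have hz : (∑ i, c i • e i) = 0 := by
    apply Subtype.ext
    refine hn _ (Subtype.mem _) fun v hv => ?_
    have hv' : v = ∑ j, e.repr ⟨v, hv⟩ j • (e j : V) := by
      have := congrArg (fun w : W => (w : V)) (e.sum_repr ⟨v, hv⟩)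
      simpa only [AddSubmonoidClass.coe_finsetSum, Submodule.coe_smul] using this.symm
    rw [hv', hγ.sum_right]
    refine Finset.sum_eq_zero fun j _ => ?_
    have := congrFun hcG j
    simp only [Matrix.vecMul, dotProduct, Matrix.of_apply, Pi.zero_apply] at this
    have h2 : γ ((∑ i, c i • e i : W) : V) (e j : V) = 0 := by
      simp only [AddSubmonoidClass.coe_finsetSum, Submodule.coe_smul]
      rw [hγ.sum_left]
      simpa using this
    rw [h2, smul_zero]
  funext i
  exact Fintype.linearIndependent_iff.mp e.linearIndependent c hz i

/-- In a basis adapted to two orthogonal complements the Gram matrix is block diagonal, and so is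
its inverse. -/
theorem metricTrace_top {γ : V → V → ℝ} (hγ : IsBilin γ) {W N : Submodule ℝ V} (h : IsCompl W N)
    (hWN : ∀ u ∈ W, ∀ v ∈ N, γ u v = 0) (hNW : ∀ u ∈ W, ∀ v ∈ N, γ v u = 0)
    (hW : ∀ u ∈ W, (∀ v ∈ W, γ u v = 0) → u = 0) (hN : ∀ u ∈ N, (∀ v ∈ N, γ u v = 0) → u = 0)
    {β : V → V → F} (hβ : IsBilin β) :
    metricTrace γ ⊤ β = metricTrace γ W β + metricTrace γ N β := by
  classical
  set e := finBasis ℝ W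
  set f := finBasis ℝ N
  set G := Matrix.of fun i j => γ (e i : V) (e j : V) with hG
  set K := Matrix.of fun i j => γ (f i : V) (f j : V) with hK
  have hGu : IsUnit G.det := isUnit_det_gram hγ hW e
  have hKu : IsUnit K.det := isUnit_det_gram hγ hN f
  set c : Basis _ ℝ (⊤ : Submodule ℝ V) := (complBasis h e f).map Submodule.topEquiv.symm with hc
  have hcl : ∀ i, (c (Sum.inl i) : V) = e i := fun i => by
    simp [hc, complBasis_inl]
  have hcr : ∀ i, (c (Sum.inr i) : V) = f i := fun i => by
    simp [hc, complBasis_inr]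
  have hgram : (Matrix.of fun i j => γ (c i : V) (c j : V)) = Matrix.fromBlocks G 0 0 K := by
    ext i j
    rcases i with i | i <;> rcases j with j | j <;>
      simp [hcl, hcr, hG, hK, hWN _ (e _).2 _ (f _).2, hNW _ (e _).2 _ (f _).2]
  have hmul : Matrix.fromBlocks G 0 0 K * Matrix.fromBlocks G⁻¹ 0 0 K⁻¹ = 1 := by
    rw [Matrix.fromBlocks_multiply]
    simp [Matrix.mul_nonsing_inv _ hGu, Matrix.mul_nonsing_inv _ hKu]
  rw [metricTrace_eq_sum_basis hγ ⊤ hβ c, hgram, Matrix.inv_eq_right_inv hmul,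
    metricTrace_eq_sum_basis hγ W hβ e hGu, metricTrace_eq_sum_basis hγ N hβ f hKu]
  · simp only [Fintype.sum_sum_type, hcl, hcr, Matrix.fromBlocks_apply₁₁, Matrix.fromBlocks_apply₁₂,
      Matrix.fromBlocks_apply₂₁, Matrix.fromBlocks_apply₂₂, Matrix.zero_apply, zero_smul,
      Finset.sum_const_zero, add_zero, zero_add]
    rfl
  · rw [hgram]
    exact Matrix.isUnit_det_of_right_inverse hmul

/-- A linearly independent family spanning a subspace is a basis of it. -/
theorem exists_basis_of_span {W : Submodule ℝ V} {ι : Type*} {X : ι → V}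
    (hX : LinearIndependent ℝ X) (hW : Submodule.span ℝ (Set.range X) = W) :
    ∃ b : Basis ι ℝ W, ∀ i, (b i : V) = X i := by
  subst hW
  exact ⟨Basis.span hX, fun i => by rw [Basis.span_apply]⟩

end LinearAlgebra

/-! ### Smoothness of the matrix inverse and derivatives of matrix curves. -/

section MatrixCalculus

variable {ι : Type*} [Fintype ι] [DecidableEq ι]

theorem contDiff_det (k : ℕ∞ω) : ContDiff ℝ k (fun A : ι → ι → ℝ => (Matrix.of A).det) := by
  simp only [Matrix.det_apply, Matrix.of_apply]
  refine ContDiff.sum fun σ _ => ContDiff.const_smul _ (contDiff_prod fun i _ => ?_)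
  fun_prop

/-- Cramer's rule: an entry of the inverse is the quotient of two determinants, polynomial in the
entries of the matrix. -/
theorem contDiffAt_inv_apply (k : ℕ∞ω) {A : ι → ι → ℝ} (hA : IsUnit (Matrix.of A).det) (i j : ι) :
    ContDiffAt ℝ k (fun A : ι → ι → ℝ => (Matrix.of A)⁻¹ i j) A := by
  have : (fun A : ι → ι → ℝ => (Matrix.of A)⁻¹ i j)
      = fun A => ((Matrix.of A).det)⁻¹ * ((Matrix.of A).updateRow j (Pi.single i 1)).det := by
    funext A
    rw [Matrix.inv_def, Matrix.smul_apply, Matrix.adjugate_apply, Ring.inverse_eq_inv', smul_eq_mul]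
  rw [this]
  refine (ContDiffAt.inv (contDiff_det k).contDiffAt hA.ne_zero).mul ?_
  have h2 : (fun A : ι → ι → ℝ => ((Matrix.of A).updateRow j (Pi.single i 1)).det)
      = (fun A : ι → ι → ℝ => (Matrix.of A).det) ∘ fun A => Function.update A j (Pi.single i 1) := by
    rfl
  rw [h2]
  refine ((contDiff_det k).comp ?_).contDiffAt
  rw [contDiff_pi]
  intro l
  by_cases hl : l = j
  · subst hl; simpa using contDiff_const
  · simp only [Function.update_of_ne hl]; fun_prop

/-- The derivative of a matrix-valued function is understood entrywise. -/
def HasMatDeriv {κ : Type*} (A : ℝ → Matrix ι κ ℝ) (A' : Matrix ι κ ℝ) (t : ℝ) : Prop :=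
  ∀ i j, HasDerivAt (fun s => A s i j) (A' i j) t

namespace HasMatDeriv

variable {A B : ℝ → Matrix ι ι ℝ} {A' B' : Matrix ι ι ℝ} {t : ℝ}

theorem mul (hA : HasMatDeriv A A' t) (hB : HasMatDeriv B B' t) :
    HasMatDeriv (fun s => A s * B s) (A' * B t + A t * B') t := by
  intro i j
  simp only [Matrix.mul_apply, Matrix.add_apply, ← Finset.sum_add_distrib]
  exact HasDerivAt.fun_sum fun k _ => (hA i k).mul (hB k j)

theorem sub (hA : HasMatDeriv A A' t) (hB : HasMatDeriv B B' t) :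
    HasMatDeriv (fun s => A s - B s) (A' - B') t := fun i j => (hA i j).sub (hB i j)

theorem smul (hA : HasMatDeriv A A' t) (c : ℝ) :
    HasMatDeriv (fun s => c • A s) (c • A') t := fun i j => (hA i j).const_mul c

theorem const (A : Matrix ι ι ℝ) : HasMatDeriv (fun _ => A) 0 t := fun _ _ => hasDerivAt_const t _

theorem trace (hA : HasMatDeriv A A' t) :
    HasDerivAt (fun s => (A s).trace) A'.trace t := by
  simp only [Matrix.trace, Matrix.diag]
  exact HasDerivAt.fun_sum fun k _ => hA k k

/-- Differentiability comes from Cramer's rule; the value of the derivative is then forced by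
differentiating `A⁻¹ A = 1`, valid near `t` because the determinant stays nonzero. -/
theorem inv (hA : HasMatDeriv A A' t) (hu : IsUnit (A t).det) :
    HasMatDeriv (fun s => (A s)⁻¹) (-((A t)⁻¹ * A' * (A t)⁻¹)) t := by
  have hA0 : HasDerivAt (fun s => fun i j => A s i j) (fun i j => A' i j) t :=
    hasDerivAt_pi.2 fun i => hasDerivAt_pi.2 fun j => hA i j
  have hd : ∀ i j, DifferentiableAt ℝ (fun s => (A s)⁻¹ i j) t := by
    intro i j
    exact DifferentiableAt.comp t (f := fun s i j => A s i j)
      ((contDiffAt_inv_apply 1 (A := fun i j => A t i j) hu i j).differentiableAt one_ne_zero) hA0.differentiableAt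
  set D : Matrix ι ι ℝ := Matrix.of fun i j => deriv (fun s => (A s)⁻¹ i j) t with hD
  have hDd : HasMatDeriv (fun s => (A s)⁻¹) D t := fun i j => (hd i j).hasDerivAt
  have hev : ∀ᶠ s in 𝓝 t, IsUnit (A s).det := by
    have hc : ContinuousAt (fun s => (A s).det) t :=
      (((contDiff_det 1).differentiable one_ne_zero fun i j => A t i j).comp t (f := fun s i j => A s i j)
        hA0.differentiableAt).continuousAt
    filter_upwards [hc.eventually_ne hu.ne_zero] with s hs
    exact isUnit_iff_ne_zero.2 hs
  have hprod := hDd.mul hA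
  have hz : D * A t + (A t)⁻¹ * A' = 0 := by
    ext i j
    refine (hprod i j).unique ?_
    refine (hasDerivAt_const t ((1 : Matrix ι ι ℝ) i j)).congr_of_eventuallyEq ?_
    filter_upwards [hev] with s hs
    rw [Matrix.nonsing_inv_mul _ hs]
  have : D = -((A t)⁻¹ * A' * (A t)⁻¹) := by
    have h1 : D * A t * (A t)⁻¹ = -((A t)⁻¹ * A') * (A t)⁻¹ := by
      rw [eq_neg_of_add_eq_zero_left hz]
    rwa [Matrix.mul_assoc, Matrix.mul_nonsing_inv _ hu, Matrix.mul_one, Matrix.neg_mul] at h1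
  rwa [← this]

end HasMatDeriv
end MatrixCalculus

/-! ### The Levi-Civita connection from the Koszul formula. -/

section Connection

variable {E : Type*} [NormedAddCommGroup E] [NormedSpace ℝ E] [FiniteDimensional ℝ E]
  {M : Type*} [TopologicalSpace M] [ChartedSpace E M]

/-- A function is differentiable at a point. -/
abbrev DiffFun (f : M → ℝ) (x : M) : Prop := MDifferentiableAt 𝓘(ℝ, E) 𝓘(ℝ, ℝ) f x

variable [IsManifold 𝓘(ℝ, E) ∞ M]

/-- A vector field is `C^k` at a point. -/
abbrev CDiffField (k : ℕ∞ω) (Y : VField E M) (x : M) : Prop :=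
  ContMDiffAt 𝓘(ℝ, E) (𝓘(ℝ, E).prod 𝓘(ℝ, E)) k (fun y => TotalSpace.mk' E y (Y y)) x

/-- A vector field is differentiable at a point. -/
abbrev DiffField (Y : VField E M) (x : M) : Prop :=
  MDifferentiableAt 𝓘(ℝ, E) (𝓘(ℝ, E).prod 𝓘(ℝ, E)) (fun y => TotalSpace.mk' E y (Y y)) x

/-- A smooth pseudo-Riemannian metric. -/
structure IsSmoothMetric (g : FormField E M) : Prop where
  smooth : ContMDiff 𝓘(ℝ, E) (𝓘(ℝ, E).prod 𝓘(ℝ, E →L[ℝ] E →L[ℝ] ℝ)) ∞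
    (fun y : M => TotalSpace.mk' (E →L[ℝ] E →L[ℝ] ℝ)
      (E := fun x : M => TangentSpace 𝓘(ℝ, E) x →L[ℝ] TangentSpace 𝓘(ℝ, E) x →L[ℝ] ℝ) y (g y))
  symm : ∀ x u v, g x u v = g x v u
  nondegenerate : ∀ x u, (∀ v, g x u v = 0) → u = 0

theorem isBilin_metric (g : FormField E M) (x : M) : IsBilin (fun u v => g x u v) :=
  ⟨fun v => ⟨fun a b => by simp, fun c a => by simp⟩, fun u => ⟨fun a b => by simp, fun c a => by simp⟩⟩

theorem diffField_add {Y Z : VField E M} {x : M} (hY : DiffField Y x) (hZ : DiffField Z x) :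
    DiffField (Y + Z) x :=
  mdifferentiableAt_add_section hY hZ

theorem diffField_smul {Y : VField E M} {x : M} {f : M → ℝ} (hf : DiffFun (E := E) f x)
    (hY : DiffField Y x) : DiffField (f • Y) x :=
  hf.smul_section hY

theorem diffField_const_smul {Y : VField E M} {x : M} (c : ℝ) (hY : DiffField Y x) :
    DiffField (c • Y) x :=
  diffField_smul (f := fun _ => c) mdifferentiableAt_const hY

theorem diffField_ext {x : M} (v : TangentSpace 𝓘(ℝ, E) x) : DiffField (ext v) x :=
  FiberBundle.mdifferentiableAt_extend ..

theorem cDiffField_ext (k : ℕ∞) {x : M} (v : TangentSpace 𝓘(ℝ, E) x) : CDiffField k (ext v) x := by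
  have : ContMDiffVectorBundle k E (TangentSpace 𝓘(ℝ, E) : M → Type _) 𝓘(ℝ, E) :=
    ContMDiffVectorBundle.of_le (n := ∞) (by exact_mod_cast le_top)
  exact FiberBundle.contMDiffAt_extend (k := k) 𝓘(ℝ, E) E v

@[simp] theorem ext_self {x : M} (v : TangentSpace 𝓘(ℝ, E) x) : ext v x = v :=
  FiberBundle.extend_apply_self E v

/-- Holds only near `x`: `ext` has constant components in the trivialization at `x`, whose inverse
is linear on the base set and nowhere else controlled. -/
theorem ext_add {x : M} (v w : TangentSpace 𝓘(ℝ, E) x) :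
    ext (v + w) =ᶠ[𝓝 x] ext v + ext w := by
  set e := trivializationAt E (TangentSpace 𝓘(ℝ, E) : M → Type _) x
  have h : x ∈ e.baseSet := FiberBundle.mem_baseSet_trivializationAt' x
  filter_upwards [e.open_baseSet.mem_nhds h] with y hy
  simp only [ext, FiberBundle.extend, Pi.add_apply]
  rw [← e.symmₗ_apply (R := ℝ) hy, ← e.symmₗ_apply (R := ℝ) hy, ← e.symmₗ_apply (R := ℝ) hy,
    ← map_add]
  exact congrArg _ ((e.linear ℝ h).map_add v w)

theorem ext_smul {x : M} (c : ℝ) (v : TangentSpace 𝓘(ℝ, E) x) :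
    ext (c • v) =ᶠ[𝓝 x] c • ext v := by
  set e := trivializationAt E (TangentSpace 𝓘(ℝ, E) : M → Type _) x
  have h : x ∈ e.baseSet := FiberBundle.mem_baseSet_trivializationAt' x
  filter_upwards [e.open_baseSet.mem_nhds h] with y hy
  simp only [ext, FiberBundle.extend, Pi.smul_apply]
  rw [← e.symmₗ_apply (R := ℝ) hy, ← e.symmₗ_apply (R := ℝ) hy, ← map_smul]
  exact congrArg _ ((e.linear ℝ h).map_smul c v)

theorem dirDeriv_add {x : M} (v : TangentSpace 𝓘(ℝ, E) x) {f f' : M → ℝ}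
    (hf : DiffFun (E := E) f x) (hf' : DiffFun (E := E) f' x) :
    dirDeriv v (fun y => f y + f' y) = dirDeriv v f + dirDeriv v f' := by
  simp [dirDeriv, mvfderiv_fun_add hf hf']

theorem dirDeriv_mul {x : M} (v : TangentSpace 𝓘(ℝ, E) x) {f f' : M → ℝ}
    (hf : DiffFun (E := E) f x) (hf' : DiffFun (E := E) f' x) :
    dirDeriv v (fun y => f y * f' y) = f x * dirDeriv v f' + f' x * dirDeriv v f := by
  simp [dirDeriv, mvfderiv_fun_mul hf hf']

theorem dirDeriv_congr {x : M} (v : TangentSpace 𝓘(ℝ, E) x) {f f' : M → ℝ}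
    (h : f =ᶠ[𝓝 x] f') : dirDeriv v f = dirDeriv v f' := by
  simp only [dirDeriv, mvfderiv, h.mfderiv_eq]
  rfl

theorem dirDeriv_add_left {x : M} (v w : TangentSpace 𝓘(ℝ, E) x) (f : M → ℝ) :
    dirDeriv (v + w) f = dirDeriv v f + dirDeriv w f := by
  simp [dirDeriv]

theorem dirDeriv_smul_left {x : M} (c : ℝ) (v : TangentSpace 𝓘(ℝ, E) x) (f : M → ℝ) :
    dirDeriv (c • v) f = c * dirDeriv v f := by
  simp [dirDeriv]

theorem diffFun_metric {g : FormField E M} (hg : IsSmoothMetric g) {x : M} {Y Z : VField E M}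
    (hY : DiffField Y x) (hZ : DiffField Z x) :
    DiffFun (E := E) (fun y => g y (Y y) (Z y)) x := by
  have : MDifferentiableAt 𝓘(ℝ, E) (𝓘(ℝ, E).prod 𝓘(ℝ))
      (fun m ↦ TotalSpace.mk' ℝ (E := Bundle.Trivial M ℝ) m (g m (Y m) (Z m))) x := by
    apply MDifferentiableAt.clm_bundle_apply₂ (F₁ := E) (F₂ := E)
    · exact (hg.smooth x).mdifferentiableAt (by simp)
    · exact hY
    · exact hZ
  simp only [mdifferentiableAt_totalSpace] at this
  exact this.2

theorem contMDiffAt_metric {g : FormField E M} (hg : IsSmoothMetric g) {x : M}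
    {Y Z : VField E M} {k : ℕ∞} (hY : CDiffField k Y x) (hZ : CDiffField k Z x) :
    ContMDiffAt 𝓘(ℝ, E) 𝓘(ℝ, ℝ) k (fun y => g y (Y y) (Z y)) x := by
  have : ContMDiffAt 𝓘(ℝ, E) (𝓘(ℝ, E).prod 𝓘(ℝ)) k
      (fun m ↦ TotalSpace.mk' ℝ (E := Bundle.Trivial M ℝ) m (g m (Y m) (Z m))) x := by
    apply ContMDiffAt.clm_bundle_apply₂ (F₁ := E) (F₂ := E)
    · exact (hg.smooth x).of_le (by exact_mod_cast le_top)
    · exact hY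
    · exact hZ
  simp only [contMDiffAt_totalSpace] at this
  exact this.2

/-- Each derivative of `f` coming from a metric term cancels one coming from a bracket. In the first
and last slots nothing is left, which makes the Koszul expression tensorial there. -/
theorem koszul_smul_left {g : FormField E M} (hg : IsSmoothMetric g) {x : M} {f : M → ℝ}
    {X Y Z : VField E M} (hf : DiffFun (E := E) f x) (hX : DiffField X x) (hY : DiffField Y x)
    (hZ : DiffField Z x) : koszul g (f • X) Y Z x = f x * koszul g X Y Z x := by
  have h1 := VectorField.mlieBracket_smul_left (I := 𝓘(ℝ, E)) (W := Y) hf hX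
  have h2 := VectorField.mlieBracket_smul_left (I := 𝓘(ℝ, E)) (W := Z) hf hX
  simp only [koszul, dirDeriv_mul _ hf (diffFun_metric hg hX hZ),
    dirDeriv_mul _ hf (diffFun_metric hg hX hY), h1, h2, map_add, map_smul, map_neg, neg_smul,
    add_apply, neg_apply, smul_apply, smul_eq_mul, Pi.smul_apply', dirDeriv_smul_left]
  simp only [dirDeriv]
  ring

theorem koszul_add_left {g : FormField E M} (hg : IsSmoothMetric g) {x : M}
    {X X' Y Z : VField E M} (hX : DiffField X x) (hX' : DiffField X' x) (hY : DiffField Y x)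
    (hZ : DiffField Z x) : koszul g (X + X') Y Z x = koszul g X Y Z x + koszul g X' Y Z x := by
  have h1 := VectorField.mlieBracket_add_left (I := 𝓘(ℝ, E)) (W := Y) hX hX'
  have h2 := VectorField.mlieBracket_add_left (I := 𝓘(ℝ, E)) (W := Z) hX hX'
  simp only [koszul, dirDeriv_add _ (diffFun_metric hg hX hZ) (diffFun_metric hg hX' hZ),
    dirDeriv_add _ (diffFun_metric hg hX hY) (diffFun_metric hg hX' hY), h1, h2, map_add,
    add_apply, Pi.add_apply, dirDeriv_add_left]
  ring

theorem koszul_smul_right {g : FormField E M} (hg : IsSmoothMetric g) {x : M} {f : M → ℝ}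
    {X Y Z : VField E M} (hf : DiffFun (E := E) f x) (hX : DiffField X x) (hY : DiffField Y x)
    (hZ : DiffField Z x) : koszul g X Y (f • Z) x = f x * koszul g X Y Z x := by
  have h1 := VectorField.mlieBracket_smul_right (I := 𝓘(ℝ, E)) (V := X) hf hZ
  have h2 := VectorField.mlieBracket_smul_right (I := 𝓘(ℝ, E)) (V := Y) hf hZ
  simp only [koszul, dirDeriv_mul _ hf (diffFun_metric hg hY hZ),
    dirDeriv_mul _ hf (diffFun_metric hg hX hZ), h1, h2, map_add, map_smul,
    add_apply, smul_apply, smul_eq_mul, Pi.smul_apply', dirDeriv_smul_left]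
  simp only [dirDeriv, hg.symm x (Z x)]
  ring

theorem koszul_add_right {g : FormField E M} (hg : IsSmoothMetric g) {x : M}
    {X Y Z Z' : VField E M} (hX : DiffField X x) (hY : DiffField Y x) (hZ : DiffField Z x)
    (hZ' : DiffField Z' x) : koszul g X Y (Z + Z') x = koszul g X Y Z x + koszul g X Y Z' x := by
  have h1 := VectorField.mlieBracket_add_right (I := 𝓘(ℝ, E)) (V := X) hZ hZ'
  have h2 := VectorField.mlieBracket_add_right (I := 𝓘(ℝ, E)) (V := Y) hZ hZ'
  simp only [koszul, dirDeriv_add _ (diffFun_metric hg hY hZ) (diffFun_metric hg hY hZ'),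
    dirDeriv_add _ (diffFun_metric hg hX hZ) (diffFun_metric hg hX hZ'), h1, h2, map_add,
    add_apply, Pi.add_apply, dirDeriv_add_left]
  ring

/-- In the middle slot the two contributions of `X(f)` add up instead of cancelling; this is twice
the Leibniz term of `∇_X (f Y)`. -/
theorem koszul_smul_mid {g : FormField E M} (hg : IsSmoothMetric g) {x : M} {f : M → ℝ}
    {X Y Z : VField E M} (hf : DiffFun (E := E) f x) (hX : DiffField X x) (hY : DiffField Y x)
    (hZ : DiffField Z x) : koszul g X (f • Y) Z x
      = f x * koszul g X Y Z x + 2 * dirDeriv (X x) f * g x (Y x) (Z x) := by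
  have h1 := VectorField.mlieBracket_smul_right (I := 𝓘(ℝ, E)) (V := X) hf hY
  have h2 := VectorField.mlieBracket_smul_left (I := 𝓘(ℝ, E)) (W := Z) hf hY
  simp only [koszul, dirDeriv_mul _ hf (diffFun_metric hg hY hZ),
    dirDeriv_mul _ hf (diffFun_metric hg hX hY), h1, h2, map_add, map_smul, map_neg, neg_smul,
    add_apply, neg_apply, smul_apply, smul_eq_mul, Pi.smul_apply', dirDeriv_smul_left]
  simp only [dirDeriv, hg.symm x (Y x)]
  ring

theorem koszul_add_mid {g : FormField E M} (hg : IsSmoothMetric g) {x : M}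
    {X Y Y' Z : VField E M} (hX : DiffField X x) (hY : DiffField Y x) (hY' : DiffField Y' x)
    (hZ : DiffField Z x) : koszul g X (Y + Y') Z x = koszul g X Y Z x + koszul g X Y' Z x := by
  have h1 := VectorField.mlieBracket_add_right (I := 𝓘(ℝ, E)) (V := X) hY hY'
  have h2 := VectorField.mlieBracket_add_left (I := 𝓘(ℝ, E)) (W := Z) hY hY'
  simp only [koszul,
    dirDeriv_add _ (diffFun_metric hg hY hZ) (diffFun_metric hg hY' hZ),
    dirDeriv_add _ (diffFun_metric hg hX hY) (diffFun_metric hg hX hY'), h1, h2, map_add,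
    add_apply, Pi.add_apply, dirDeriv_add_left]
  ring

/-- Tensoriality in the outer slots makes the expression depend on the values at `x` only, so the
extensions `ext` in the definition of `nabla` may be replaced by any differentiable fields. -/
theorem koszul_pointwise {g : FormField E M} (hg : IsSmoothMetric g) {x : M}
    {X X' Y Z Z' : VField E M} (hX : DiffField X x) (hX' : DiffField X' x) (hY : DiffField Y x)
    (hZ : DiffField Z x) (hZ' : DiffField Z' x) (hXX : X x = X' x) (hZZ : Z x = Z' x) :
    koszul g X Y Z x = koszul g X' Y Z' x :=
  TensorialAt.pointwise₂ (I := 𝓘(ℝ, E)) (F := E) (F' := E) (Φ := fun X Z => koszul g X Y Z x)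
    (fun _ hτ => ⟨fun hf hσ => koszul_smul_left hg hf hσ hY hτ,
      fun hσ hσ' => koszul_add_left hg hσ hσ' hY hτ⟩)
    (fun _ hσ => ⟨fun hf hτ => koszul_smul_right hg hf hσ hY hτ,
      fun hτ hτ' => koszul_add_right hg hσ hY hτ hτ'⟩) hX hX' hZ hZ' hXX hZZ

theorem isLinearMap_koszul_right {g : FormField E M} (hg : IsSmoothMetric g) {x : M}
    {X Y : VField E M} (hX : DiffField X x) (hY : DiffField Y x) :
    IsLinearMap ℝ fun w : TangentSpace 𝓘(ℝ, E) x => koszul g X Y (ext w) x :=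
  ⟨fun a b => by
    rw [← koszul_add_right hg hX hY (diffField_ext a) (diffField_ext b)]
    exact koszul_pointwise hg hX hX hY (diffField_ext _)
      (diffField_add (diffField_ext a) (diffField_ext b)) rfl (by simp), fun c a => by
    rw [smul_eq_mul, ← koszul_smul_right hg (f := fun _ => c) mdifferentiableAt_const hX hY
      (diffField_ext a)]
    exact koszul_pointwise hg hX hX hY (diffField_ext _)
      (diffField_const_smul c (diffField_ext a)) rfl (by simp)⟩

theorem isLinearMap_koszul_left {g : FormField E M} (hg : IsSmoothMetric g) {x : M}
    {Y Z : VField E M} (hY : DiffField Y x) (hZ : DiffField Z x) :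
    IsLinearMap ℝ fun v : TangentSpace 𝓘(ℝ, E) x => koszul g (ext v) Y Z x :=
  ⟨fun a b => by
    rw [← koszul_add_left hg (diffField_ext a) (diffField_ext b) hY hZ]
    exact koszul_pointwise hg (diffField_ext _)
      (diffField_add (diffField_ext a) (diffField_ext b)) hY hZ hZ (by simp) rfl, fun c a => by
    rw [smul_eq_mul, ← koszul_smul_left hg (f := fun _ => c) mdifferentiableAt_const
      (diffField_ext a) hY hZ]
    exact koszul_pointwise hg (diffField_ext _) (diffField_const_smul c (diffField_ext a)) hY hZ hZ
      (by simp) rfl⟩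

theorem metric_nabla {g : FormField E M} (hg : IsSmoothMetric g) {x : M}
    {X Y Z : VField E M} (hX : DiffField X x) (hY : DiffField Y x) (hZ : DiffField Z x) :
    g x (nabla g (X x) Y) (Z x) = (1 / 2) * koszul g X Y Z x := by
  have hk := isLinearMap_koszul_right hg (diffField_ext (X x)) hY
  have hlin : IsLinearMap ℝ fun w => (1 / 2) * koszul g (ext (X x)) Y (ext w) x :=
    ⟨fun a b => by rw [hk.map_add, mul_add], fun c a => by rw [hk.map_smul, mul_smul_comm]⟩
  have := apply_sharp g x (hg.nondegenerate x) (hlin.mk' _) (Z x)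
  simp only [IsLinearMap.mk'_apply] at this
  rw [nabla, this, koszul_pointwise hg (diffField_ext _) hX hY (diffField_ext _) hZ (ext_self _)
    (ext_self _)]

theorem eq_of_metric_eq {g : FormField E M} (hg : IsSmoothMetric g) {x : M}
    {u v : TangentSpace 𝓘(ℝ, E) x} (h : ∀ w, g x u w = g x v w) : u = v := by
  have := hg.nondegenerate x (u - v) fun w => by simp [h w]
  exact sub_eq_zero.1 this

theorem metric_nabla_vec {g : FormField E M} (hg : IsSmoothMetric g) {x : M}
    (v w : TangentSpace 𝓘(ℝ, E) x) {Y : VField E M} (hY : DiffField Y x) :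
    g x (nabla g v Y) w = (1 / 2) * koszul g (ext v) Y (ext w) x := by
  have := metric_nabla hg (diffField_ext v) hY (diffField_ext w)
  simpa using this

theorem nabla_smul {g : FormField E M} (hg : IsSmoothMetric g) {x : M}
    (v : TangentSpace 𝓘(ℝ, E) x) {f : M → ℝ} {Y : VField E M} (hf : DiffFun (E := E) f x)
    (hY : DiffField Y x) : nabla g v (f • Y) = dirDeriv v f • Y x + f x • nabla g v Y := by
  refine eq_of_metric_eq hg fun w => ?_
  rw [metric_nabla_vec hg v w (diffField_smul hf hY), koszul_smul_mid hg hf (diffField_ext _) hY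
    (diffField_ext _), map_add, add_apply, map_smul, map_smul, smul_apply, smul_apply,
    metric_nabla_vec hg v w hY]
  simp only [ext_self, smul_eq_mul]
  ring

theorem nabla_add {g : FormField E M} (hg : IsSmoothMetric g) {x : M}
    (v : TangentSpace 𝓘(ℝ, E) x) {Y Y' : VField E M} (hY : DiffField Y x) (hY' : DiffField Y' x) :
    nabla g v (Y + Y') = nabla g v Y + nabla g v Y' := by
  refine eq_of_metric_eq hg fun w => ?_
  rw [metric_nabla_vec hg v w (diffField_add hY hY'), koszul_add_mid hg (diffField_ext _) hY hY'
    (diffField_ext _), map_add, add_apply, metric_nabla_vec hg v w hY, metric_nabla_vec hg v w hY']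
  ring

theorem isLinearMap_nabla {g : FormField E M} (hg : IsSmoothMetric g) {x : M} {Y : VField E M}
    (hY : DiffField Y x) : IsLinearMap ℝ fun v : TangentSpace 𝓘(ℝ, E) x => nabla g v Y :=
  ⟨fun a b => eq_of_metric_eq hg fun w => by
      rw [map_add, add_apply, metric_nabla_vec hg _ w hY, metric_nabla_vec hg _ w hY,
        metric_nabla_vec hg _ w hY, (isLinearMap_koszul_left hg hY (diffField_ext w)).map_add,
        mul_add],
    fun c a => eq_of_metric_eq hg fun w => by
      rw [map_smul, smul_apply, metric_nabla_vec hg _ w hY, metric_nabla_vec hg _ w hY,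
        (isLinearMap_koszul_left hg hY (diffField_ext w)).map_smul, mul_smul_comm]⟩

theorem nabla_congr (g : FormField E M) {x : M} (v : TangentSpace 𝓘(ℝ, E) x) {Y Y' : VField E M}
    (h : Y =ᶠ[𝓝 x] Y') : nabla g v Y = nabla g v Y' := by
  have hk : ∀ X Z, koszul g X Y Z x = koszul g X Y' Z x := by
    intro X Z
    have h1 : (fun y => g y (Y y) (Z y)) =ᶠ[𝓝 x] fun y => g y (Y' y) (Z y) :=
      h.mono fun y hy => by simp only [hy]
    have h2 : (fun y => g y (X y) (Y y)) =ᶠ[𝓝 x] fun y => g y (X y) (Y' y) :=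
      h.mono fun y hy => by simp only [hy]
    simp only [koszul, dirDeriv_congr _ h1, dirDeriv_congr _ h2, h.self_of_nhds,
      (Filter.EventuallyEq.refl (𝓝 x) X).mlieBracket_vectorField_eq h,
      h.mlieBracket_vectorField_eq (Filter.EventuallyEq.refl (𝓝 x) Z)]
  simp only [nabla, hk]

/-- The Levi-Civita connection is torsion-free. -/
theorem nabla_sub_nabla {g : FormField E M} (hg : IsSmoothMetric g) {x : M} {X Y : VField E M}
    (hX : DiffField X x) (hY : DiffField Y x) :
    nabla g (X x) Y - nabla g (Y x) X = VectorField.mlieBracket 𝓘(ℝ, E) X Y x := by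
  refine eq_of_metric_eq hg fun w => ?_
  have h1 := metric_nabla hg hX hY (diffField_ext w)
  have h2 := metric_nabla hg hY hX (diffField_ext w)
  rw [ext_self] at h1 h2
  have h3 : (fun y => g y (Y y) (X y)) = fun y => g y (X y) (Y y) := funext fun y => hg.symm y _ _
  rw [map_sub, sub_apply, h1, h2]
  simp only [koszul, VectorField.mlieBracket_swap_apply (V := Y) (W := X), map_neg, neg_apply,
    ext_self, h3]
  ring

/-- The Levi-Civita connection is compatible with the metric. -/
theorem dirDeriv_metric {g : FormField E M} (hg : IsSmoothMetric g) {x : M}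
    (v : TangentSpace 𝓘(ℝ, E) x) {Y Z : VField E M} (hY : DiffField Y x) (hZ : DiffField Z x) :
    dirDeriv v (fun y => g y (Y y) (Z y)) = g x (nabla g v Y) (Z x) + g x (Y x) (nabla g v Z) := by
  have h1 := metric_nabla hg (diffField_ext v) hY hZ
  have h2 := metric_nabla hg (diffField_ext v) hZ hY
  rw [ext_self] at h1 h2
  have h3 : (fun y => g y (Z y) (Y y)) = fun y => g y (Y y) (Z y) := funext fun y => hg.symm y _ _
  rw [hg.symm x (Y x), h1, h2]
  simp only [koszul, VectorField.mlieBracket_swap_apply (V := Z) (W := Y), map_neg, neg_apply,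
    ext_self, h3]
  ring

end Connection

/-! ### Second fundamental form and integrability tensor of an adapted metric. -/

section Splitting

variable {E : Type*} [NormedAddCommGroup E] [NormedSpace ℝ E] [FiniteDimensional ℝ E]
  {M : Type*} [TopologicalSpace M] [ChartedSpace E M] [IsManifold 𝓘(ℝ, E) ∞ M]

theorem diffField_of_cDiffField {k : ℕ∞ω} (hk : k ≠ 0) {Y : VField E M} {x : M}
    (h : CDiffField k Y x) : DiffField Y x :=
  ContMDiffAt.mdifferentiableAt h hk

/-- Being `C²` at a point is an open condition, whereas differentiability at a point is not; for
this reason sections are extended as `C²` fields. -/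
theorem eventually_diffField {Y : VField E M} {x : M} (h : CDiffField 2 Y x) :
    ∀ᶠ y in 𝓝 x, DiffField Y y := by
  have := (contMDiffAt_iff_contMDiffAt_nhds (by decide)).1 h
  exact this.mono fun y hy => diffField_of_cDiffField two_ne_zero hy

theorem diffField_congr {Y Y' : VField E M} {x : M} (h : DiffField Y x) (hY : Y' =ᶠ[𝓝 x] Y) :
    DiffField Y' x :=
  MDifferentiableAt.congr_of_eventuallyEq h (hY.mono fun y hy => by simp only [hy])

/-- The entries of the inverse of a matrix with `C^k` entries are `C^k`. -/
theorem contMDiffAt_inv_apply {ι : Type*} [Fintype ι] [DecidableEq ι] {k : ℕ∞ω}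
    {A : M → Matrix ι ι ℝ} {x : M}
    (hA : ∀ i j, ContMDiffAt 𝓘(ℝ, E) 𝓘(ℝ, ℝ) k (fun y => A y i j) x) (hu : IsUnit (A x).det)
    (i j : ι) : ContMDiffAt 𝓘(ℝ, E) 𝓘(ℝ, ℝ) k (fun y => (A y)⁻¹ i j) x := by
  have h1 : ContMDiffAt 𝓘(ℝ, E) 𝓘(ℝ, ι → ι → ℝ) k (fun y i j => A y i j) x := by
    refine contMDiffAt_pi_space.2 fun i => contMDiffAt_pi_space.2 fun j => hA i j
  exact (contDiffAt_inv_apply k (A := fun i j => A x i j) hu i j).contMDiffAt.comp x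
    (f := fun y i j => A y i j) h1

namespace Splitting

variable {n p : ℕ} (S : Splitting E M n p) {x : M}

theorem projTop_mem (v : TangentSpace 𝓘(ℝ, E) x) : S.projTop x v ∈ S.top x :=
  Submodule.projection_apply_mem _ _

theorem projPerp_mem (v : TangentSpace 𝓘(ℝ, E) x) : S.projPerp x v ∈ S.perp x :=
  S.swap.projTop_mem v

theorem projTop_of_mem {v : TangentSpace 𝓘(ℝ, E) x} (h : v ∈ S.top x) : S.projTop x v = v :=
  Submodule.projection_apply_of_mem_left _ h

theorem projPerp_of_mem {v : TangentSpace 𝓘(ℝ, E) x} (h : v ∈ S.perp x) : S.projPerp x v = v :=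
  S.swap.projTop_of_mem h

theorem projTop_of_mem_perp {v : TangentSpace 𝓘(ℝ, E) x} (h : v ∈ S.perp x) : S.projTop x v = 0 :=
  (Submodule.projection_apply_eq_zero_iff _).2 h

theorem projTop_add_projPerp (v : TangentSpace 𝓘(ℝ, E) x) : S.projTop x v + S.projPerp x v = v :=
  Submodule.projection_add_projection_eq_self _ v

/-- The metric makes the two distributions orthogonal. -/
structure IsAdapted (g : FormField E M) : Prop where
  metric : IsSmoothMetric g
  orthogonal : ∀ x, ∀ u ∈ S.top x, ∀ v ∈ S.perp x, g x u v = 0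

variable {S} {g : FormField E M}

theorem IsAdapted.swap (h : S.IsAdapted g) : S.swap.IsAdapted g :=
  ⟨h.metric, fun x u hu v hv => by rw [h.metric.symm]; exact h.orthogonal x v hv u hu⟩

theorem IsAdapted.orthogonal' (h : S.IsAdapted g) {u v : TangentSpace 𝓘(ℝ, E) x}
    (hu : u ∈ S.perp x) (hv : v ∈ S.top x) : g x u v = 0 :=
  h.swap.orthogonal x u hu v hv

theorem IsAdapted.metric_projTop_right (h : S.IsAdapted g) {u : TangentSpace 𝓘(ℝ, E) x}
    (hu : u ∈ S.top x) (v : TangentSpace 𝓘(ℝ, E) x) : g x u (S.projTop x v) = g x u v := by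
  conv_rhs => rw [← S.projTop_add_projPerp v, map_add, h.orthogonal x u hu _ (S.projPerp_mem v),
    add_zero]

theorem IsAdapted.metric_projTop_left (h : S.IsAdapted g) {u : TangentSpace 𝓘(ℝ, E) x}
    (hu : u ∈ S.top x) (v : TangentSpace 𝓘(ℝ, E) x) : g x (S.projTop x v) u = g x v u := by
  rw [h.metric.symm, h.metric_projTop_right hu, h.metric.symm]

theorem IsAdapted.metric_projPerp_right (h : S.IsAdapted g) {u : TangentSpace 𝓘(ℝ, E) x}
    (hu : u ∈ S.perp x) (v : TangentSpace 𝓘(ℝ, E) x) : g x u (S.projPerp x v) = g x u v :=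
  h.swap.metric_projTop_right hu v

theorem IsAdapted.metric_projPerp_left (h : S.IsAdapted g) {u : TangentSpace 𝓘(ℝ, E) x}
    (hu : u ∈ S.perp x) (v : TangentSpace 𝓘(ℝ, E) x) : g x (S.projPerp x v) u = g x v u :=
  h.swap.metric_projTop_left hu v

theorem IsAdapted.nondegenerate_top (h : S.IsAdapted g) :
    ∀ u ∈ S.top x, (∀ v ∈ S.top x, g x u v = 0) → u = 0 := fun u hu h0 =>
  h.metric.nondegenerate x u fun v => by
    rw [← h.metric_projTop_right hu]
    exact h0 _ (S.projTop_mem v)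

theorem IsAdapted.eq_of_mem_top (h : S.IsAdapted g) {u v : TangentSpace 𝓘(ℝ, E) x}
    (hu : u ∈ S.top x) (hv : v ∈ S.top x) (hw : ∀ w ∈ S.top x, g x u w = g x v w) : u = v :=
  sub_eq_zero.1 (h.nondegenerate_top _ (Submodule.sub_mem _ hu hv) fun w hw' => by
    simp [hw w hw'])

theorem IsAdapted.eq_of_mem_perp (h : S.IsAdapted g) {u v : TangentSpace 𝓘(ℝ, E) x}
    (hu : u ∈ S.perp x) (hv : v ∈ S.perp x) (hw : ∀ w ∈ S.perp x, g x u w = g x v w) : u = v :=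
  h.swap.eq_of_mem_top hu hv hw

/-- The Gram matrix of a family of tangent vectors. -/
def _root_.AlmostProduct.gram (g : FormField E M) (x : M) {ι : Type*}
    (X : ι → TangentSpace 𝓘(ℝ, E) x) : Matrix ι ι ℝ :=
  Matrix.of fun i j => g x (X i) (X j)

section Basis

variable {ι : Type*} [Fintype ι] [DecidableEq ι]

theorem IsAdapted.isUnit_gram (h : S.IsAdapted g) (b : Basis ι ℝ (S.top x)) :
    IsUnit (gram g x fun i => (b i : TangentSpace 𝓘(ℝ, E) x)).det :=
  isUnit_det_gram (isBilin_metric g x) h.nondegenerate_top b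

theorem _root_.AlmostProduct.mem_span_basis {W : Submodule ℝ (TangentSpace 𝓘(ℝ, E) x)}
    (b : Basis ι ℝ W) {v : TangentSpace 𝓘(ℝ, E) x} (hv : v ∈ W) :
    v = ∑ i, b.repr ⟨v, hv⟩ i • (b i : TangentSpace 𝓘(ℝ, E) x) := by
  have := congrArg (fun w : W => (w : TangentSpace 𝓘(ℝ, E) x)) (b.sum_repr ⟨v, hv⟩)
  simpa only [AddSubmonoidClass.coe_finsetSum, Submodule.coe_smul] using this.symm

theorem _root_.AlmostProduct.metric_eq_of_basis {W : Submodule ℝ (TangentSpace 𝓘(ℝ, E) x)}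
    (b : Basis ι ℝ W) {u v : TangentSpace 𝓘(ℝ, E) x}
    (h : ∀ i, g x u (b i) = g x v (b i)) : ∀ w ∈ W, g x u w = g x v w := by
  intro w hw
  rw [mem_span_basis b hw, map_sum, map_sum]
  simp [h]

/-- The orthogonal projection in terms of a basis. -/
theorem IsAdapted.projTop_eq_sum (h : S.IsAdapted g) (b : Basis ι ℝ (S.top x))
    (v : TangentSpace 𝓘(ℝ, E) x) :
    S.projTop x v = ∑ i, ∑ j, ((gram g x fun i => (b i : TangentSpace 𝓘(ℝ, E) x))⁻¹ i j
      * g x v (b i)) • (b j : TangentSpace 𝓘(ℝ, E) x) := by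
  set G := gram g x fun i => (b i : TangentSpace 𝓘(ℝ, E) x) with hG
  refine h.eq_of_mem_top (S.projTop_mem v) (Submodule.sum_mem _ fun i _ => Submodule.sum_mem _
    fun j _ => Submodule.smul_mem _ _ (b j).2) (metric_eq_of_basis b fun k => ?_)
  rw [h.metric_projTop_left (b k).2]
  have hGG : ∀ i, ∑ j, G⁻¹ i j * g x (b j) (b k) = (1 : Matrix ι ι ℝ) i k := by
    intro i
    rw [← Matrix.nonsing_inv_mul G (h.isUnit_gram b), Matrix.mul_apply]
    rfl
  simp only [map_sum, map_smul, sum_apply, smul_apply, smul_eq_mul]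
  calc g x v (b k) = ∑ i, g x v (b i) * (1 : Matrix ι ι ℝ) i k := by
        simp [Matrix.one_apply]
    _ = _ := by
        refine Finset.sum_congr rfl fun i _ => ?_
        rw [← hGG, Finset.mul_sum]
        exact Finset.sum_congr rfl fun j _ => by ring

end Basis

/-- The projection of a `C^k` vector field to a distribution is `C^k`. -/
theorem IsAdapted.cDiffField_projTop (h : S.IsAdapted g) {k : ℕ∞} {Y : VField E M}
    (hY : CDiffField k Y x) : CDiffField k (fun y => S.projTop y (Y y)) x := by
  obtain ⟨U, hU, X, hXs, hXb⟩ := S.smooth_top x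
  have hXk : ∀ i, CDiffField k (X i) x := fun i =>
    ((hXs i).contMDiffAt hU).of_le (by exact_mod_cast le_top)
  have hG : ∀ i j, ContMDiffAt 𝓘(ℝ, E) 𝓘(ℝ, ℝ) k
      (fun y => gram g y (fun i => X i y) i j) x := fun i j =>
    contMDiffAt_metric h.metric (hXk i) (hXk j)
  have hbas : ∀ y ∈ U, ∃ b : Basis (Fin n) ℝ (S.top y), ∀ i, (b i : TangentSpace 𝓘(ℝ, E) y) = X i y :=
    fun y hy => exists_basis_of_span (hXb y hy).1 (hXb y hy).2
  have hu : IsUnit (gram g x fun i => X i x).det := by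
    obtain ⟨b, hb⟩ := hbas x (mem_of_mem_nhds hU)
    simpa only [hb] using h.isUnit_gram b
  -- The projection does not involve the metric, but an adapted metric makes it orthogonal; the
  -- inverse Gram matrix of a smooth frame then provides regular coefficients.
  have hs : CDiffField k (fun y => ∑ i, ∑ j, ((gram g y fun i => X i y)⁻¹ i j
      * g y (Y y) (X i y)) • X j y) x := by
    refine ContMDiffAt.sum_section fun i _ => ContMDiffAt.sum_section fun j _ => ?_
    exact ContMDiffAt.smul_section ((contMDiffAt_inv_apply hG hu i j).mul
      (contMDiffAt_metric h.metric hY (hXk i))) (hXk j)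
  refine ContMDiffAt.congr_of_eventuallyEq hs ?_
  filter_upwards [hU] with y hy
  obtain ⟨b, hb⟩ := hbas y hy
  have := h.projTop_eq_sum b (Y y)
  simp only [hb] at this
  rw [this]

theorem IsAdapted.cDiffField_extTop (h : S.IsAdapted g) (k : ℕ∞) (v : TangentSpace 𝓘(ℝ, E) x) :
    CDiffField k (S.extTop v) x :=
  h.cDiffField_projTop (cDiffField_ext k v)

theorem IsAdapted.diffField_extTop (h : S.IsAdapted g) (v : TangentSpace 𝓘(ℝ, E) x) :
    DiffField (S.extTop v) x :=
  diffField_of_cDiffField one_ne_zero (h.cDiffField_extTop 1 v)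

theorem extTop_mem (v : TangentSpace 𝓘(ℝ, E) x) (y : M) : S.extTop v y ∈ S.top y :=
  S.projTop_mem _

theorem extTop_self (v : TangentSpace 𝓘(ℝ, E) x) : S.extTop v x = S.projTop x v := by
  simp [extTop]

theorem extTop_self_of_mem {v : TangentSpace 𝓘(ℝ, E) x} (hv : v ∈ S.top x) : S.extTop v x = v := by
  rw [extTop_self, S.projTop_of_mem hv]

/-- Differentiate `g(V, Z) = 0` along `u`. This moves the derivative from a section of one
distribution to a section of the other. -/
theorem IsAdapted.metric_nabla_eq_neg (h : S.IsAdapted g) (u : TangentSpace 𝓘(ℝ, E) x)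
    {V Z : VField E M} (hV : DiffField V x) (hZ : DiffField Z x) (hVm : ∀ᶠ y in 𝓝 x, V y ∈ S.top y)
    (hZm : ∀ᶠ y in 𝓝 x, Z y ∈ S.perp y) :
    g x (nabla g u V) (Z x) = - g x (V x) (nabla g u Z) := by
  have h1 := dirDeriv_metric h.metric u hV hZ
  have h2 : (fun y => g y (V y) (Z y)) =ᶠ[𝓝 x] fun _ => 0 := by
    filter_upwards [hVm, hZm] with y h1 h2 using h.orthogonal y _ h1 _ h2
  rw [dirDeriv_congr u h2, show dirDeriv u (fun _ : M => (0 : ℝ)) = 0 by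
    simp [dirDeriv, mvfderiv_const]] at h1
  linarith

/-- The second fundamental form, tested against a section of the complement. -/
theorem IsAdapted.metric_h (h : S.IsAdapted g) (u v : TangentSpace 𝓘(ℝ, E) x) {Z : VField E M}
    (hZ : DiffField Z x) (hZm : ∀ᶠ y in 𝓝 x, Z y ∈ S.perp y) :
    g x (S.h g x u v) (Z x) = -(1 / 2) * (g x (S.projTop x v) (nabla g (S.projTop x u) Z)
      + g x (S.projTop x u) (nabla g (S.projTop x v) Z)) := by
  have hm : ∀ w : TangentSpace 𝓘(ℝ, E) x, ∀ᶠ y in 𝓝 x, S.extTop w y ∈ S.top y := fun w =>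
    Filter.Eventually.of_forall fun y => extTop_mem w y
  simp only [Splitting.h, map_smul, smul_apply, smul_eq_mul]
  rw [h.metric_projPerp_left hZm.self_of_nhds, map_add, add_apply,
    h.metric_nabla_eq_neg _ (h.diffField_extTop v) hZ (hm v) hZm,
    h.metric_nabla_eq_neg _ (h.diffField_extTop u) hZ (hm u) hZm, extTop_self, extTop_self]
  ring

/-- The integrability tensor, tested against a section of the complement. -/
theorem IsAdapted.metric_T (h : S.IsAdapted g) (u v : TangentSpace 𝓘(ℝ, E) x) {Z : VField E M}
    (hZ : DiffField Z x) (hZm : ∀ᶠ y in 𝓝 x, Z y ∈ S.perp y) :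
    g x (S.T x u v) (Z x) = (1 / 2) * (g x (S.projTop x u) (nabla g (S.projTop x v) Z)
      - g x (S.projTop x v) (nabla g (S.projTop x u) Z)) := by
  have hm : ∀ w : TangentSpace 𝓘(ℝ, E) x, ∀ᶠ y in 𝓝 x, S.extTop w y ∈ S.top y := fun w =>
    Filter.Eventually.of_forall fun y => extTop_mem w y
  simp only [Splitting.T, map_smul, smul_apply, smul_eq_mul]
  rw [h.metric_projPerp_left hZm.self_of_nhds,
    ← nabla_sub_nabla h.metric (h.diffField_extTop u) (h.diffField_extTop v), map_sub, sub_apply,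
    h.metric_nabla_eq_neg _ (h.diffField_extTop v) hZ (hm v) hZm,
    h.metric_nabla_eq_neg _ (h.diffField_extTop u) hZ (hm u) hZm, extTop_self, extTop_self]
  ring

theorem h_mem (u v : TangentSpace 𝓘(ℝ, E) x) : S.h g x u v ∈ S.perp x :=
  Submodule.smul_mem _ _ (S.projPerp_mem _)

theorem T_mem (u v : TangentSpace 𝓘(ℝ, E) x) : S.T x u v ∈ S.perp x :=
  Submodule.smul_mem _ _ (S.projPerp_mem _)

theorem h_symm (u v : TangentSpace 𝓘(ℝ, E) x) : S.h g x u v = S.h g x v u := by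
  simp only [Splitting.h, add_comm]

theorem T_antisymm (u v : TangentSpace 𝓘(ℝ, E) x) : S.T x u v = - S.T x v u := by
  simp only [Splitting.T]
  rw [VectorField.mlieBracket_swap_apply, map_neg, smul_neg]

theorem IsAdapted.exists_section_perp (h : S.IsAdapted g) {z : TangentSpace 𝓘(ℝ, E) x}
    (hz : z ∈ S.perp x) :
    ∃ Z : VField E M, CDiffField 2 Z x ∧ (∀ y, Z y ∈ S.perp y) ∧ Z x = z :=
  ⟨S.swap.extTop z, h.swap.cDiffField_extTop 2 z, extTop_mem (S := S.swap) z,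
    extTop_self_of_mem (S := S.swap) hz⟩

/-- The definition goes through chosen extensions of `u` and `v`. Tested against a section `Z` of
the complement, `metric_h` leaves only `∇_u Z` and `∇_v Z`, which are linear in the vectors. -/
theorem IsAdapted.isBilin_h (h : S.IsAdapted g) : IsBilin (S.h g x) := by
  have hl : ∀ v, IsLinearMap ℝ fun u => S.h g x u v := by
    intro v
    constructor
    · intro a b
      refine h.eq_of_mem_perp (h_mem _ _) (Submodule.add_mem _ (h_mem _ _) (h_mem _ _)) fun z hz => ?_
      obtain ⟨Z, hZ, hZm, rfl⟩ := h.exists_section_perp hz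
      have hZd := diffField_of_cDiffField two_ne_zero hZ
      have hZe := Filter.Eventually.of_forall (f := 𝓝 x) hZm
      have hn := isLinearMap_nabla (x := x) h.metric hZd
      rw [map_add, add_apply, h.metric_h _ _ hZd hZe, h.metric_h _ _ hZd hZe, h.metric_h _ _ hZd hZe]
      simp only [map_add, hn.map_add, add_apply]
      ring
    · intro c a
      refine h.eq_of_mem_perp (h_mem _ _) (Submodule.smul_mem _ _ (h_mem _ _)) fun z hz => ?_
      obtain ⟨Z, hZ, hZm, rfl⟩ := h.exists_section_perp hz
      have hZd := diffField_of_cDiffField two_ne_zero hZ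
      have hZe := Filter.Eventually.of_forall (f := 𝓝 x) hZm
      have hn := isLinearMap_nabla (x := x) h.metric hZd
      rw [map_smul, smul_apply, h.metric_h _ _ hZd hZe, h.metric_h _ _ hZd hZe]
      simp only [map_smul, hn.map_smul, smul_apply, smul_eq_mul]
      ring
  exact ⟨hl, fun u => by simpa only [h_symm _ u] using hl u⟩

/-- As for `h`, with `metric_T`; the second argument follows by antisymmetry. -/
theorem IsAdapted.isBilin_T (h : S.IsAdapted g) : IsBilin (S.T x) := by
  have hl : ∀ v, IsLinearMap ℝ fun u => S.T x u v := by
    intro v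
    constructor
    · intro a b
      refine h.eq_of_mem_perp (T_mem _ _) (Submodule.add_mem _ (T_mem _ _) (T_mem _ _)) fun z hz => ?_
      obtain ⟨Z, hZ, hZm, rfl⟩ := h.exists_section_perp hz
      have hZd := diffField_of_cDiffField two_ne_zero hZ
      have hZe := Filter.Eventually.of_forall (f := 𝓝 x) hZm
      have hn := isLinearMap_nabla (x := x) h.metric hZd
      rw [map_add, add_apply, h.metric_T _ _ hZd hZe, h.metric_T _ _ hZd hZe, h.metric_T _ _ hZd hZe]
      simp only [map_add, hn.map_add, add_apply]
      ring
    · intro c a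
      refine h.eq_of_mem_perp (T_mem _ _) (Submodule.smul_mem _ _ (T_mem _ _)) fun z hz => ?_
      obtain ⟨Z, hZ, hZm, rfl⟩ := h.exists_section_perp hz
      have hZd := diffField_of_cDiffField two_ne_zero hZ
      have hZe := Filter.Eventually.of_forall (f := 𝓝 x) hZm
      have hn := isLinearMap_nabla (x := x) h.metric hZd
      rw [map_smul, smul_apply, h.metric_T _ _ hZd hZe, h.metric_T _ _ hZd hZe]
      simp only [map_smul, hn.map_smul, smul_apply, smul_eq_mul]
      ring
  exact ⟨hl, fun u => ⟨fun a b => by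
      rw [T_antisymm u, (hl u).map_add, neg_add, ← T_antisymm, ← T_antisymm],
    fun c a => by rw [T_antisymm u, (hl u).map_smul, ← smul_neg, ← T_antisymm]⟩⟩

theorem IsAdapted.h_projTop (h : S.IsAdapted g) (u v : TangentSpace 𝓘(ℝ, E) x) :
    S.h g x (S.projTop x u) (S.projTop x v) = S.h g x u v := by
  refine h.eq_of_mem_perp (h_mem _ _) (h_mem _ _) fun z hz => ?_
  obtain ⟨Z, hZ, hZm, rfl⟩ := h.exists_section_perp hz
  have hZd := diffField_of_cDiffField two_ne_zero hZ
  have hZe := Filter.Eventually.of_forall (f := 𝓝 x) hZm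
  rw [h.metric_h _ _ hZd hZe, h.metric_h _ _ hZd hZe]
  simp only [S.projTop_of_mem (S.projTop_mem _)]

theorem IsAdapted.T_projTop (h : S.IsAdapted g) (u v : TangentSpace 𝓘(ℝ, E) x) :
    S.T x (S.projTop x u) (S.projTop x v) = S.T x u v := by
  refine h.eq_of_mem_perp (T_mem _ _) (T_mem _ _) fun z hz => ?_
  obtain ⟨Z, hZ, hZm, rfl⟩ := h.exists_section_perp hz
  have hZd := diffField_of_cDiffField two_ne_zero hZ
  have hZe := Filter.Eventually.of_forall (f := 𝓝 x) hZm
  rw [h.metric_T _ _ hZd hZe, h.metric_T _ _ hZd hZe]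
  simp only [S.projTop_of_mem (S.projTop_mem _)]

/-- The covariant derivative of a section of the complement, tested against the distribution. -/
theorem IsAdapted.metric_nabla_section_perp (h : S.IsAdapted g) {u v : TangentSpace 𝓘(ℝ, E) x}
    (hu : u ∈ S.top x) (hv : v ∈ S.top x) {Z : VField E M} (hZ : DiffField Z x)
    (hZm : ∀ᶠ y in 𝓝 x, Z y ∈ S.perp y) :
    g x (nabla g u Z) v = - g x (S.h g x u v) (Z x) - g x (S.T x u v) (Z x) := by
  rw [h.metric_h u v hZ hZm, h.metric_T u v hZ hZm, S.projTop_of_mem hu, S.projTop_of_mem hv,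
    h.metric.symm x _ v]
  ring

/-- The second fundamental form as a Lie derivative of the metric. -/
theorem IsAdapted.metric_h_eq_lie (h : S.IsAdapted g) {X Y Z : VField E M} (hX : DiffField X x)
    (hY : DiffField Y x) (hZ : DiffField Z x) (hXm : X x ∈ S.top x) (hYm : Y x ∈ S.top x)
    (hZm : ∀ᶠ y in 𝓝 x, Z y ∈ S.perp y) :
    g x (S.h g x (X x) (Y x)) (Z x) = -(1 / 2) * (dirDeriv (Z x) (fun y => g y (X y) (Y y))
      - g x (VectorField.mlieBracket 𝓘(ℝ, E) Z X x) (Y x)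
      - g x (X x) (VectorField.mlieBracket 𝓘(ℝ, E) Z Y x)) := by
  -- Torsion-freeness turns `∇_Z X - [Z, X]` into `∇_X Z`. The formula obtained contains no
  -- connection, so its dependence on the metric is explicit.
  rw [h.metric_h _ _ hZ hZm, S.projTop_of_mem hXm, S.projTop_of_mem hYm,
    dirDeriv_metric h.metric _ hX hY, ← nabla_sub_nabla h.metric hZ hX,
    ← nabla_sub_nabla h.metric hZ hY, map_sub, map_sub, sub_apply,
    h.metric.symm x (nabla g (X x) Z)]
  ring

end Splitting

end Splitting

/-! ### Directional derivatives in charts and mixed partial derivatives. -/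

section Calculus

variable {E : Type*} [NormedAddCommGroup E] [NormedSpace ℝ E] [FiniteDimensional ℝ E]
  {M : Type*} [TopologicalSpace M] [ChartedSpace E M] [IsManifold 𝓘(ℝ, E) ∞ M] {x : M}

theorem contMDiffAt_extChartAt_symm (k : ℕ∞) {z : E} (hz : z ∈ (extChartAt 𝓘(ℝ, E) x).target) :
    ContMDiffAt 𝓘(ℝ, E) 𝓘(ℝ, E) k (extChartAt 𝓘(ℝ, E) x).symm z := by
  have : IsManifold 𝓘(ℝ, E) k M := IsManifold.of_le (n := ∞) (by exact_mod_cast le_top)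
  exact (contMDiffOn_extChartAt_symm x).contMDiffAt
    ((isOpen_extChartAt_target x).mem_nhds hz)

/-- A directional derivative at `x` is a derivative in the chart at `x`. -/
theorem exists_hasFDerivAt_chart {f : M → ℝ} (hf : DiffFun (E := E) f x) :
    ∃ L : E →L[ℝ] ℝ, (∀ v : TangentSpace 𝓘(ℝ, E) x, dirDeriv v f = L v) ∧
      HasFDerivAt (fun z : E => f ((extChartAt 𝓘(ℝ, E) x).symm z)) L (extChartAt 𝓘(ℝ, E) x x) := by
  have h1 := hf.mvfderiv
  have h2 := hf.differentiableWithinAt_writtenInExtChartAt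
  simp only [modelWithCornersSelf_coe, range_id, fderivWithin_univ, differentiableWithinAt_univ] at h1 h2
  refine ⟨_, fun v => ?_, h2.hasFDerivAt⟩
  rw [dirDeriv, h1]
  rfl

/-- A curve through `x` along which derivatives at `0` are directional derivatives. -/
theorem exists_curve (v : TangentSpace 𝓘(ℝ, E) x) : ∃ c : ℝ → M, c 0 = x ∧
    ∀ f : M → ℝ, DiffFun (E := E) f x → HasDerivAt (fun s => f (c s)) (dirDeriv v f) 0 := by
  -- The tangent space at `x` is `E` itself, read in the chart at `x`; the curve is a straight line
  -- in that chart.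
  obtain ⟨w, hw⟩ : ∃ w : E, w = v := ⟨v, rfl⟩
  refine ⟨fun s : ℝ => (extChartAt 𝓘(ℝ, E) x).symm (extChartAt 𝓘(ℝ, E) x x + s • w), by simp,
    fun f hf => ?_⟩
  obtain ⟨L, hL, h1⟩ := exists_hasFDerivAt_chart hf
  have h2 : HasDerivAt (fun s : ℝ => extChartAt 𝓘(ℝ, E) x x + s • w) w 0 := by
    simpa using ((hasDerivAt_id (0 : ℝ)).smul_const w).const_add (extChartAt 𝓘(ℝ, E) x x)
  rw [hL, ← hw]
  exact h1.comp_hasDerivAt_of_eq 0 h2 (by simp)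

/-- If a function is `C²` and a vector field is differentiable, then so is the derivative of the
function along the vector field. -/
theorem diffFun_dirDeriv {f : M → ℝ} (hf : ContMDiffAt 𝓘(ℝ, E) 𝓘(ℝ, ℝ) 2 f x) {Y : VField E M}
    (hY : DiffField Y x) : DiffFun (E := E) (fun y => dirDeriv (Y y) f) x := by
  set φ := extChartAt 𝓘(ℝ, E) x with hφ
  set F : E → ℝ := fun z => f (φ.symm z) with hF
  have hxs : x ∈ φ.source := mem_extChartAt_source x
  have hFc : ContDiffAt ℝ 2 F (φ x) := by
    refine ContMDiffAt.contDiffAt ?_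
    refine ContMDiffAt.comp (φ x) ?_ (contMDiffAt_extChartAt_symm 2 (mem_extChartAt_target x))
    rwa [φ.left_inv hxs]
  have hF' : MDifferentiableAt 𝓘(ℝ, E) 𝓘(ℝ, E →L[ℝ] ℝ) (fun y => fderiv ℝ F (φ y)) x := by
    have h1 : DifferentiableAt ℝ (fderiv ℝ F) (φ x) :=
      (hFc.fderiv_right (m := 1) (by norm_num)).differentiableAt one_ne_zero
    exact h1.mdifferentiableAt.comp x (mdifferentiableAt_extChartAt (mem_chart_source E x))
  have hY' : MDifferentiableAt 𝓘(ℝ, E) 𝓘(ℝ, E)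
      (fun y => (trivializationAt E (TangentSpace 𝓘(ℝ, E) : M → Type _) x
        (TotalSpace.mk' E y (Y y))).2) x := by
    have := hY
    simp only [mdifferentiableAt_totalSpace] at this
    exact this.2
  -- Near `x`, the derivative of `f` along `Y` is `DF(φ y)` applied to the chart components of `Y
  -- y`, and both factors are differentiable at `x`.
  refine (hF'.clm_apply hY').congr_of_eventuallyEq ?_
  have hev : ∀ᶠ y in 𝓝 x, ContMDiffAt 𝓘(ℝ, E) 𝓘(ℝ, ℝ) 2 f y :=
    (contMDiffAt_iff_contMDiffAt_nhds (by decide)).1 hf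
  have hev' : ∀ᶠ y in 𝓝 x, y ∈ φ.source := extChartAt_source_mem_nhds x
  filter_upwards [hev, hev', hev'.eventually_nhds] with y hy hys hyn
  have hyc : y ∈ (chartAt E x).source := by simpa [hφ] using hys
  have hFy : DifferentiableAt ℝ F (φ y) := by
    refine MDifferentiableAt.differentiableAt ?_
    refine MDifferentiableAt.comp (φ y) (I' := 𝓘(ℝ, E)) ?_
      ((contMDiffAt_extChartAt_symm 1 (φ.map_source hys)).mdifferentiableAt one_ne_zero)
    rw [φ.left_inv hys]
    exact hy.mdifferentiableAt two_ne_zero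
  have hcomp : f =ᶠ[𝓝 y] F ∘ φ := hyn.mono fun w hw => by simp [hF, φ.left_inv hw]
  have hd : mfderiv 𝓘(ℝ, E) 𝓘(ℝ, ℝ) f y
      = (mfderiv 𝓘(ℝ, E) 𝓘(ℝ, ℝ) F (φ y)).comp (mfderiv 𝓘(ℝ, E) 𝓘(ℝ, E) φ y) := by
    rw [hcomp.mfderiv_eq]
    exact mfderiv_comp y hFy.mdifferentiableAt (mdifferentiableAt_extChartAt hyc)
  have ht := TangentBundle.continuousLinearMapAt_trivializationAt (I := 𝓘(ℝ, E)) hyc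
  have hb : y ∈ (trivializationAt E (TangentSpace 𝓘(ℝ, E) : M → Type _) x).baseSet := by
    simpa using hyc
  have ht2 : (trivializationAt E (TangentSpace 𝓘(ℝ, E) : M → Type _) x
        (TotalSpace.mk' E y (Y y))).2 = mfderiv 𝓘(ℝ, E) 𝓘(ℝ, E) φ y (Y y) := by
    rw [← ht]
    exact ((trivializationAt E (TangentSpace 𝓘(ℝ, E) : M → Type _) x).continuousLinearMapAt_apply_of_mem
      (R := ℝ) hb (Y y)).symm
  change (mfderiv 𝓘(ℝ, E) 𝓘(ℝ, ℝ) f y) (Y y) = _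
  rw [hd, ht2, mfderiv_eq_fderiv]
  rfl

variable {f : ℝ × M → ℝ} {t : ℝ}

/-- The time derivative of a `C²` function is differentiable in space, and time derivatives
commute with directional derivatives. -/
theorem mixed_partial (hf : ContMDiffAt (𝓘(ℝ, ℝ).prod 𝓘(ℝ, E)) 𝓘(ℝ, ℝ) 2 f (t, x)) :
    (∀ᶠ y in 𝓝 x, DifferentiableAt ℝ (fun s => f (s, y)) t) ∧
    DiffFun (E := E) (fun y => deriv (fun s => f (s, y)) t) x ∧
    ∀ v : TangentSpace 𝓘(ℝ, E) x, HasDerivAt (fun s => dirDeriv v (fun y => f (s, y)))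
      (dirDeriv v (fun y => deriv (fun s => f (s, y)) t)) t := by
  set φ := extChartAt 𝓘(ℝ, E) x with hφ
  set F : ℝ × E → ℝ := fun q => f (q.1, φ.symm q.2) with hF
  have hxs : x ∈ φ.source := mem_extChartAt_source x
  have hFc : ContDiffAt ℝ 2 F (t, φ x) := by
    have h : ContMDiffAt (𝓘(ℝ, ℝ).prod 𝓘(ℝ, E)) 𝓘(ℝ, ℝ) 2 F (t, φ x) := by
      refine ContMDiffAt.comp (t, φ x) (I' := 𝓘(ℝ, ℝ).prod 𝓘(ℝ, E)) (g := f)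
        (f := fun q : ℝ × E => (q.1, φ.symm q.2)) ?_ ?_
      · simpa [φ.left_inv hxs] using hf
      · refine contMDiffAt_fst.prodMk ?_
        exact ContMDiffAt.comp (t, φ x) (I' := 𝓘(ℝ, E))
          (contMDiffAt_extChartAt_symm 2 (mem_extChartAt_target x)) contMDiffAt_snd
    rw [← modelWithCornersSelf_prod, chartedSpaceSelf_prod] at h
    exact h.contDiffAt
  have hFev : ∀ᶠ q in 𝓝 (t, φ x), DifferentiableAt ℝ F q :=
    (hFc.eventually (by decide)).mono fun q hq => hq.differentiableAt two_ne_zero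
  have hF2 : DifferentiableAt ℝ (fderiv ℝ F) (t, φ x) :=
    (hFc.fderiv_right (m := 1) (by norm_num)).differentiableAt one_ne_zero
  -- Symmetry of the second derivative of `F`, which is `f` in the coordinates (time, chart at `x`).
  have hsymm := hFc.isSymmSndFDerivAt (by simp)
  have hφc : ContinuousAt φ x := continuousAt_extChartAt x
  have htime : ∀ᶠ y in 𝓝 x, HasDerivAt (fun s => f (s, y)) (fderiv ℝ F (t, φ y) (1, 0)) t := by
    have h1 : ∀ᶠ y in 𝓝 x, DifferentiableAt ℝ F (t, φ y) :=
      (continuousAt_const.prodMk hφc).eventually hFev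
    filter_upwards [h1, extChartAt_source_mem_nhds (I := 𝓘(ℝ, E)) x] with y hy hys
    have h2 : HasDerivAt (fun s : ℝ => (s, φ y)) ((1 : ℝ), (0 : E)) t :=
      (hasDerivAt_id t).prodMk (hasDerivAt_const t (φ y))
    have h3 := hy.hasFDerivAt.comp_hasDerivAt t h2
    refine h3.congr_of_eventuallyEq (Filter.Eventually.of_forall fun s => ?_)
    simp [hF, φ.left_inv hys]
  have hder : (fun y => deriv (fun s => f (s, y)) t) =ᶠ[𝓝 x] fun y => fderiv ℝ F (t, φ y) (1, 0) :=
    htime.mono fun y hy => hy.deriv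
  have hdz : HasFDerivAt (fun z : E => fderiv ℝ F (t, z) (1, 0))
      (((ContinuousLinearMap.apply ℝ ℝ ((1 : ℝ), (0 : E))).comp
        (fderiv ℝ (fderiv ℝ F) (t, φ x))).comp (ContinuousLinearMap.inr ℝ ℝ E)) (φ x) := by
    have h1 : HasFDerivAt (fun z : E => (t, z)) (ContinuousLinearMap.inr ℝ ℝ E) (φ x) :=
      hasFDerivAt_prodMk_right t (φ x)
    exact ((ContinuousLinearMap.apply ℝ ℝ ((1 : ℝ), (0 : E))).hasFDerivAt.comp (φ x)
      (hF2.hasFDerivAt.comp (φ x) h1))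
  have hdiff : DiffFun (E := E) (fun y => deriv (fun s => f (s, y)) t) x := by
    refine MDifferentiableAt.congr_of_eventuallyEq ?_ hder
    exact hdz.differentiableAt.mdifferentiableAt.comp x
      (mdifferentiableAt_extChartAt (mem_chart_source E x))
  refine ⟨htime.mono fun y hy => hy.differentiableAt, hdiff, fun v => ?_⟩
  have hR : dirDeriv v (fun y => deriv (fun s => f (s, y)) t)
      = fderiv ℝ (fderiv ℝ F) (t, φ x) (0, v) (1, 0) := by
    obtain ⟨L, hL, h1⟩ := exists_hasFDerivAt_chart hdiff
    have h2 : (fun z : E => deriv (fun s => f (s, φ.symm z)) t)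
        =ᶠ[𝓝 (φ x)] fun z => fderiv ℝ F (t, z) (1, 0) := by
      have hc : ContinuousAt φ.symm (φ x) := continuousAt_extChartAt_symm x
      have h3 : ∀ᶠ z in 𝓝 (φ x), deriv (fun s => f (s, φ.symm z)) t
          = fderiv ℝ F (t, φ (φ.symm z)) (1, 0) := by
        have := hc.tendsto
        rw [φ.left_inv hxs] at this
        exact this.eventually hder
      filter_upwards [h3, extChartAt_target_mem_nhds (I := 𝓘(ℝ, E)) x] with z hz hzt
      rw [hz, φ.right_inv hzt]
    rw [hL, h1.unique (hdz.congr_of_eventuallyEq h2)]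
    rfl
  have hL : (fun s => dirDeriv v (fun y => f (s, y))) =ᶠ[𝓝 t]
      fun s => fderiv ℝ F (s, φ x) (0, v) := by
    have hfev : ∀ᶠ s in 𝓝 t, ContMDiffAt (𝓘(ℝ, ℝ).prod 𝓘(ℝ, E)) 𝓘(ℝ, ℝ) 2 f (s, x) := by
      have := (contMDiffAt_iff_contMDiffAt_nhds (by decide)).1 hf
      exact (continuousAt_id.prodMk continuousAt_const).eventually this
    have hFs : ∀ᶠ s in 𝓝 t, DifferentiableAt ℝ F (s, φ x) :=
      (continuousAt_id.prodMk continuousAt_const).eventually hFev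
    filter_upwards [hfev, hFs] with s hs hFs
    have hd : DiffFun (E := E) (fun y => f (s, y)) x := by
      have h1 : MDifferentiableAt 𝓘(ℝ, E) (𝓘(ℝ, ℝ).prod 𝓘(ℝ, E)) (fun y : M => (s, y)) x :=
        mdifferentiableAt_const.prodMk mdifferentiableAt_id
      exact (hs.mdifferentiableAt two_ne_zero).comp x h1
    obtain ⟨L, hL, h1⟩ := exists_hasFDerivAt_chart hd
    have h2 : HasFDerivAt (fun z : E => F (s, z))
        ((fderiv ℝ F (s, φ x)).comp (ContinuousLinearMap.inr ℝ ℝ E)) (φ x) :=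
      hFs.hasFDerivAt.comp (φ x) (hasFDerivAt_prodMk_right s (φ x))
    rw [hL, h1.unique h2]
    rfl
  refine HasDerivAt.congr_of_eventuallyEq ?_ hL
  -- Both iterated derivatives are values of `D²F` at `(t, φ x)` on the pair `(1, 0)`, `(0, v)`.
  rw [hR, hsymm]
  have h1 : HasDerivAt (fun s : ℝ => (s, φ x)) ((1 : ℝ), (0 : E)) t :=
    (hasDerivAt_id t).prodMk (hasDerivAt_const t (φ x))
  have h2 := hF2.hasFDerivAt.comp_hasDerivAt t h1
  obtain ⟨w, hw⟩ : ∃ w : E, w = v := ⟨v, rfl⟩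
  rw [← hw]
  exact (ContinuousLinearMap.apply ℝ ℝ ((0 : ℝ), w)).hasFDerivAt.comp_hasDerivAt t h2

end Calculus

/-! ### Extrinsic quantities as traces of matrices in arbitrary bases. -/

section Frames

variable {E : Type*} [NormedAddCommGroup E] [NormedSpace ℝ E] [FiniteDimensional ℝ E]
  {M : Type*} [TopologicalSpace M] [ChartedSpace E M] [IsManifold 𝓘(ℝ, E) ∞ M] {x : M}
  {F : Type*} [AddCommGroup F] [Module ℝ F]

theorem IsBilin.trOn {g : FormField E M} {W : Submodule ℝ (TangentSpace 𝓘(ℝ, E) x)}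
    {V : Type*} [AddCommGroup V] [Module ℝ V]
    {β : V → V → TangentSpace 𝓘(ℝ, E) x → TangentSpace 𝓘(ℝ, E) x → F}
    (h : ∀ b b', IsBilin fun a a' => β a a' b b') :
    IsBilin fun a a' => trOn g x W fun b b' => β a a' b b' := by
  simp only [AlmostProduct.trOn, metricTrace]
  exact IsBilin.sum _ fun i => IsBilin.sum _ fun j => (h _ _).smul _

theorem trOn_congr {g : FormField E M} {W : Submodule ℝ (TangentSpace 𝓘(ℝ, E) x)}
    {β β' : TangentSpace 𝓘(ℝ, E) x → TangentSpace 𝓘(ℝ, E) x → F}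
    (h : ∀ u ∈ W, ∀ v ∈ W, β u v = β' u v) : trOn g x W β = trOn g x W β' := by
  simp only [trOn, metricTrace]
  exact Finset.sum_congr rfl fun i _ => Finset.sum_congr rfl fun j _ => by
    rw [h _ (Subtype.mem _) _ (Subtype.mem _)]

theorem trOn_zero (g : FormField E M) (W : Submodule ℝ (TangentSpace 𝓘(ℝ, E) x)) :
    trOn g x W (fun _ _ => (0 : F)) = 0 := by
  simp [trOn, metricTrace]

theorem trOn_map {F' : Type*} [AddCommGroup F'] [Module ℝ F'] {g : FormField E M}
    {W : Submodule ℝ (TangentSpace 𝓘(ℝ, E) x)} {l : F → F'} (hl : IsLinearMap ℝ l)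
    (β : TangentSpace 𝓘(ℝ, E) x → TangentSpace 𝓘(ℝ, E) x → F) :
    trOn g x W (fun u v => l (β u v)) = l (trOn g x W β) := by
  simp only [trOn, metricTrace]
  change _ = (hl.mk' l) _
  simp only [map_sum, map_smul, IsLinearMap.mk'_apply]

theorem trOn_mem {g : FormField E M} {W N : Submodule ℝ (TangentSpace 𝓘(ℝ, E) x)}
    {β : TangentSpace 𝓘(ℝ, E) x → TangentSpace 𝓘(ℝ, E) x → TangentSpace 𝓘(ℝ, E) x}
    (h : ∀ u v, β u v ∈ N) : trOn g x W β ∈ N := by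
  simp only [trOn, metricTrace]
  exact Submodule.sum_mem _ fun _ _ => Submodule.sum_mem _ fun _ _ => Submodule.smul_mem _ _ (h _ _)

theorem isBilin_smul_left {l : TangentSpace 𝓘(ℝ, E) x → ℝ} (hl : IsLinearMap ℝ l) :
    IsBilin (fun u v : TangentSpace 𝓘(ℝ, E) x => l u • v) :=
  ⟨fun v => ⟨fun a b => by rw [hl.map_add, add_smul], fun c a => by rw [hl.map_smul, smul_assoc]⟩,
    fun u => ⟨fun a b => smul_add _ _ _, fun c a => smul_comm _ _ _⟩⟩

theorem isLinearMap_metric (g : FormField E M) (v : TangentSpace 𝓘(ℝ, E) x) :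
    IsLinearMap ℝ (fun u => g x u v) := (isBilin_metric g x).left v

theorem isLinearMap_metric_right (g : FormField E M) (u : TangentSpace 𝓘(ℝ, E) x) :
    IsLinearMap ℝ (fun v => g x u v) := (isBilin_metric g x).right u

theorem metric_sharp {g : FormField E M} (hg : IsSmoothMetric g)
    {η : TangentSpace 𝓘(ℝ, E) x → ℝ} (hη : IsLinearMap ℝ η) (v : TangentSpace 𝓘(ℝ, E) x) :
    g x (sharp g x η) v = η v :=
  apply_sharp g x (hg.nondegenerate x) (hη.mk' η) v

/-- The matrix of a bilinear form in a family of vectors. -/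
def formMatrix {V ι : Type*} (β : V → V → ℝ) (X : ι → V) : Matrix ι ι ℝ :=
  Matrix.of fun i j => β (X i) (X j)

theorem sum_mul_eq_trace {ι : Type*} [Fintype ι] (P Q : Matrix ι ι ℝ) :
    ∑ i, ∑ j, P i j * Q i j = (P * Q.transpose).trace := by
  simp [Matrix.trace, Matrix.mul_apply]

namespace Splitting

variable {n p : ℕ} {S : Splitting E M n p} {g : FormField E M}

theorem IsAdapted.trOn_univ (h : S.IsAdapted g)
    {β : TangentSpace 𝓘(ℝ, E) x → TangentSpace 𝓘(ℝ, E) x → F} (hβ : IsBilin β) :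
    trOn g x ⊤ β = trOn g x (S.top x) β + trOn g x (S.perp x) β :=
  metricTrace_top (isBilin_metric g x) (S.isCompl x) (h.orthogonal x)
    (fun _ hu _ hv => h.orthogonal' hv hu) h.nondegenerate_top h.swap.nondegenerate_top hβ

theorem IsAdapted.trOn_univ_eq_top (h : S.IsAdapted g)
    {β : TangentSpace 𝓘(ℝ, E) x → TangentSpace 𝓘(ℝ, E) x → F} (hβ : IsBilin β)
    (h0 : ∀ u ∈ S.perp x, ∀ v ∈ S.perp x, β u v = 0) :
    trOn g x ⊤ β = trOn g x (S.top x) β := by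
  rw [h.trOn_univ hβ, trOn_congr (W := S.perp x) (β' := fun _ _ => 0) h0, trOn_zero, add_zero]

theorem IsAdapted.trOn_univ_eq_perp (h : S.IsAdapted g)
    {β : TangentSpace 𝓘(ℝ, E) x → TangentSpace 𝓘(ℝ, E) x → F} (hβ : IsBilin β)
    (h0 : ∀ u ∈ S.top x, ∀ v ∈ S.top x, β u v = 0) :
    trOn g x ⊤ β = trOn g x (S.perp x) β :=
  h.swap.trOn_univ_eq_top hβ h0

section Basis

variable {ι : Type*} [Fintype ι] [DecidableEq ι] (b : Basis ι ℝ (S.top x))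

/-- The inverse of the Gram matrix of a basis of a subspace. -/
def gramInv (g : FormField E M) {W : Submodule ℝ (TangentSpace 𝓘(ℝ, E) x)} (b : Basis ι ℝ W) :
    Matrix ι ι ℝ :=
  (gram g x fun i => (b i : TangentSpace 𝓘(ℝ, E) x))⁻¹

theorem IsAdapted.trOn_top (h : S.IsAdapted g)
    {β : TangentSpace 𝓘(ℝ, E) x → TangentSpace 𝓘(ℝ, E) x → F} (hβ : IsBilin β) :
    trOn g x (S.top x) β = ∑ i, ∑ j, gramInv g b i j • β (b i) (b j) :=
  metricTrace_eq_sum_basis (isBilin_metric g x) _ hβ b (h.isUnit_gram b)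

theorem IsAdapted.transpose_gram (h : S.IsAdapted g) (X : ι → TangentSpace 𝓘(ℝ, E) x) :
    (gram g x X).transpose = gram g x X := by
  ext i j
  exact h.metric.symm x _ _

theorem IsAdapted.transpose_gramInv (h : S.IsAdapted g) :
    (gramInv g b).transpose = gramInv g b := by
  rw [gramInv, Matrix.transpose_nonsing_inv, h.transpose_gram]

theorem IsAdapted.sharp_eq_sum (h : S.IsAdapted g) {η : TangentSpace 𝓘(ℝ, E) x → ℝ}
    (hη : IsLinearMap ℝ η) (h0 : ∀ v ∈ S.perp x, η v = 0) :
    sharp g x η = ∑ i, ∑ j, (gramInv g b i j * η (b i)) • (b j : TangentSpace 𝓘(ℝ, E) x) := by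
  rw [sharp, h.trOn_univ_eq_top (isBilin_smul_left hη) fun u hu v _ => by rw [h0 u hu, zero_smul],
    h.trOn_top b (isBilin_smul_left hη)]
  simp only [smul_smul]

/-- A scalar product is recovered from the components `g(u, b i)` and `g(v, b i)` by the inverse
Gram matrix. Such components are what can be followed in time. -/
theorem IsAdapted.metric_eq_sum (h : S.IsAdapted g) (u : TangentSpace 𝓘(ℝ, E) x)
    {v : TangentSpace 𝓘(ℝ, E) x} (hv : v ∈ S.top x) :
    g x u v = ∑ i, ∑ j, gramInv g b i j * (g x v (b i) * g x u (b j)) := by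
  conv_lhs => rw [← S.projTop_of_mem hv, h.projTop_eq_sum b v]
  simp only [map_sum, map_smul, smul_eq_mul, mul_assoc]
  rfl

theorem IsAdapted.metric_eq_sum_perp (h : S.IsAdapted g) (c : Basis ι ℝ (S.perp x))
    (u : TangentSpace 𝓘(ℝ, E) x) {v : TangentSpace 𝓘(ℝ, E) x} (hv : v ∈ S.perp x) :
    g x u v = ∑ i, ∑ j, gramInv g c i j * (g x v (c i) * g x u (c j)) :=
  IsAdapted.metric_eq_sum (S := S.swap) c h.swap u hv

theorem IsAdapted.trace_eq (h : S.IsAdapted g)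
    {β : TangentSpace 𝓘(ℝ, E) x → TangentSpace 𝓘(ℝ, E) x → ℝ} (hβ : IsBilin β) :
    trOn g x (S.top x) β
      = (gramInv g b * (formMatrix β fun i => (b i : TangentSpace 𝓘(ℝ, E) x)).transpose).trace := by
  rw [h.trOn_top b hβ, ← sum_mul_eq_trace]
  rfl

end Basis

variable {κ ι : Type*} [Fintype κ] [DecidableEq κ] [Fintype ι] [DecidableEq ι]
  (b : Basis ι ℝ (S.top x)) (c : Basis κ ℝ (S.perp x))

/-- The matrix of the component along `z` of a vector-valued bilinear map. -/
def compMatrix (g : FormField E M) (P : Tensor12 E M) (X : ι → TangentSpace 𝓘(ℝ, E) x)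
    (z : TangentSpace 𝓘(ℝ, E) x) : Matrix ι ι ℝ :=
  formMatrix (fun u v => g x (P x u v) z) X

/-- Expanding the outer scalar product over `c` separates the component index from the two
arguments, which then contract as matrix products. Only Gram and component matrices remain to be
differentiated. -/
theorem IsAdapted.normSq_eq (h : S.IsAdapted g) {P : Tensor12 E M} (hP : IsBilin (P x))
    (hPm : ∀ u v, P x u v ∈ S.perp x) :
    S.normSq g P x = ∑ a, ∑ a', gramInv g c a a' *
      (gramInv g b * compMatrix g P (fun i => (b i : TangentSpace 𝓘(ℝ, E) x)) (c a)
        * gramInv g b * (compMatrix g P (fun i => (b i : TangentSpace 𝓘(ℝ, E) x))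
          (c a')).transpose).trace := by
  have h1 : ∀ u v u' v', g x (P x u v) (P x u' v')
      = ∑ a, ∑ a', gramInv g c a a' * (g x (P x u' v') (c a) * g x (P x u v) (c a')) :=
    fun u v u' v' => h.metric_eq_sum_perp c _ (hPm u' v')
  have hb : ∀ a a', IsBilin fun b b' => g x (P x a b) (P x a' b') := fun a a' =>
    (isBilin_metric g x).comp (hP.right a) (hP.right a')
  have hb' : IsBilin fun a a' => trOn g x (S.top x) fun b b' => g x (P x a b) (P x a' b') :=
    IsBilin.trOn fun b b' => (isBilin_metric g x).comp (hP.left b) (hP.left b')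
  rw [normSq, h.trOn_top b hb']
  simp only [h.trOn_top b (hb _ _)]
  simp only [h1, smul_eq_mul, Finset.mul_sum]
  have h2 : ∀ a a', (gramInv g b * compMatrix g P (fun i => (b i : TangentSpace 𝓘(ℝ, E) x)) (c a)
        * gramInv g b * (compMatrix g P (fun i => (b i : TangentSpace 𝓘(ℝ, E) x))
          (c a')).transpose).trace
      = ∑ i, ∑ j, ∑ k, ∑ l, gramInv g b i j * (gramInv g b k l * (g x (P x (b j) (b l)) (c a)
        * g x (P x (b i) (b k)) (c a'))) := by
    intro a a'
    rw [← sum_mul_eq_trace]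
    simp only [Matrix.mul_apply, compMatrix, formMatrix, Matrix.of_apply, Finset.sum_mul]
    refine Finset.sum_congr rfl fun i _ => ?_
    rw [Finset.sum_congr rfl fun k _ => Finset.sum_comm, Finset.sum_comm]
    refine Finset.sum_congr rfl fun j _ => Finset.sum_congr rfl fun k _ =>
      Finset.sum_congr rfl fun l _ => ?_
    have : gramInv g b l k = gramInv g b k l := by
      conv_lhs => rw [← h.transpose_gramInv b, Matrix.transpose_apply]
    rw [this]
    ring
  simp only [h2, Finset.mul_sum]
  have h3 : ∀ f : ι → ι → ι → ι → κ → κ → ℝ, ∑ i, ∑ j, ∑ k, ∑ l, ∑ a, ∑ a', f i j k l a a'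
      = ∑ a, ∑ a', ∑ i, ∑ j, ∑ k, ∑ l, f i j k l a a' := by
    intro f
    simp only [← Fintype.sum_prod_type']
    exact Fintype.sum_equiv ⟨fun q => (q.2.2.2.2.1, q.2.2.2.2.2, q.1, q.2.1, q.2.2.1, q.2.2.2.1),
      fun q => (q.2.2.1, q.2.2.2.1, q.2.2.2.2.1, q.2.2.2.2.2, q.1, q.2.1), fun _ => rfl,
      fun _ => rfl⟩ _ _ fun _ => rfl
  rw [h3]
  exact Finset.sum_congr rfl fun a _ => Finset.sum_congr rfl fun a' _ =>
    Finset.sum_congr rfl fun i _ => Finset.sum_congr rfl fun j _ =>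
    Finset.sum_congr rfl fun k _ => Finset.sum_congr rfl fun l _ => by ring

theorem transpose_compMatrix_h (X : ι → TangentSpace 𝓘(ℝ, E) x)
    (z : TangentSpace 𝓘(ℝ, E) x) :
    (compMatrix g (S.h g) X z).transpose = compMatrix g (S.h g) X z := by
  ext i j
  simp only [compMatrix, formMatrix, Matrix.transpose_apply, Matrix.of_apply, h_symm (X i)]

theorem transpose_compMatrix_T (X : ι → TangentSpace 𝓘(ℝ, E) x)
    (z : TangentSpace 𝓘(ℝ, E) x) :
    (compMatrix g S.T X z).transpose = - compMatrix g S.T X z := by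
  ext i j
  simp only [compMatrix, formMatrix, Matrix.transpose_apply, Matrix.of_apply, Matrix.neg_apply,
    T_antisymm (X i), map_neg, neg_apply, neg_neg]

theorem IsAdapted.metric_H (h : S.IsAdapted g) (z : TangentSpace 𝓘(ℝ, E) x) :
    g x (S.H g x) z
      = (gramInv g b * compMatrix g (S.h g) (fun i => (b i : TangentSpace 𝓘(ℝ, E) x)) z).trace := by
  rw [H, ← trOn_map (isLinearMap_metric g z),
    h.trace_eq b (h.isBilin_h.map (isLinearMap_metric g z)), ← transpose_compMatrix_h]
  rfl

theorem H_mem : S.H g x ∈ S.perp x := trOn_mem fun u v => h_mem u v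

/-- The extrinsic scalar curvature in terms of bases. -/
theorem IsAdapted.Sex_eq (h : S.IsAdapted g) :
    S.Sex g x = ∑ a, ∑ a', gramInv g c a a' *
      ((gramInv g b * compMatrix g (S.h g) (fun i => (b i : TangentSpace 𝓘(ℝ, E) x)) (c a)).trace
        * (gramInv g b * compMatrix g (S.h g) (fun i => (b i : TangentSpace 𝓘(ℝ, E) x)) (c a')).trace
      - (gramInv g b * compMatrix g (S.h g) (fun i => (b i : TangentSpace 𝓘(ℝ, E) x)) (c a)
        * (gramInv g b * compMatrix g (S.h g) (fun i => (b i : TangentSpace 𝓘(ℝ, E) x))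
          (c a'))).trace) := by
  rw [Sex, h.normSq_eq b c h.isBilin_h h_mem, h.metric_eq_sum_perp c _ H_mem]
  simp only [h.metric_H b, ← Finset.sum_sub_distrib, mul_sub, transpose_compMatrix_h,
    Matrix.mul_assoc]

end Splitting
end Frames

/-! ### Pairings with forms supported on one distribution, and the tensors `𝓣` and `𝓚`. -/

section Contractions

variable {E : Type*} [NormedAddCommGroup E] [NormedSpace ℝ E] [FiniteDimensional ℝ E]
  {M : Type*} [TopologicalSpace M] [ChartedSpace E M] [IsManifold 𝓘(ℝ, E) ∞ M] {x : M}
  {F : Type*} [AddCommGroup F] [Module ℝ F]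

theorem isLinearMap_trOn {g : FormField E M} {W : Submodule ℝ (TangentSpace 𝓘(ℝ, E) x)}
    {V : Type*} [AddCommGroup V] [Module ℝ V]
    {β : V → TangentSpace 𝓘(ℝ, E) x → TangentSpace 𝓘(ℝ, E) x → F}
    (h : ∀ b b', IsLinearMap ℝ fun a => β a b b') :
    IsLinearMap ℝ fun a => trOn g x W (β a) := by
  simp only [trOn, metricTrace]
  constructor
  · intro u v
    simp only [(h _ _).map_add, smul_add, Finset.sum_add_distrib]
  · intro c v
    simp only [(h _ _).map_smul, Finset.smul_sum, smul_comm c]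

theorem isBilin_flatTensor {g : FormField E M} {L : Tensor11 E M} (hL : IsLinearMap ℝ (L x)) :
    IsBilin (flatTensor g L x) :=
  (isBilin_metric g x).comp hL ⟨fun _ _ => rfl, fun _ _ => rfl⟩

section

variable {g : FormField E M} {V : Type*} [AddCommGroup V] [Module ℝ V]
  {β : V → TangentSpace 𝓘(ℝ, E) x → ℝ}

theorem isLinearMap_sharp (hg : IsSmoothMetric g) (hβ : ∀ v, IsLinearMap ℝ fun u => β u v)
    (hβ' : ∀ u, IsLinearMap ℝ (β u)) : IsLinearMap ℝ fun u => sharp g x (β u) :=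
  ⟨fun a b => eq_of_metric_eq hg fun w => by
      rw [map_add, add_apply, metric_sharp hg (hβ' _), metric_sharp hg (hβ' _),
        metric_sharp hg (hβ' _), (hβ w).map_add],
    fun c a => eq_of_metric_eq hg fun w => by
      rw [map_smul, smul_apply, metric_sharp hg (hβ' _), metric_sharp hg (hβ' _), (hβ w).map_smul]⟩

end

namespace Splitting

variable {n p : ℕ} {S : Splitting E M n p} {g : FormField E M}

/-- A symmetric bilinear form on a tangent space which vanishes on the second distribution. -/
structure IsTopForm (S : Splitting E M n p) (x : M)
    (β : TangentSpace 𝓘(ℝ, E) x → TangentSpace 𝓘(ℝ, E) x → ℝ) : Prop where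
  bilin : IsBilin β
  symm : ∀ u v, β u v = β v u
  vanish : ∀ u ∈ S.perp x, ∀ v, β u v = 0

/-- A bilinear map on a tangent space which depends only on the components in the first
distribution and takes values in the second one. -/
structure IsExtrinsic (S : Splitting E M n p) (x : M)
    (P : TangentSpace 𝓘(ℝ, E) x → TangentSpace 𝓘(ℝ, E) x → TangentSpace 𝓘(ℝ, E) x) : Prop where
  bilin : IsBilin P
  mem : ∀ u v, P u v ∈ S.perp x
  projTop : ∀ u v, P (S.projTop x u) (S.projTop x v) = P u v

theorem IsExtrinsic.right {P : TangentSpace 𝓘(ℝ, E) x → TangentSpace 𝓘(ℝ, E) x →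
    TangentSpace 𝓘(ℝ, E) x} (hP : S.IsExtrinsic x P) {v : TangentSpace 𝓘(ℝ, E) x}
    (hv : v ∈ S.perp x) (u : TangentSpace 𝓘(ℝ, E) x) : P u v = 0 := by
  rw [← hP.projTop, S.projTop_of_mem_perp hv, hP.bilin.zero_right]

theorem IsExtrinsic.projTop_left {P : TangentSpace 𝓘(ℝ, E) x → TangentSpace 𝓘(ℝ, E) x →
    TangentSpace 𝓘(ℝ, E) x} (hP : S.IsExtrinsic x P) (u v : TangentSpace 𝓘(ℝ, E) x) :
    P (S.projTop x u) v = P u v := by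
  rw [← hP.projTop, S.projTop_of_mem (S.projTop_mem u), hP.projTop]

theorem IsExtrinsic.projTop_right {P : TangentSpace 𝓘(ℝ, E) x → TangentSpace 𝓘(ℝ, E) x →
    TangentSpace 𝓘(ℝ, E) x} (hP : S.IsExtrinsic x P) (u v : TangentSpace 𝓘(ℝ, E) x) :
    P u (S.projTop x v) = P u v := by
  rw [← hP.projTop, S.projTop_of_mem (S.projTop_mem v), hP.projTop]

theorem IsAdapted.isExtrinsic_h (h : S.IsAdapted g) : S.IsExtrinsic x (S.h g x) :=
  ⟨h.isBilin_h, h_mem, h.h_projTop⟩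

theorem IsAdapted.isExtrinsic_T (h : S.IsAdapted g) : S.IsExtrinsic x (S.T x) :=
  ⟨h.isBilin_T, T_mem, h.T_projTop⟩

variable {κ ι : Type*} [Fintype κ] [DecidableEq κ] [Fintype ι] [DecidableEq ι]
  (b : Basis ι ℝ (S.top x)) (c : Basis κ ℝ (S.perp x)) {A B : Tensor02 E M}

theorem IsTopForm.transpose {β : TangentSpace 𝓘(ℝ, E) x → TangentSpace 𝓘(ℝ, E) x → ℝ}
    (hβ : S.IsTopForm x β) (X : ι → TangentSpace 𝓘(ℝ, E) x) :
    (formMatrix β X).transpose = formMatrix β X := by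
  ext i j
  exact hβ.symm _ _

theorem IsAdapted.trG_eq (h : S.IsAdapted g) (hB : S.IsTopForm x (B x)) :
    trG g B x = (gramInv g b * formMatrix (B x) fun i => (b i : TangentSpace 𝓘(ℝ, E) x)).trace := by
  rw [trG, h.trOn_univ_eq_top hB.bilin fun u hu v _ => hB.vanish u hu v, h.trace_eq b hB.bilin,
    hB.transpose]

theorem gramInv_symm (h : S.IsAdapted g) (i j : ι) : gramInv g b i j = gramInv g b j i := by
  conv_lhs => rw [← h.transpose_gramInv b, Matrix.transpose_apply]

theorem IsAdapted.sharpTensor_eq (h : S.IsAdapted g) (hB : S.IsTopForm x (B x)) (i : ι) :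
    sharpTensor g B x (b i) = ∑ j, (formMatrix (B x) (fun i => (b i : TangentSpace 𝓘(ℝ, E) x))
      * gramInv g b) i j • (b j : TangentSpace 𝓘(ℝ, E) x) := by
  rw [sharpTensor, h.sharp_eq_sum b (hB.bilin.right _) fun v hv => by
    rw [hB.symm]; exact hB.vanish v hv _]
  rw [Finset.sum_comm]
  refine Finset.sum_congr rfl fun j _ => ?_
  rw [← Finset.sum_smul]
  congr 1
  rw [Matrix.mul_apply]
  exact Finset.sum_congr rfl fun k _ => mul_comm _ _

/-- The pairing of a tensor with a form vanishing on the second distribution. -/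
theorem IsAdapted.pairing_eq_trace (h : S.IsAdapted g) (hA : IsBilin (A x))
    (hB : S.IsTopForm x (B x)) :
    pairing g A B x = (gramInv g b * formMatrix (B x) (fun i => (b i : TangentSpace 𝓘(ℝ, E) x))
      * gramInv g b * formMatrix (A x) fun i => (b i : TangentSpace 𝓘(ℝ, E) x)).trace := by
  have hs : IsLinearMap ℝ (sharpTensor g B x) :=
    isLinearMap_sharp h.metric hB.bilin.left hB.bilin.right
  have hs0 : ∀ u ∈ S.perp x, sharpTensor g B x u = 0 := fun u hu =>
    eq_of_metric_eq h.metric fun w => by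
      rw [sharpTensor, metric_sharp h.metric (hB.bilin.right u), hB.vanish u hu, map_zero,
        zero_apply]
  have hbil : IsBilin fun u v => A x (sharpTensor g B x u) v :=
    hA.comp hs ⟨fun _ _ => rfl, fun _ _ => rfl⟩
  rw [AlmostProduct.pairing_eq g x (h.metric.nondegenerate x) A B hA.right,
    h.trOn_univ_eq_top hbil fun u hu v _ => by rw [hs0 u hu, hA.zero_left], h.trOn_top b hbil]
  simp only [h.sharpTensor_eq b hB, hA.sum_left]
  rw [Matrix.mul_assoc, Matrix.mul_assoc, ← Matrix.mul_assoc (formMatrix (B x) _), Matrix.trace]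
  simp only [Matrix.diag, Matrix.mul_apply (M := gramInv g b), smul_eq_mul]
  rw [Finset.sum_comm]
  refine Finset.sum_congr rfl fun j _ => Finset.sum_congr rfl fun i _ => ?_
  rw [gramInv_symm b h]
  congr 1

theorem IsAdapted.pairingVec_eq (h : S.IsAdapted g) {P : Tensor12 E M} (hP : IsBilin (P x))
    (hB : S.IsTopForm x (B x)) :
    pairingVec g P B x = ∑ i, ∑ j,
      (gramInv g b * formMatrix (B x) (fun i => (b i : TangentSpace 𝓘(ℝ, E) x)) * gramInv g b) i j
        • P x (b i) (b j) := by
  have h1 : ∀ u u', IsBilin fun v v' => B x u v • P x u' v' := fun u u' =>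
    ⟨fun w => ⟨fun _ _ => by rw [(hB.bilin.right u).map_add, add_smul],
        fun _ _ => by rw [(hB.bilin.right u).map_smul, smul_assoc]⟩,
      fun w => ⟨fun _ _ => by rw [(hP.right u').map_add, smul_add],
        fun _ _ => by rw [(hP.right u').map_smul, smul_comm]⟩⟩
  have h2 : ∀ v v', IsBilin fun u u' => B x u v • P x u' v' := fun v v' =>
    ⟨fun w => ⟨fun _ _ => by rw [(hB.bilin.left v).map_add, add_smul],
        fun _ _ => by rw [(hB.bilin.left v).map_smul, smul_assoc]⟩,
      fun w => ⟨fun _ _ => by rw [(hP.left v').map_add, smul_add],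
        fun _ _ => by rw [(hP.left v').map_smul, smul_comm]⟩⟩
  rw [pairingVec, h.trOn_univ_eq_top (IsBilin.trOn h2) fun u hu u' _ => by
    simp only [hB.vanish u hu, zero_smul, trOn_zero]]
  simp only [fun u u' => h.trOn_univ_eq_top (h1 u u') fun v hv v' _ => by
    rw [hB.symm, hB.vanish v hv, zero_smul]]
  rw [h.trOn_top b (IsBilin.trOn h2)]
  simp only [h.trOn_top b (h1 _ _), Finset.smul_sum, smul_smul, Matrix.mul_apply, Finset.sum_mul,
    Finset.sum_smul, formMatrix, Matrix.of_apply]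
  rw [Finset.sum_comm]
  refine Finset.sum_congr rfl fun j _ => ?_
  rw [Finset.sum_congr rfl fun i _ => Finset.sum_comm, Finset.sum_comm]
  refine Finset.sum_congr rfl fun l _ => ?_
  rw [Finset.sum_comm]
  refine Finset.sum_congr rfl fun k _ => Finset.sum_congr rfl fun i _ => ?_
  rw [gramInv_symm b h i j]
  congr 1
  ring

section Sharp

variable {P Q : Tensor12 E M}

theorem IsExtrinsic.isBilin_sharp (h : S.IsAdapted g) (hP : S.IsExtrinsic x (P x)) :
    IsBilin fun (z u : TangentSpace 𝓘(ℝ, E) x) => sharp g x fun v => g x (P x u v) z := by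
  have hl : ∀ z u, IsLinearMap ℝ fun v => g x (P x u v) z := fun z u =>
    (hP.bilin.map (isLinearMap_metric g z)).right u
  exact ⟨fun u => isLinearMap_sharp h.metric (fun v => isLinearMap_metric_right g _)
      fun z => hl z u, fun z => isLinearMap_sharp h.metric
      (hP.bilin.map (isLinearMap_metric g z)).left fun u => hl z u⟩

/-- The composition of two of the operators associated with extrinsic tensors. -/
theorem IsExtrinsic.metric_sharp_eq (h : S.IsAdapted g) (hP : S.IsExtrinsic x (P x))
    (hQ : S.IsExtrinsic x (Q x)) (z z' : TangentSpace 𝓘(ℝ, E) x) (i j : ι) :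
    g x (Q x (sharp g x fun v => g x (P x (b i) v) z') (b j)) z
      = (compMatrix g P (fun i => (b i : TangentSpace 𝓘(ℝ, E) x)) z' * gramInv g b
        * compMatrix g Q (fun i => (b i : TangentSpace 𝓘(ℝ, E) x)) z) i j := by
  rw [h.sharp_eq_sum b ((hP.bilin.map (isLinearMap_metric g z')).right _) fun v hv => by
    rw [hP.right hv, map_zero, zero_apply]]
  have hb := hQ.bilin.map (isLinearMap_metric g z)
  rw [Finset.sum_comm]
  simp only [← Finset.sum_smul]
  rw [hb.sum_left, Matrix.mul_apply]
  refine Finset.sum_congr rfl fun l _ => ?_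
  rw [Matrix.mul_apply, smul_eq_mul]
  congr 1
  exact Finset.sum_congr rfl fun k _ => mul_comm _ _

end Sharp

theorem IsAdapted.isLinearMap_TT (h : S.IsAdapted g) : IsLinearMap ℝ (S.TT g x) := by
  have hb := IsExtrinsic.isBilin_sharp h (h.isExtrinsic_T (x := x))
  refine isLinearMap_trOn fun z z' => ?_
  exact ⟨fun u v => by
      simp only [TSharp]
      rw [(hb.right z').map_add, (hb.right z).map_add],
    fun r u => by
      simp only [TSharp]
      rw [(hb.right z').map_smul, (hb.right z).map_smul]⟩

theorem IsAdapted.isLinearMap_KK (h : S.IsAdapted g) : IsLinearMap ℝ (S.KK g x) := by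
  have hb := IsExtrinsic.isBilin_sharp h (h.isExtrinsic_T (x := x))
  have hb' := IsExtrinsic.isBilin_sharp h (h.isExtrinsic_h (x := x))
  refine isLinearMap_trOn fun z z' => ?_
  exact ⟨fun u v => by
      simp only [TSharp, Splitting.A]
      rw [(hb.right z').map_add, (hb'.right z).map_add, (hb'.right z').map_add, (hb.right z).map_add]
      abel,
    fun r u => by
      simp only [TSharp, Splitting.A]
      rw [(hb.right z').map_smul, (hb'.right z).map_smul, (hb'.right z').map_smul,
        (hb.right z).map_smul, smul_sub]⟩

theorem IsAdapted.trOn_perp (h : S.IsAdapted g)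
    {β : TangentSpace 𝓘(ℝ, E) x → TangentSpace 𝓘(ℝ, E) x → F} (hβ : IsBilin β) :
    trOn g x (S.perp x) β = ∑ i, ∑ j, gramInv g c i j • β (c i) (c j) :=
  IsAdapted.trOn_top (S := S.swap) c h.swap hβ

/-- Since `g(T♯_z w, v) = g(T(w, v), z)`, composing two such operators multiplies component matrices
with `gramInv` in between. The inner operator gives the left factor, hence the reversed order of
`a'` and `a`. -/
theorem IsAdapted.flat_TT_eq (h : S.IsAdapted g) (i j : ι) :
    flatTensor g (S.TT g) x (b i) (b j) = ∑ a, ∑ a', gramInv g c a a' *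
      (compMatrix g S.T (fun i => (b i : TangentSpace 𝓘(ℝ, E) x)) (c a') * gramInv g b
        * compMatrix g S.T (fun i => (b i : TangentSpace 𝓘(ℝ, E) x)) (c a)) i j := by
  have hT := h.isExtrinsic_T (x := x)
  have hb := IsExtrinsic.isBilin_sharp h hT
  have hl : ∀ z u, IsLinearMap ℝ fun v => g x (S.T x u v) z := fun z u =>
    (hT.bilin.map (isLinearMap_metric g z)).right u
  have hm : ∀ z u v, g x (S.TSharp g z u) v = g x (S.T x u v) z := fun z u v =>
    metric_sharp h.metric (hl z u) v
  rw [flatTensor, TT, ← trOn_map (isLinearMap_metric g (b j : TangentSpace 𝓘(ℝ, E) x))]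
  simp only [hm]
  rw [h.trOn_perp c]
  · simp only [smul_eq_mul]
    exact Finset.sum_congr rfl fun a _ => Finset.sum_congr rfl fun a' _ => by
      rw [← hT.metric_sharp_eq b h hT]
      rfl
  · exact ⟨fun z' => isLinearMap_metric_right g _,
      fun z => ⟨fun u v => by
          simp only [TSharp]
          rw [(hb.left _).map_add, (hT.bilin.left _).map_add, map_add, add_apply],
        fun r u => by
          simp only [TSharp]
          rw [(hb.left _).map_smul, (hT.bilin.left _).map_smul, map_smul, smul_apply]⟩⟩

/-- Same composition rule as in `flat_TT_eq`: `T♯ A` gives the product with the matrix of `h` on the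
left, and `A T♯` the product with the matrix of `T` on the left. -/
theorem IsAdapted.flat_KK_eq (h : S.IsAdapted g) (i j : ι) :
    flatTensor g (S.KK g) x (b i) (b j) = ∑ a, ∑ a', gramInv g c a a' *
      (compMatrix g (S.h g) (fun i => (b i : TangentSpace 𝓘(ℝ, E) x)) (c a') * gramInv g b
        * compMatrix g S.T (fun i => (b i : TangentSpace 𝓘(ℝ, E) x)) (c a)
      - compMatrix g S.T (fun i => (b i : TangentSpace 𝓘(ℝ, E) x)) (c a') * gramInv g b
        * compMatrix g (S.h g) (fun i => (b i : TangentSpace 𝓘(ℝ, E) x)) (c a)) i j := by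
  have hT := h.isExtrinsic_T (x := x)
  have hh := h.isExtrinsic_h (x := x)
  have hb := IsExtrinsic.isBilin_sharp h hT
  have hb' := IsExtrinsic.isBilin_sharp h hh
  have hm : ∀ z u v, g x (S.TSharp g z u) v = g x (S.T x u v) z := fun z u v =>
    metric_sharp h.metric ((hT.bilin.map (isLinearMap_metric g z)).right u) v
  have hm' : ∀ z u v, g x (S.A g z u) v = g x (S.h g x u v) z := fun z u v =>
    metric_sharp h.metric ((hh.bilin.map (isLinearMap_metric g z)).right u) v
  rw [flatTensor, KK, ← trOn_map (isLinearMap_metric g (b j : TangentSpace 𝓘(ℝ, E) x))]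
  simp only [map_sub, sub_apply, hm, hm']
  rw [h.trOn_perp c]
  · simp only [smul_eq_mul, Matrix.sub_apply]
    exact Finset.sum_congr rfl fun a _ => Finset.sum_congr rfl fun a' _ => by
      rw [← hh.metric_sharp_eq b h hT, ← hT.metric_sharp_eq b h hh]
      rfl
  · refine IsBilin.sub ⟨fun z' => isLinearMap_metric_right g _, fun z => ⟨fun u v => ?_, fun r u => ?_⟩⟩
      ⟨fun z' => isLinearMap_metric_right g _, fun z => ⟨fun u v => ?_, fun r u => ?_⟩⟩
    · simp only [Splitting.A]
      rw [(hb'.left _).map_add, (hT.bilin.left _).map_add, map_add, add_apply]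
    · simp only [Splitting.A]
      rw [(hb'.left _).map_smul, (hT.bilin.left _).map_smul, map_smul, smul_apply]
    · simp only [TSharp]
      rw [(hb.left _).map_add, (hh.bilin.left _).map_add, map_add, add_apply]
    · simp only [TSharp]
      rw [(hb.left _).map_smul, (hh.bilin.left _).map_smul, map_smul, smul_apply]

end Splitting
end Contractions

/-! ### Divergence of vector fields and differentiability of extrinsic tensors. -/

section Divergence

variable {E : Type*} [NormedAddCommGroup E] [NormedSpace ℝ E] [FiniteDimensional ℝ E]
  {M : Type*} [TopologicalSpace M] [ChartedSpace E M] [IsManifold 𝓘(ℝ, E) ∞ M] {x : M}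

theorem diffFun_sum {ι : Type*} {s : Finset ι} {f : ι → M → ℝ}
    (h : ∀ i ∈ s, DiffFun (E := E) (f i) x) : DiffFun (E := E) (fun y => ∑ i ∈ s, f i y) x := by
  classical
  induction s using Finset.induction_on with
  | empty => simpa using (mdifferentiableAt_const (I := 𝓘(ℝ, E)) (I' := 𝓘(ℝ, ℝ)) : DiffFun (E := E) (fun _ : M => (0 : ℝ)) x)
  | insert a s ha ih =>
    simp only [Finset.sum_insert ha]
    exact (h a (Finset.mem_insert_self a s)).add
      (ih fun i hi => h i (Finset.mem_insert_of_mem hi))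

theorem mdifferentiableAt_pi_iff {ι : Type*} [Fintype ι] {F : Type*} [NormedAddCommGroup F]
    [NormedSpace ℝ F] {f : M → ι → F} :
    MDifferentiableAt 𝓘(ℝ, E) 𝓘(ℝ, ι → F) f x
      ↔ ∀ i, MDifferentiableAt 𝓘(ℝ, E) 𝓘(ℝ, F) (fun y => f y i) x := by
  simp only [mdifferentiableAt_iff, writtenInExtChartAt, extChartAt_model_space_eq_id,
    continuousAt_pi, forall_and]
  refine and_congr_right fun _ => ?_
  exact differentiableWithinAt_pi

theorem diffField_sum {ι : Type*} {s : Finset ι} {Y : ι → VField E M}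
    (h : ∀ i, DiffField (Y i) x) : DiffField (fun y => ∑ i ∈ s, Y i y) x :=
  MDifferentiableAt.sum_section fun i _ => h i

section MatrixFunctions

variable {ι : Type*} [Fintype ι] [DecidableEq ι]

/-- A matrix-valued function with differentiable entries. -/
def DiffMat (E : Type*) [NormedAddCommGroup E] [NormedSpace ℝ E] [ChartedSpace E M]
    (A : M → Matrix ι ι ℝ) (x : M) : Prop :=
  ∀ i j, DiffFun (E := E) (fun y => A y i j) x

/-- The entrywise derivative of a matrix-valued function. -/
def matDeriv (v : TangentSpace 𝓘(ℝ, E) x) (A : M → Matrix ι ι ℝ) : Matrix ι ι ℝ :=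
  Matrix.of fun i j => dirDeriv v fun y => A y i j

variable {A B : M → Matrix ι ι ℝ}

theorem DiffMat.mul (hA : DiffMat E A x) (hB : DiffMat E B x) :
    DiffMat E (fun y => A y * B y) x := by
  intro i j
  simp only [Matrix.mul_apply]
  exact diffFun_sum fun k _ => (hA i k).mul (hB k j)

theorem DiffMat.trace (hA : DiffMat E A x) : DiffFun (E := E) (fun y => (A y).trace) x :=
  diffFun_sum fun k _ => hA k k

theorem DiffMat.inv (hA : DiffMat E A x) (hu : IsUnit (A x).det) :
    DiffMat E (fun y => (A y)⁻¹) x := by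
  intro i j
  have h1 : MDifferentiableAt 𝓘(ℝ, E) 𝓘(ℝ, ι → ι → ℝ) (fun y i j => A y i j) x :=
    mdifferentiableAt_pi_iff.2 fun i => mdifferentiableAt_pi_iff.2 fun j => hA i j
  exact ((contDiffAt_inv_apply 1 (A := fun i j => A x i j) hu i j).differentiableAt
    one_ne_zero).mdifferentiableAt.comp x (f := fun y i j => A y i j) h1

/-- Along such a curve directional derivatives are ordinary ones, so the product and inverse rules
of `HasMatDeriv` also serve in the space variables. -/
theorem DiffMat.exists_curve (hA : DiffMat E A x) (hB : DiffMat E B x)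
    (v : TangentSpace 𝓘(ℝ, E) x) : ∃ c : ℝ → M, c 0 = x ∧
      (∀ f : M → ℝ, DiffFun (E := E) f x → HasDerivAt (fun s => f (c s)) (dirDeriv v f) 0) ∧
      HasMatDeriv (fun s => A (c s)) (matDeriv v A) 0 ∧
      HasMatDeriv (fun s => B (c s)) (matDeriv v B) 0 := by
  obtain ⟨c, hc, h⟩ := AlmostProduct.exists_curve v
  exact ⟨c, hc, h, fun i j => h _ (hA i j), fun i j => h _ (hB i j)⟩

theorem dirDeriv_trace_inv_mul (hA : DiffMat E A x) (hB : DiffMat E B x) (hu : IsUnit (A x).det)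
    (v : TangentSpace 𝓘(ℝ, E) x) : dirDeriv v (fun y => ((A y)⁻¹ * B y).trace)
      = (-((A x)⁻¹ * matDeriv v A * (A x)⁻¹) * B x + (A x)⁻¹ * matDeriv v B).trace := by
  obtain ⟨c, rfl, h, h1, h2⟩ := hA.exists_curve hB v
  exact (h _ ((hA.inv hu).mul hB).trace).unique ((h1.inv hu).mul h2).trace

theorem matDeriv_inv_mul_inv (hA : DiffMat E A x) (hB : DiffMat E B x) (hu : IsUnit (A x).det)
    (v : TangentSpace 𝓘(ℝ, E) x) : matDeriv v (fun y => (A y)⁻¹ * B y * (A y)⁻¹)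
      = (-((A x)⁻¹ * matDeriv v A * (A x)⁻¹) * B x + (A x)⁻¹ * matDeriv v B) * (A x)⁻¹
        + (A x)⁻¹ * B x * -((A x)⁻¹ * matDeriv v A * (A x)⁻¹) := by
  obtain ⟨c, rfl, h, h1, h2⟩ := hA.exists_curve hB v
  ext i j
  exact (h _ ((((hA.inv hu).mul hB).mul (hA.inv hu)) i j)).unique
    ((((h1.inv hu).mul h2).mul (h1.inv hu)) i j)

end MatrixFunctions

section DivField

variable {g : FormField E M}

theorem divField_congr (g : FormField E M) {Y Y' : VField E M} (h : Y =ᶠ[𝓝 x] Y') :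
    divField g Y x = divField g Y' x := by
  change trOn g x ⊤ (fun u v => g x (nabla g u Y) v) = trOn g x ⊤ (fun u v => g x (nabla g u Y') v)
  simp only [nabla_congr g _ h]

theorem divField_add (hg : IsSmoothMetric g) {Y Y' : VField E M} (hY : DiffField Y x)
    (hY' : DiffField Y' x) :
    divField g (fun y => Y y + Y' y) x = divField g Y x + divField g Y' x := by
  change trOn g x ⊤ (fun u v => g x (nabla g u (Y + Y')) v) = trOn g x ⊤ _ + trOn g x ⊤ _
  simp only [nabla_add hg _ hY hY', map_add, add_apply, trOn_add]
  rfl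

theorem divField_smul (hg : IsSmoothMetric g) {f : M → ℝ} {Y : VField E M}
    (hf : DiffFun (E := E) f x) (hY : DiffField Y x) :
    divField g (fun y => f y • Y y) x = dirDeriv (Y x) f + f x * divField g Y x := by
  change trOn g x ⊤ (fun u v => g x (nabla g u (f • Y)) v) = _
  have h1 : ∀ u v, g x (nabla g u (f • Y)) v
      = g x (Y x) (dirDeriv u f • v) + f x * g x (nabla g u Y) v := fun u v => by
    rw [nabla_smul hg u hf hY]
    simp only [map_add, add_apply, map_smul, smul_apply, smul_eq_mul]
  have hl : IsLinearMap ℝ fun u : TangentSpace 𝓘(ℝ, E) x => dirDeriv u f :=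
    ⟨fun u v => dirDeriv_add_left u v f, fun c u => dirDeriv_smul_left c u f⟩
  simp only [h1]
  rw [trOn_add, trOn_mul, trOn_map (isLinearMap_metric_right g (Y x))]
  congr 1
  -- The trace of `u ↦ u(f) Y` is the scalar product of `Y` with the gradient of `f`, that is
  -- `Y(f)`.
  change g x (Y x) (sharp g x fun u => dirDeriv u f) = _
  rw [hg.symm, metric_sharp hg hl]

theorem divField_zero (hg : IsSmoothMetric g) : divField g (fun y => (0 : TangentSpace 𝓘(ℝ, E) y)) x = 0 := by
  have h0 : DiffField (fun y => (0 : TangentSpace 𝓘(ℝ, E) y)) x :=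
    diffField_sum (s := (∅ : Finset Empty)) (Y := fun i => i.elim) fun i => i.elim
  have := divField_add hg h0 h0
  simp only [add_zero] at this
  linarith

theorem divField_sum (hg : IsSmoothMetric g) {ι : Type*} (s : Finset ι) {Y : ι → VField E M}
    (hY : ∀ i, DiffField (Y i) x) :
    divField g (fun y => ∑ i ∈ s, Y i y) x = ∑ i ∈ s, divField g (Y i) x := by
  classical
  induction s using Finset.induction_on with
  | empty => simpa using divField_zero hg
  | insert a s ha ih =>
    simp only [Finset.sum_insert ha]
    rw [divField_add hg (hY a) (diffField_sum hY), ih]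

theorem divField_sum_smul (hg : IsSmoothMetric g) {ι : Type*} [Fintype ι] {A : M → Matrix ι ι ℝ}
    (hA : DiffMat E A x) {Y : ι → ι → VField E M} (hY : ∀ i j, DiffField (Y i j) x) :
    divField g (fun y => ∑ i, ∑ j, A y i j • Y i j y) x
      = ∑ i, ∑ j, (dirDeriv (Y i j x) (fun y => A y i j) + A x i j * divField g (Y i j) x) := by
  have hs : ∀ i j, DiffField (fun y => A y i j • Y i j y) x := fun i j =>
    diffField_smul (hA i j) (hY i j)
  rw [divField_sum hg _ fun i => diffField_sum (hs i)]
  refine Finset.sum_congr rfl fun i _ => ?_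
  rw [divField_sum hg _ (hs i)]
  exact Finset.sum_congr rfl fun j _ => divField_smul hg (hA i j) (hY i j)

end DivField

namespace Splitting

variable {n p : ℕ} {S : Splitting E M n p} {g : FormField E M}

theorem exists_basis_top (S : Splitting E M n p) (x : M) : Nonempty (Basis (Fin n) ℝ (S.top x)) := by
  obtain ⟨U, hU, X, -, hX⟩ := S.smooth_top x
  obtain ⟨b, -⟩ := exists_basis_of_span (hX x (mem_of_mem_nhds hU)).1 (hX x (mem_of_mem_nhds hU)).2
  exact ⟨b⟩

theorem finrank_top (S : Splitting E M n p) (x : M) : finrank ℝ (S.top x) = n := by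
  obtain ⟨b⟩ := S.exists_basis_top x
  simp [finrank_eq_card_basis b]

section Frame

variable (b : Basis (Fin n) ℝ (S.top x))

theorem extTop_basis (i : Fin n) :
    S.extTop (b i : TangentSpace 𝓘(ℝ, E) x) x = b i := extTop_self_of_mem (b i).2

/-- The Gram matrix of the local frame extending a basis of the distribution at `x`. -/
def frameGram (g : FormField E M) (b : Basis (Fin n) ℝ (S.top x)) (y : M) :
    Matrix (Fin n) (Fin n) ℝ :=
  gram g y fun i => S.extTop (b i : TangentSpace 𝓘(ℝ, E) x) y

theorem frameGram_self : frameGram g b x = gram g x fun i => (b i : TangentSpace 𝓘(ℝ, E) x) := by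
  simp only [frameGram, extTop_basis]

theorem IsAdapted.isUnit_frameGram (h : S.IsAdapted g) : IsUnit (frameGram g b x).det := by
  rw [frameGram_self]
  exact h.isUnit_gram b

theorem IsAdapted.diffMat_frameGram (h : S.IsAdapted g) : DiffMat E (frameGram g b) x := fun _ _ =>
  diffFun_metric h.metric (h.diffField_extTop _) (h.diffField_extTop _)

/-- The local frame extending a basis of the distribution at `x`. -/
theorem IsAdapted.eventually_frame (h : S.IsAdapted g) : ∀ᶠ y in 𝓝 x,
    ∃ b' : Basis (Fin n) ℝ (S.top y), ∀ i, (b' i : TangentSpace 𝓘(ℝ, E) y)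
      = S.extTop (b i : TangentSpace 𝓘(ℝ, E) x) y := by
  have hc : ContinuousAt (fun y => (frameGram g b y).det) x := by
    have h1 : ContinuousAt (fun y i j => frameGram g b y i j) x :=
      continuousAt_pi.2 fun i => continuousAt_pi.2 fun j => (h.diffMat_frameGram b i j).continuousAt
    exact ((contDiff_det 0).continuous.continuousAt).comp (f := fun y i j => frameGram g b y i j) h1
  -- Where the Gram determinant is nonzero the extended vectors are independent, since a linear
  -- relation would give a null vector of the Gram matrix.
  filter_upwards [hc.eventually_ne (h.isUnit_frameGram b).ne_zero] with y hy
  have hli : LinearIndependent ℝ fun i => (⟨S.extTop (b i : TangentSpace 𝓘(ℝ, E) x) y,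
      extTop_mem _ y⟩ : S.top y) := by
    rw [Fintype.linearIndependent_iff]
    intro c hc
    have h0 : Matrix.vecMul c (frameGram g b y) = 0 := by
      funext j
      have h1 := congrArg (fun w : S.top y => g y (w : TangentSpace 𝓘(ℝ, E) y)
        (S.extTop (b j : TangentSpace 𝓘(ℝ, E) x) y)) hc
      simp only [AddSubmonoidClass.coe_finsetSum, Submodule.coe_smul] at h1
      rw [(isBilin_metric g y).sum_left] at h1
      simpa [Matrix.vecMul, dotProduct, frameGram, gram] using h1
    have := Matrix.eq_zero_of_vecMul_eq_zero hy h0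
    exact fun i => congrFun this i
  exact ⟨basisOfLinearIndependentOfCardEqFinrank' _ hli (by simp [S.finrank_top y]), fun i => by
    rw [coe_basisOfLinearIndependentOfCardEqFinrank']⟩

end Frame

theorem exists_basis_perp (S : Splitting E M n p) (x : M) : Nonempty (Basis (Fin p) ℝ (S.perp x)) :=
  S.swap.exists_basis_top x

theorem IsAdapted.eventually_frame_perp (h : S.IsAdapted g) (c : Basis (Fin p) ℝ (S.perp x)) :
    ∀ᶠ y in 𝓝 x, ∃ c' : Basis (Fin p) ℝ (S.perp y), ∀ i, (c' i : TangentSpace 𝓘(ℝ, E) y)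
      = S.swap.extTop (c i : TangentSpace 𝓘(ℝ, E) x) y := by
  -- The swapped splitting becomes a variable `W`, and `S.perp` is then replaced by `W.top`, so that
  -- `c` has literally the type of a basis of `W.top x`.
  obtain ⟨W, hW⟩ : ∃ W : Splitting E M p n, W = S.swap := ⟨_, rfl⟩
  have h' : W.IsAdapted g := hW ▸ h.swap
  have e : S.perp = W.top := by rw [hW]; rfl
  have e' : S.swap = W := hW.symm
  rw [e']
  clear hW e'
  generalize S.perp = D at e c
  subst e
  exact h'.eventually_frame c

theorem IsAdapted.projPerp_eq_sum {κ : Type*} [Fintype κ] [DecidableEq κ] (h : S.IsAdapted g)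
    (c : Basis κ ℝ (S.perp x)) {v : TangentSpace 𝓘(ℝ, E) x} (hv : v ∈ S.perp x) :
    v = ∑ i, ∑ j, (gramInv g c i j * g x v (c i)) • (c j : TangentSpace 𝓘(ℝ, E) x) := by
  conv_lhs => rw [← S.projPerp_of_mem hv]
  exact IsAdapted.projTop_eq_sum h.swap c v

theorem diffField_mlieBracket {Y Z : VField E M} (hY : CDiffField 2 Y x) (hZ : CDiffField 2 Z x) :
    DiffField (VectorField.mlieBracket 𝓘(ℝ, E) Y Z) x := by
  have h2 : (2 : ℕ∞ω) ≤ ∞ := by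
    have : ((2 : ℕ∞) : ℕ∞ω) ≤ ∞ := by exact_mod_cast le_top
    exact this
  have : IsManifold 𝓘(ℝ, E) (minSmoothness ℝ 2) M := by
    simp only [minSmoothness_of_isRCLikeNormedField]
    exact IsManifold.of_le (n := ∞) h2
  have : IsManifold 𝓘(ℝ, E) (((2 : ℕ∞) : ℕ∞ω) + 1) M :=
    IsManifold.of_le (n := ∞) (by exact_mod_cast le_top)
  have := ContMDiffAt.mlieBracket_vectorField (n := 2) (m := 1) hY hZ (by
    simp only [minSmoothness_of_isRCLikeNormedField]
    norm_num)
  exact this.mdifferentiableAt one_ne_zero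

theorem IsAdapted.diffMat_gram_perp {κ : Type*} [Fintype κ] [DecidableEq κ] (h : S.IsAdapted g)
    (z : κ → TangentSpace 𝓘(ℝ, E) x) :
    DiffMat E (fun y => gram g y fun a => S.swap.extTop (z a) y) x := fun _ _ =>
  diffFun_metric h.metric (h.swap.diffField_extTop _) (h.swap.diffField_extTop _)

theorem IsAdapted.isUnit_gram_perp {κ : Type*} [Fintype κ] [DecidableEq κ] (h : S.IsAdapted g)
    (c : Basis κ ℝ (S.perp x)) :
    IsUnit (gram g x fun a => S.swap.extTop (c a : TangentSpace 𝓘(ℝ, E) x) x).det := by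
  simp only [fun a => extTop_self_of_mem (S := S.swap) (c a).2]
  exact isUnit_det_gram (isBilin_metric g x) h.swap.nondegenerate_top c

/-- The second fundamental form of sections, tested against a section, is differentiable. -/
theorem IsAdapted.diffFun_metric_h (h : S.IsAdapted g) (u w z : TangentSpace 𝓘(ℝ, E) x) :
    DiffFun (E := E)
      (fun y => g y (S.h g y (S.extTop u y) (S.extTop w y)) (S.swap.extTop z y)) x := by
  have hXc : CDiffField 2 (S.extTop u) x := h.cDiffField_extTop 2 u
  have hYc : CDiffField 2 (S.extTop w) x := h.cDiffField_extTop 2 w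
  have hZc : CDiffField 2 (S.swap.extTop z) x := h.swap.cDiffField_extTop 2 z
  -- `metric_h_eq_lie` expresses the function by one directional derivative of `g(X, Y)` and two
  -- brackets; each is differentiable because the extensions are `C²`.
  have h1 := diffFun_dirDeriv (contMDiffAt_metric h.metric hXc hYc)
    (diffField_of_cDiffField two_ne_zero hZc)
  have h2 := diffFun_metric h.metric (diffField_mlieBracket hZc hXc) (h.diffField_extTop w)
  have h3 := diffFun_metric h.metric (h.diffField_extTop u) (diffField_mlieBracket hZc hYc)
  have hc : DiffFun (E := E) (fun _ => -(1 / 2 : ℝ)) x := mdifferentiableAt_const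
  refine (hc.mul ((h1.sub h2).sub h3)).congr_of_eventuallyEq ?_
  filter_upwards [eventually_diffField hXc, eventually_diffField hYc, eventually_diffField hZc]
    with y hXy hYy hZy
  exact h.metric_h_eq_lie hXy hYy hZy (extTop_mem _ _) (extTop_mem _ _)
    (Filter.Eventually.of_forall fun y => extTop_mem (S := S.swap) z y)

/-- The second fundamental form of sections is a differentiable vector field. -/
theorem IsAdapted.diffField_h (h : S.IsAdapted g) (u w : TangentSpace 𝓘(ℝ, E) x) :
    DiffField (fun y => S.h g y (S.extTop u y) (S.extTop w y)) x := by
  obtain ⟨c⟩ := S.exists_basis_perp x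
  -- The field has values in `S.perp`, so it is recovered from its components against a local frame
  -- there.
  have hs : DiffField (fun y => ∑ a, ∑ a',
      ((gram g y fun a => S.swap.extTop (c a : TangentSpace 𝓘(ℝ, E) x) y)⁻¹ a a'
        * g y (S.h g y (S.extTop u y) (S.extTop w y))
          (S.swap.extTop (c a : TangentSpace 𝓘(ℝ, E) x) y)) •
      S.swap.extTop (c a' : TangentSpace 𝓘(ℝ, E) x) y) x :=
    diffField_sum fun a => diffField_sum fun a' => diffField_smul
      (((h.diffMat_gram_perp _).inv (h.isUnit_gram_perp c) a a').mul (h.diffFun_metric_h u w _))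
      (h.swap.diffField_extTop _)
  refine diffField_congr hs ?_
  filter_upwards [h.eventually_frame_perp c] with y hy
  obtain ⟨c', hc'⟩ := hy
  have h1 := h.projPerp_eq_sum c' (h_mem (g := g) (S.extTop u y) (S.extTop w y))
  simp only [gramInv, hc'] at h1
  exact h1

end Splitting
end Divergence

/-! ### The two trace identities behind the variation of the extrinsic curvature. -/

section MatrixIdentities

variable {ι : Type*} [Fintype ι] [DecidableEq ι]

/-- Read `B = G'`, `Gd` and `Bd` as derivatives of `G` and `B` along a vector `z` of the complement,
`C` as its bracket coefficients and `η` as the component of `h` along `z`. The identity says that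
`tr(G⁻¹η)`, the component of `H`, varies by `-½ z(Tr B)`. -/
theorem two_mul_trace_deriv {G gi B C η Gd Bd : Matrix ι ι ℝ} (h1 : gi * G = 1) (h2 : G * gi = 1)
    (hη : Gd = C.transpose * G + G * C - (2 : ℝ) • η) :
    2 * (-(gi * B * gi) * η + gi * (-(1 / 2 : ℝ) • (Bd - C.transpose * B - B * C))).trace
      = -(-(gi * Gd * gi) * B + gi * Bd).trace := by
  have c1 : ∀ N : Matrix ι ι ℝ, gi * (G * N) = N := fun N => by
    rw [← Matrix.mul_assoc, h1, Matrix.one_mul]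
  have c2 : ∀ N : Matrix ι ι ℝ, G * (gi * N) = N := fun N => by
    rw [← Matrix.mul_assoc, h2, Matrix.one_mul]
  subst hη
  have e1 := Matrix.trace_mul_comm C (gi * B)
  have e2 := Matrix.trace_mul_comm (gi * η) (gi * B)
  simp only [Matrix.mul_assoc] at e1 e2
  simp only [Matrix.mul_add, Matrix.add_mul, Matrix.mul_sub, Matrix.sub_mul, Matrix.mul_smul,
    Matrix.smul_mul, Matrix.neg_mul, Matrix.mul_assoc, c1, c2, Matrix.trace_add,
    Matrix.trace_sub, Matrix.trace_neg, Matrix.trace_smul, smul_eq_mul, smul_sub, e1, e2]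
  ring

/-- Same reading, with `η'` the component of `h` along a second vector and `τ` that of `T` along
`z`. The matrix `(Cᵀ G - η - τ) G⁻¹` is `nablaMatrix`; its `τ` part is compensated by the last
trace, which comes from `𝓚`. The remaining terms match by cyclicity of the trace. -/
theorem neg_two_mul_trace_deriv {G gi B C η η' τ Gd Bd : Matrix ι ι ℝ} (h1 : gi * G = 1)
    (h2 : G * gi = 1) (hgi : gi.transpose = gi) (hB : B.transpose = B) (hηs : η.transpose = η)
    (hηs' : η'.transpose = η') (hτ : τ.transpose = -τ)
    (hη : Gd = C.transpose * G + G * C - (2 : ℝ) • η) :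
    -2 * ((-(gi * B * gi) * η + gi * (-(1 / 2 : ℝ) • (Bd - C.transpose * B - B * C)))
        * (gi * η')).trace
      = (gi * B * gi * ((C.transpose * G - η - τ) * gi * η'
          + η' * ((C.transpose * G - η - τ) * gi).transpose)).trace
        + (η' * ((-(gi * Gd * gi) * B + gi * Bd) * gi + gi * B * -(gi * Gd * gi))).trace
        - (gi * B * gi * (η' * gi * τ - τ * gi * η')).trace := by
  have hG : G.transpose = G := by
    have : G.transpose * gi = 1 := by
      rw [← hgi, ← Matrix.transpose_mul, h1, Matrix.transpose_one]
    calc G.transpose = G.transpose * (gi * G) := by rw [h1, Matrix.mul_one]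
      _ = G := by rw [← Matrix.mul_assoc, this, Matrix.one_mul]
  have c1 : ∀ N : Matrix ι ι ℝ, gi * (G * N) = N := fun N => by
    rw [← Matrix.mul_assoc, h1, Matrix.one_mul]
  subst hη
  have e1 := Matrix.trace_mul_comm η' (gi * C.transpose * B * gi)
  have e2 := Matrix.trace_mul_comm (η' * C) (gi * B * gi)
  have e3 := Matrix.trace_mul_comm η' (gi * Bd * gi)
  have e4 := Matrix.trace_mul_comm η' (gi * B * gi * C.transpose)
  have e5 := Matrix.trace_mul_comm η' (gi * B * C * gi)
  have e6 := Matrix.trace_mul_comm (η' * gi * η) (gi * B * gi)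
  have e7 := Matrix.trace_mul_comm η' (gi * B * gi * η * gi)
  -- Transposition followed by cyclicity exchanges `η` and `η'`, because `gi`, `B`, `η` and `η'` are
  -- all symmetric.
  have e8 : (gi * B * gi * η * gi * η').trace = (gi * B * gi * η' * gi * η).trace := by
    rw [← Matrix.trace_transpose]
    simp only [Matrix.transpose_mul, hgi, hB, hηs, hηs']
    rw [← Matrix.mul_assoc, ← Matrix.mul_assoc, Matrix.trace_mul_comm]
    simp only [Matrix.mul_assoc]
  simp only [Matrix.mul_assoc] at e1 e2 e3 e4 e5 e6 e7 e8
  simp only [Matrix.transpose_mul, Matrix.transpose_sub, Matrix.transpose_transpose, hG, hgi, hηs,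
    hτ]
  simp only [Matrix.mul_add, Matrix.add_mul, Matrix.mul_sub, Matrix.sub_mul, Matrix.mul_smul,
    Matrix.smul_mul, Matrix.neg_mul, Matrix.mul_neg, Matrix.mul_assoc, c1, h2, Matrix.mul_one,
    Matrix.trace_add, Matrix.trace_sub, Matrix.trace_neg, Matrix.trace_smul, smul_eq_mul,
    smul_sub]
  simp only [e1, e2, e3, e4, e5, e6, e7, e8]
  ring

end MatrixIdentities

/-! ### The second fundamental form and its divergence in a local frame. -/

section LocalExpressions

variable {E : Type*} [NormedAddCommGroup E] [NormedSpace ℝ E] [FiniteDimensional ℝ E]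
  {M : Type*} [TopologicalSpace M] [ChartedSpace E M] [IsManifold 𝓘(ℝ, E) ∞ M] {x : M}

namespace Splitting

variable {n p : ℕ} {S : Splitting E M n p} {g : FormField E M}
  {κ : Type*} [Fintype κ] [DecidableEq κ]
  (b : Basis (Fin n) ℝ (S.top x)) (c : Basis κ ℝ (S.perp x))

/-- The coefficients of the components along the distribution of the Lie brackets of a section of
the complement with the frame. -/
def lieMatrix (b : Basis (Fin n) ℝ (S.top x)) (z : TangentSpace 𝓘(ℝ, E) x) :
    Matrix (Fin n) (Fin n) ℝ :=
  Matrix.of fun k i => b.repr ⟨S.projTop x (VectorField.mlieBracket 𝓘(ℝ, E) (S.swap.extTop z)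
    (S.extTop (b i : TangentSpace 𝓘(ℝ, E) x)) x), S.projTop_mem _⟩ k

theorem IsAdapted.metric_mlieBracket (h : S.IsAdapted g) (z : TangentSpace 𝓘(ℝ, E) x) (i j : Fin n) :
    g x (VectorField.mlieBracket 𝓘(ℝ, E) (S.swap.extTop z)
      (S.extTop (b i : TangentSpace 𝓘(ℝ, E) x)) x) (b j)
      = ((lieMatrix b z).transpose * frameGram g b x) i j := by
  rw [← h.metric_projTop_left (b j).2, mem_span_basis b (S.projTop_mem _),
    (isBilin_metric g x).sum_left, Matrix.mul_apply, frameGram_self]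
  rfl

/-- The second fundamental form in terms of the frame. -/
theorem IsAdapted.compMatrix_h_eq (h : S.IsAdapted g) {z : TangentSpace 𝓘(ℝ, E) x}
    (hz : z ∈ S.perp x) :
    compMatrix g (S.h g) (fun i => (b i : TangentSpace 𝓘(ℝ, E) x)) z
      = -(1 / 2 : ℝ) • (matDeriv z (frameGram g b) - (lieMatrix b z).transpose * frameGram g b x
        - frameGram g b x * lieMatrix b z) := by
  have hzx : S.swap.extTop z x = z := extTop_self_of_mem (S := S.swap) hz
  ext i j
  have h1 := h.metric_h_eq_lie (h.diffField_extTop (b i : TangentSpace 𝓘(ℝ, E) x))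
    (h.diffField_extTop (b j : TangentSpace 𝓘(ℝ, E) x)) (h.swap.diffField_extTop z)
    (extTop_mem _ _) (extTop_mem _ _) (Filter.Eventually.of_forall fun y =>
      extTop_mem (S := S.swap) z y)
  have h2 : (frameGram g b x * lieMatrix b z) i j
      = ((lieMatrix b z).transpose * frameGram g b x) j i := by
    conv_rhs => rw [frameGram, ← h.transpose_gram, ← Matrix.transpose_mul]
    rfl
  rw [extTop_basis, extTop_basis, hzx, h.metric.symm x (b i : TangentSpace 𝓘(ℝ, E) x),
    h.metric_mlieBracket, h.metric_mlieBracket, ← h2] at h1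
  exact h1

/-- The transposed coefficients of the components along the distribution of the covariant
derivatives of the frame in the direction of the complement. -/
def nablaMatrix (g : FormField E M) (b : Basis (Fin n) ℝ (S.top x)) (z : TangentSpace 𝓘(ℝ, E) x) :
    Matrix (Fin n) (Fin n) ℝ :=
  ((lieMatrix b z).transpose * frameGram g b x
    - compMatrix g (S.h g) (fun i => (b i : TangentSpace 𝓘(ℝ, E) x)) z
    - compMatrix g S.T (fun i => (b i : TangentSpace 𝓘(ℝ, E) x)) z) * gramInv g b

/-- Torsion-freeness gives `∇_Z X = [Z, X] + ∇_X Z`: the bracket contributes `lieMatrix`, and `∇_X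
Z` tested against the distribution contributes `-h - T`. -/
theorem IsAdapted.projTop_nabla_extTop (h : S.IsAdapted g) {z : TangentSpace 𝓘(ℝ, E) x}
    (hz : z ∈ S.perp x) (i : Fin n) :
    S.projTop x (nabla g z (S.extTop (b i : TangentSpace 𝓘(ℝ, E) x)))
      = ∑ k, nablaMatrix g b z i k • (b k : TangentSpace 𝓘(ℝ, E) x) := by
  have hzx : S.swap.extTop z x = z := extTop_self_of_mem (S := S.swap) hz
  have h1 : ∀ l, g x (nabla g z (S.extTop (b i : TangentSpace 𝓘(ℝ, E) x))) (b l)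
      = ((lieMatrix b z).transpose * frameGram g b x
        - compMatrix g (S.h g) (fun i => (b i : TangentSpace 𝓘(ℝ, E) x)) z
        - compMatrix g S.T (fun i => (b i : TangentSpace 𝓘(ℝ, E) x)) z) i l := by
    intro l
    have h2 := nabla_sub_nabla h.metric (h.swap.diffField_extTop z)
      (h.diffField_extTop (b i : TangentSpace 𝓘(ℝ, E) x))
    rw [extTop_basis, hzx] at h2
    have h3 := h.metric_nabla_section_perp (b i).2 (b l).2 (h.swap.diffField_extTop z)
      (Filter.Eventually.of_forall fun y => extTop_mem (S := S.swap) z y)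
    rw [hzx] at h3
    rw [sub_eq_iff_eq_add.1 h2, map_add, add_apply, h3, h.metric_mlieBracket]
    simp only [Matrix.sub_apply, compMatrix, formMatrix, Matrix.of_apply]
    ring
  rw [h.projTop_eq_sum b, Finset.sum_comm]
  refine Finset.sum_congr rfl fun k _ => ?_
  rw [← Finset.sum_smul, nablaMatrix, Matrix.mul_apply]
  congr 1
  refine Finset.sum_congr rfl fun l _ => ?_
  rw [h1, mul_comm]
  rfl

/-- The two extensions differ by a section of the complement vanishing at `x`. By
`metric_nabla_eq_neg` the derivative of such a section has no component in `S.top`. This reconciles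
`nablaTensor`, defined with `ext`, with the frame given by `extTop`. -/
theorem IsAdapted.projTop_nabla_ext (h : S.IsAdapted g) (v : TangentSpace 𝓘(ℝ, E) x)
    {u : TangentSpace 𝓘(ℝ, E) x} (hu : u ∈ S.top x) :
    S.projTop x (nabla g v (ext u)) = S.projTop x (nabla g v (S.extTop u)) := by
  have h1 : (ext u : VField E M) = S.extTop u + S.swap.extTop u := by
    funext y
    exact (S.projTop_add_projPerp (ext u y)).symm
  refine h.eq_of_mem_top (S.projTop_mem _) (S.projTop_mem _) fun w hw => ?_
  have h2 := h.swap.metric_nabla_eq_neg v (h.swap.diffField_extTop u) (h.diffField_extTop w)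
    (Filter.Eventually.of_forall fun y => extTop_mem (S := S.swap) u y)
    (Filter.Eventually.of_forall fun y => extTop_mem (S := S) w y)
  have h3 : S.swap.extTop u x = 0 := by
    rw [extTop_self]
    exact projTop_of_mem_perp S.swap hu
  rw [h3, map_zero, zero_apply, neg_zero, extTop_self_of_mem hw] at h2
  rw [h.metric_projTop_left hw, h.metric_projTop_left hw, h1,
    nabla_add h.metric v (h.diffField_extTop u) (h.swap.diffField_extTop u), map_add, add_apply, h2,
    add_zero]

theorem IsAdapted.h_ext (h : S.IsAdapted g) (u w : TangentSpace 𝓘(ℝ, E) x) :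
    (fun y => S.h g y (ext u y) (ext w y)) = fun y => S.h g y (S.extTop u y) (S.extTop w y) :=
  funext fun y => (h.h_projTop (ext u y) (ext w y)).symm

/-- The extensions in the definition depend linearly on the vectors near `x`, and `nabla` sees only
germs at `x`; no independence of the extension is needed. -/
theorem IsAdapted.isBilin_nablaTensor (h : S.IsAdapted g) (v : TangentSpace 𝓘(ℝ, E) x) :
    IsBilin (nablaTensor g (S.h g) v) := by
  have hd : ∀ u w : TangentSpace 𝓘(ℝ, E) x, DiffField (fun y => S.h g y (ext u y) (ext w y)) x :=
    fun u w => by rw [h.h_ext]; exact h.diffField_h u w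
  have hsymm : ∀ u w, nablaTensor g (S.h g) v u w = nablaTensor g (S.h g) v w u := by
    intro u w
    simp only [nablaTensor, fun y => h_symm (S := S) (g := g) (ext u y) (ext w y)]
    rw [h_symm (nabla g v (ext u)), h_symm u, sub_right_comm]
  have hl : ∀ w, IsLinearMap ℝ fun u => nablaTensor g (S.h g) v u w := by
    intro w
    have hb := h.isBilin_h (x := x)
    constructor
    · intro u u'
      have h1 : (fun y => S.h g y (ext (u + u') y) (ext w y)) =ᶠ[𝓝 x]
          (fun y => S.h g y (ext u y) (ext w y)) + fun y => S.h g y (ext u' y) (ext w y) := by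
        filter_upwards [ext_add u u'] with y hy
        rw [hy]
        exact (h.isBilin_h.left _).map_add _ _
      simp only [nablaTensor]
      rw [nabla_congr g v h1, nabla_add h.metric v (hd u w) (hd u' w), nabla_congr g v (ext_add u u'),
        nabla_add h.metric v (diffField_ext u) (diffField_ext u'), (hb.left _).map_add,
        (hb.left _).map_add]
      abel
    · intro r u
      have hr : DiffFun (E := E) (fun _ : M => r) x := mdifferentiableAt_const
      have h1 : (fun y => S.h g y (ext (r • u) y) (ext w y)) =ᶠ[𝓝 x]
          (fun _ : M => r) • (fun y => S.h g y (ext u y) (ext w y)) := by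
        filter_upwards [ext_smul r u] with y hy
        rw [hy]
        exact (h.isBilin_h.left _).map_smul _ _
      have h0 : dirDeriv v (fun _ : M => r) = 0 := by simp [dirDeriv, mvfderiv_const]
      have h2 : (ext (r • u) : VField E M) =ᶠ[𝓝 x] (fun _ : M => r) • ext u := ext_smul r u
      simp only [nablaTensor]
      rw [nabla_congr g v h1, nabla_smul h.metric v hr (hd u w), nabla_congr g v h2,
        nabla_smul h.metric v hr (diffField_ext u), h0, zero_smul, zero_add, zero_smul, zero_add,
        (hb.left _).map_smul, (hb.left _).map_smul, smul_sub, smul_sub]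
  refine ⟨hl, fun u => ?_⟩
  rw [show nablaTensor g (S.h g) v u = fun w => nablaTensor g (S.h g) v w u from funext (hsymm u)]
  exact hl u

theorem IsAdapted.isBilin_divTensor (h : S.IsAdapted g) : IsBilin (divTensor g (S.h g) x) :=
  IsBilin.trOn fun v w => (h.isBilin_nablaTensor v).map (isLinearMap_metric g w)

/-- The divergence of the second fundamental form in terms of the frame. -/
theorem IsAdapted.divTensor_eq (h : S.IsAdapted g) (i j : Fin n) :
    divTensor g (S.h g) x (b i) (b j)
      = divField g (fun y => S.h g y (S.extTop (b i : TangentSpace 𝓘(ℝ, E) x) y)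
          (S.extTop (b j : TangentSpace 𝓘(ℝ, E) x) y)) x
        - ∑ a, ∑ a', gramInv g c a a' * (nablaMatrix g b (c a)
            * compMatrix g (S.h g) (fun i => (b i : TangentSpace 𝓘(ℝ, E) x)) (c a')
          + compMatrix g (S.h g) (fun i => (b i : TangentSpace 𝓘(ℝ, E) x)) (c a')
            * (nablaMatrix g b (c a)).transpose) i j := by
  have hh := h.isExtrinsic_h (x := x)
  set β : TangentSpace 𝓘(ℝ, E) x → TangentSpace 𝓘(ℝ, E) x → ℝ := fun e e' =>
    g x (S.h g x (nabla g e (ext (b i : TangentSpace 𝓘(ℝ, E) x))) (b j)) e'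
      + g x (S.h g x (b i) (nabla g e (ext (b j : TangentSpace 𝓘(ℝ, E) x)))) e' with hβ
  have hid : IsLinearMap ℝ fun v : TangentSpace 𝓘(ℝ, E) x => v := ⟨fun _ _ => rfl, fun _ _ => rfl⟩
  have hβb : IsBilin β := by
    refine IsBilin.add ?_ ?_
    · exact (isBilin_metric g x).comp (l := fun e => S.h g x (nabla g e (ext _)) (b j))
        ((hh.bilin.left _).mk' _ ∘ₗ (isLinearMap_nabla h.metric (diffField_ext _)).mk' _).isLinear hid
    · exact (isBilin_metric g x).comp (l := fun e => S.h g x (b i) (nabla g e (ext _)))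
        ((hh.bilin.right _).mk' _ ∘ₗ (isLinearMap_nabla h.metric (diffField_ext _)).mk' _).isLinear hid
  -- The values of `h` are orthogonal to `S.top`, so the correction terms of `∇h` are contracted
  -- over the complement only.
  have hβ0 : ∀ e ∈ S.top x, ∀ e' ∈ S.top x, β e e' = 0 := fun e _ e' he' => by
    rw [hβ]
    simp only [h.orthogonal' (h_mem _ _) he', add_zero]
  have h1 : ∀ e e', g x (nablaTensor g (S.h g) e (b i) (b j)) e'
      = g x (nabla g e (fun y => S.h g y (S.extTop (b i : TangentSpace 𝓘(ℝ, E) x) y)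
          (S.extTop (b j : TangentSpace 𝓘(ℝ, E) x) y))) e' + -β e e' := by
    intro e e'
    rw [nablaTensor, h.h_ext, map_sub, map_sub, sub_apply, sub_apply, hβ]
    ring
  rw [divTensor]
  simp only [h1]
  rw [trOn_add, trOn_neg, ← sub_eq_add_neg, h.trOn_univ_eq_perp hβb hβ0, h.trOn_perp c hβb]
  congr 1
  refine Finset.sum_congr rfl fun a _ => Finset.sum_congr rfl fun a' _ => ?_
  simp only [smul_eq_mul, hβ]
  congr 1
  have hP : ∀ k, S.projTop x (nabla g (c a : TangentSpace 𝓘(ℝ, E) x)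
      (ext (b k : TangentSpace 𝓘(ℝ, E) x)))
      = ∑ l, nablaMatrix g b (c a) k l • (b l : TangentSpace 𝓘(ℝ, E) x) := fun k => by
    rw [h.projTop_nabla_ext _ (b k).2, h.projTop_nabla_extTop b (c a).2]
  have hm := hh.bilin.map (isLinearMap_metric g (c a' : TangentSpace 𝓘(ℝ, E) x))
  rw [Matrix.add_apply, Matrix.mul_apply, Matrix.mul_apply]
  congr 1
  · rw [← hh.projTop_left, hP, hm.sum_left]
    rfl
  · rw [← hh.projTop_right, hP, hm.sum_right]
    exact Finset.sum_congr rfl fun k _ => mul_comm _ _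

end Splitting
end LocalExpressions

/-! ### Frame expressions of both terms in the variation formula. -/

section Gradient

variable {E : Type*} [NormedAddCommGroup E] [NormedSpace ℝ E] [FiniteDimensional ℝ E]
  {M : Type*} [TopologicalSpace M] [ChartedSpace E M] [IsManifold 𝓘(ℝ, E) ∞ M] {x : M}

theorem diffField_neg_smul {Y : VField E M} {f : M → ℝ} (hf : DiffFun (E := E) f x)
    (hY : DiffField Y x) : DiffField (fun y => (-f y) • Y y) x :=
  diffField_smul (f := fun y => -f y) hf.neg hY

theorem dirDeriv_neg (v : TangentSpace 𝓘(ℝ, E) x) (f : M → ℝ) :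
    dirDeriv v (fun y => -f y) = -dirDeriv v f := by
  simp only [dirDeriv]
  rw [show (fun y => -f y) = -f from rfl, mvfderiv_neg]
  rfl

theorem divField_sub_smul {g : FormField E M} (hg : IsSmoothMetric g) {f : M → ℝ} {Y Z : VField E M}
    (hf : DiffFun (E := E) f x) (hY : DiffField Y x) (hZ : DiffField Z x) :
    divField g (fun y => Z y - f y • Y y) x
      = divField g Z x - dirDeriv (Y x) f - f x * divField g Y x := by
  have h1 : (fun y => Z y - f y • Y y) = fun y => Z y + (-f y) • Y y := by
    funext y
    rw [neg_smul, sub_eq_add_neg]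
  rw [h1, divField_add hg hZ (diffField_neg_smul hf hY),
    divField_smul hg (f := fun y => -f y) hf.neg hY, dirDeriv_neg]
  ring

namespace Splitting

variable {n p : ℕ} {S : Splitting E M n p} {g : FormField E M} {B : Tensor02 E M}
  {κ : Type*} [Fintype κ] [DecidableEq κ]
  (b : Basis (Fin n) ℝ (S.top x)) (c : Basis κ ℝ (S.perp x))

/-- The matrix of a form in the local frame. -/
def frameForm (B : Tensor02 E M) (b : Basis (Fin n) ℝ (S.top x)) (y : M) :
    Matrix (Fin n) (Fin n) ℝ :=
  formMatrix (B y) fun i => S.extTop (b i : TangentSpace 𝓘(ℝ, E) x) y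

theorem frameForm_self :
    frameForm B b x = formMatrix (B x) fun i => (b i : TangentSpace 𝓘(ℝ, E) x) := by
  simp only [frameForm, extTop_basis]

theorem gramInv_eq : gramInv g b = (frameGram g b x)⁻¹ := by
  rw [frameGram_self, gramInv]

/-- The matrix expression is needed on a neighbourhood, with one frame extending `b`, because it
will be differentiated at `x`. -/
theorem IsAdapted.eventually_trG (h : S.IsAdapted g) (hB : ∀ y, S.IsTopForm y (B y)) :
    trG g B =ᶠ[𝓝 x] fun y => ((frameGram g b y)⁻¹ * frameForm B b y).trace := by
  filter_upwards [h.eventually_frame b] with y hy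
  obtain ⟨b', hb'⟩ := hy
  rw [h.trG_eq b' (hB y)]
  simp only [gramInv, hb', frameGram, frameForm]

theorem IsAdapted.eventually_pairingVec (h : S.IsAdapted g) (hB : ∀ y, S.IsTopForm y (B y)) :
    pairingVec g (S.h g) B =ᶠ[𝓝 x] fun y => ∑ i, ∑ j,
      ((frameGram g b y)⁻¹ * frameForm B b y * (frameGram g b y)⁻¹) i j •
        S.h g y (S.extTop (b i : TangentSpace 𝓘(ℝ, E) x) y)
          (S.extTop (b j : TangentSpace 𝓘(ℝ, E) x) y) := by
  filter_upwards [h.eventually_frame b] with y hy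
  obtain ⟨b', hb'⟩ := hy
  rw [h.pairingVec_eq b' h.isBilin_h (hB y)]
  simp only [gramInv, hb', frameGram, frameForm]
  rfl

theorem IsAdapted.diffField_H (h : S.IsAdapted g) : DiffField (S.H g) x := by
  obtain ⟨b⟩ := S.exists_basis_top x
  have hs : DiffField (fun y => ∑ i, ∑ j, (frameGram g b y)⁻¹ i j •
        S.h g y (S.extTop (b i : TangentSpace 𝓘(ℝ, E) x) y)
          (S.extTop (b j : TangentSpace 𝓘(ℝ, E) x) y)) x :=
    diffField_sum fun i => diffField_sum fun j => diffField_smul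
      ((h.diffMat_frameGram b).inv (h.isUnit_frameGram b) i j) (h.diffField_h _ _)
  refine diffField_congr hs ?_
  filter_upwards [h.eventually_frame b] with y hy
  obtain ⟨b', hb'⟩ := hy
  rw [H, h.trOn_top b' h.isBilin_h]
  simp only [gramInv, hb', frameGram]
  rfl

/-- Applied to `h(b i, b j)` and to `H`, so that their components along `c`, which are the entries
and traces entering `Sex_eq`, appear next to derivatives along the basis vectors. -/
theorem IsAdapted.dirDeriv_eq_sum (h : S.IsAdapted g) {v : TangentSpace 𝓘(ℝ, E) x}
    (hv : v ∈ S.perp x) (f : M → ℝ) : dirDeriv v f = ∑ a, ∑ a', gramInv g c a a'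
      * (g x v (c a') * dirDeriv (c a : TangentSpace 𝓘(ℝ, E) x) f) := by
  have hl : IsLinearMap ℝ fun u : TangentSpace 𝓘(ℝ, E) x => dirDeriv u f :=
    ⟨fun u v => dirDeriv_add_left u v f, fun c u => dirDeriv_smul_left c u f⟩
  have hk : ∀ a a', gramInv g c a a' = gramInv g c a' a := fun a a' =>
    gramInv_symm (S := S.swap) c h.swap a a'
  conv_lhs => rw [h.projPerp_eq_sum c hv]
  change hl.mk' _ _ = _
  simp only [map_sum, map_smul, IsLinearMap.mk'_apply, smul_eq_mul]
  rw [Finset.sum_comm]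
  exact Finset.sum_congr rfl fun a _ => Finset.sum_congr rfl fun a' _ => by rw [hk a a', mul_assoc]

/-- Leibniz rule for the divergence of a combination of the fields `h(Xᵢ, Xⱼ)` with matrix
coefficients. The terms without derivatives of coefficients are opposite to those of
`pairing_variation`. -/
theorem IsAdapted.divField_variation (h : S.IsAdapted g) (hB : ∀ y, S.IsTopForm y (B y))
    (hBd : DiffMat E (frameForm B b) x) :
    divField g (fun y => pairingVec g (S.h g) B y - trG g B y • S.H g y) x
      = ∑ i, ∑ j, ((frameGram g b x)⁻¹ * frameForm B b x * (frameGram g b x)⁻¹) i j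
          * divField g (fun y => S.h g y (S.extTop (b i : TangentSpace 𝓘(ℝ, E) x) y)
            (S.extTop (b j : TangentSpace 𝓘(ℝ, E) x) y)) x
        - ((frameGram g b x)⁻¹ * frameForm B b x).trace * divField g (S.H g) x
        + ∑ a, ∑ a', gramInv g c a a' * ((compMatrix g (S.h g)
            (fun i => (b i : TangentSpace 𝓘(ℝ, E) x)) (c a')
            * matDeriv (c a : TangentSpace 𝓘(ℝ, E) x) (fun y =>
              (frameGram g b y)⁻¹ * frameForm B b y * (frameGram g b y)⁻¹)).trace
          - dirDeriv (c a : TangentSpace 𝓘(ℝ, E) x)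
              (fun y => ((frameGram g b y)⁻¹ * frameForm B b y).trace)
            * ((frameGram g b x)⁻¹ * compMatrix g (S.h g)
              (fun i => (b i : TangentSpace 𝓘(ℝ, E) x)) (c a')).trace) := by
  have hGi := (h.diffMat_frameGram b).inv (h.isUnit_frameGram b)
  have hBh := (hGi.mul hBd).mul hGi
  have hh : ∀ i j, DiffField (fun y => S.h g y (S.extTop (b i : TangentSpace 𝓘(ℝ, E) x) y)
      (S.extTop (b j : TangentSpace 𝓘(ℝ, E) x) y)) x := fun i j => h.diffField_h _ _
  have ht := h.eventually_trG b hB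
  have hpd : DiffField (pairingVec g (S.h g) B) x := diffField_congr
    (diffField_sum fun i => diffField_sum fun j => diffField_smul (hBh i j) (hh i j))
    (h.eventually_pairingVec b hB)
  have htd : DiffFun (E := E) (trG g B) x :=
    MDifferentiableAt.congr_of_eventuallyEq (hGi.mul hBd).trace ht
  have hdiv := (divField_congr g (h.eventually_pairingVec b hB)).trans
    (divField_sum_smul h.metric hBh hh)
  rw [divField_sub_smul h.metric htd h.diffField_H hpd, hdiv,
    dirDeriv_congr _ ht, ht.self_of_nhds, h.dirDeriv_eq_sum c H_mem]
  simp only [extTop_basis, h.metric_H b, gramInv_eq b,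
    fun i j => h.dirDeriv_eq_sum c (h_mem (S := S) (g := g) (b i : TangentSpace 𝓘(ℝ, E) x) (b j))]
  have h3 : ∀ a a', (compMatrix g (S.h g) (fun i => (b i : TangentSpace 𝓘(ℝ, E) x)) (c a')
            * matDeriv (c a : TangentSpace 𝓘(ℝ, E) x) (fun y =>
              (frameGram g b y)⁻¹ * frameForm B b y * (frameGram g b y)⁻¹)).trace
      = ∑ i, ∑ j, g x (S.h g x (b i) (b j)) (c a') * dirDeriv (c a : TangentSpace 𝓘(ℝ, E) x)
        (fun y => ((frameGram g b y)⁻¹ * frameForm B b y * (frameGram g b y)⁻¹) i j) := by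
    intro a a'
    conv_lhs => rw [← transpose_compMatrix_h, Matrix.trace_mul_comm]
    rw [← sum_mul_eq_trace]
    exact Finset.sum_congr rfl fun i _ => Finset.sum_congr rfl fun j _ => mul_comm _ _
  have hswap : ∀ f : Fin n → Fin n → κ → κ → ℝ, ∑ i, ∑ j, ∑ a, ∑ a', f i j a a'
      = ∑ a, ∑ a', ∑ i, ∑ j, f i j a a' := by
    intro f
    simp only [← Fintype.sum_prod_type']
    exact Fintype.sum_equiv ⟨fun q => (q.2.2.1, q.2.2.2, q.1, q.2.1),
      fun q => (q.2.2.1, q.2.2.2, q.1, q.2.1), fun _ => rfl, fun _ => rfl⟩ _ _ fun _ => rfl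
  simp only [h3, mul_sub, Finset.sum_add_distrib, Finset.sum_sub_distrib, hswap, Finset.mul_sum,
    mul_comm (dirDeriv _ _) (Matrix.trace _)]
  ring

/-- By `pairing_eq_trace` only the matrix of the left tensor on `S.top` matters: `g^⊥` contributes
`G`, with `G⁻¹BG⁻¹G = G⁻¹B`, while `divTensor_eq` and `flat_KK_eq` supply the rest. -/
theorem IsAdapted.pairing_variation (h : S.IsAdapted g) (hB : S.IsTopForm x (B x)) :
    pairing g (fun y u v => divField g (S.H g) y * S.swap.gPerp g y u v
        - divTensor g (S.h g) y u v - flatTensor g (S.KK g) y u v) B x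
      = ((frameGram g b x)⁻¹ * frameForm B b x).trace * divField g (S.H g) x
        - ∑ i, ∑ j, ((frameGram g b x)⁻¹ * frameForm B b x * (frameGram g b x)⁻¹) i j
          * divField g (fun y => S.h g y (S.extTop (b i : TangentSpace 𝓘(ℝ, E) x) y)
            (S.extTop (b j : TangentSpace 𝓘(ℝ, E) x) y)) x
        + ∑ a, ∑ a', gramInv g c a a' *
          (((frameGram g b x)⁻¹ * frameForm B b x * (frameGram g b x)⁻¹ *
            (nablaMatrix g b (c a) * compMatrix g (S.h g)
              (fun i => (b i : TangentSpace 𝓘(ℝ, E) x)) (c a')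
            + compMatrix g (S.h g) (fun i => (b i : TangentSpace 𝓘(ℝ, E) x)) (c a')
              * (nablaMatrix g b (c a)).transpose)).trace
          - ((frameGram g b x)⁻¹ * frameForm B b x * (frameGram g b x)⁻¹ *
            (compMatrix g (S.h g) (fun i => (b i : TangentSpace 𝓘(ℝ, E) x)) (c a') *
              (frameGram g b x)⁻¹ * compMatrix g S.T
                (fun i => (b i : TangentSpace 𝓘(ℝ, E) x)) (c a)
            - compMatrix g S.T (fun i => (b i : TangentSpace 𝓘(ℝ, E) x)) (c a) *
              (frameGram g b x)⁻¹ * compMatrix g (S.h g)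
                (fun i => (b i : TangentSpace 𝓘(ℝ, E) x)) (c a'))).trace) := by
  have hid : IsLinearMap ℝ fun v : TangentSpace 𝓘(ℝ, E) x => v := ⟨fun _ _ => rfl, fun _ _ => rfl⟩
  set d := divField g (S.H g) x with hd
  have hA1 : IsBilin fun u v => d * S.swap.gPerp g x u v :=
    ((isBilin_metric g x).comp (S.projTop x).isLinear (S.projTop x).isLinear).smul d
  have hA : IsBilin fun u v => d * S.swap.gPerp g x u v - divTensor g (S.h g) x u v
      - flatTensor g (S.KK g) x u v :=
    (hA1.sub h.isBilin_divTensor).sub (isBilin_flatTensor h.isLinearMap_KK)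
  rw [h.pairing_eq_trace b hA hB, ← frameForm_self, gramInv_eq b]
  set gi := (frameGram g b x)⁻¹ with hgi
  set Bm := frameForm B b x with hBm
  set k := gramInv g c with hk
  set η : κ → Matrix (Fin n) (Fin n) ℝ := fun a =>
    compMatrix g (S.h g) (fun i => (b i : TangentSpace 𝓘(ℝ, E) x)) (c a) with hη
  set τ : κ → Matrix (Fin n) (Fin n) ℝ := fun a =>
    compMatrix g S.T (fun i => (b i : TangentSpace 𝓘(ℝ, E) x)) (c a) with hτ
  set D : Matrix (Fin n) (Fin n) ℝ := Matrix.of fun i j => divField g (fun y => S.h g y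
    (S.extTop (b i : TangentSpace 𝓘(ℝ, E) x) y) (S.extTop (b j : TangentSpace 𝓘(ℝ, E) x) y)) x
    with hD
  have hks : ∀ a a', k a a' = k a' a := fun a a' => gramInv_symm (S := S.swap) c h.swap a a'
  have hsum : ∀ f : κ → κ → ℝ, ∑ a, ∑ a', k a a' * f a a' = ∑ a, ∑ a', k a a' * f a' a := by
    intro f
    rw [Finset.sum_comm]
    exact Finset.sum_congr rfl fun a _ => Finset.sum_congr rfl fun a' _ => by rw [hks]
  have hm : formMatrix (fun u v => d * S.swap.gPerp g x u v - divTensor g (S.h g) x u v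
      - flatTensor g (S.KK g) x u v) (fun i => (b i : TangentSpace 𝓘(ℝ, E) x))
      = d • frameGram g b x - (D - ∑ a, ∑ a', k a a' • (nablaMatrix g b (c a) * η a'
          + η a' * (nablaMatrix g b (c a)).transpose))
        - ∑ a, ∑ a', k a a' • (η a' * gi * τ a - τ a * gi * η a') := by
    ext i j
    have h1 : S.swap.gPerp g x (b i) (b j) = frameGram g b x i j := by
      rw [frameGram_self]
      change g x (S.projTop x _) (S.projTop x _) = _
      rw [S.projTop_of_mem (b i).2, S.projTop_of_mem (b j).2]
      rfl
    simp only [formMatrix, Matrix.of_apply, h1, h.divTensor_eq b c, h.flat_KK_eq b c,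
      Matrix.sub_apply, Matrix.smul_apply, Matrix.sum_apply, smul_eq_mul]
    congr 1
    simp only [mul_sub, Finset.sum_sub_distrib, gramInv_eq b]
    congr 1
    -- The symmetry of `K⁻¹` allows renaming the indices in one half of `𝓚`, so that `τ` carries `a`
    -- and `η` carries `a'` throughout.
    exact hsum fun a a' => (τ a' * gi * η a) i j
  have hGu : gi * frameGram g b x = 1 := Matrix.nonsing_inv_mul _ (h.isUnit_frameGram b)
  have hDs : D.transpose = D := by
    ext i j
    simp only [hD, Matrix.transpose_apply, Matrix.of_apply]
    congr 1
    funext y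
    exact h_symm _ _
  have h2 : ∑ i, ∑ j, (gi * Bm * gi) i j * D i j = (gi * Bm * gi * D).trace := by
    rw [sum_mul_eq_trace, hDs]
  change _ = _ - ∑ i, ∑ j, (gi * Bm * gi) i j * D i j + _
  rw [hm, h2]
  rw [Matrix.mul_sub, Matrix.mul_sub]
  simp only [Matrix.mul_smul, Matrix.mul_sum, Matrix.trace_sub, Matrix.trace_smul,
    Matrix.trace_sum, smul_eq_mul, mul_sub, Finset.sum_sub_distrib]
  rw [Matrix.mul_assoc (gi * Bm) gi, hGu, Matrix.mul_one]
  ring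

end Splitting
end Gradient

/-! ### Time derivatives in the two regimes of variation. -/

section Variation

variable {E : Type*} [NormedAddCommGroup E] [NormedSpace ℝ E] [FiniteDimensional ℝ E]
  {M : Type*} [TopologicalSpace M] [ChartedSpace E M] [IsManifold 𝓘(ℝ, E) ∞ M] {x : M}

theorem HasMatDeriv.congr {ι : Type*} [Fintype ι] [DecidableEq ι] {A B : ℝ → Matrix ι ι ℝ}
    {A' : Matrix ι ι ℝ} {t : ℝ} (h : HasMatDeriv A A' t) (hB : B =ᶠ[𝓝 t] A) : HasMatDeriv B A' t :=
  fun i j => (h i j).congr_of_eventuallyEq (hB.mono fun s hs => by simp only [hs])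

theorem hasDerivAt_trOn {g : FormField E M} {W : Submodule ℝ (TangentSpace 𝓘(ℝ, E) x)}
    {β : ℝ → TangentSpace 𝓘(ℝ, E) x → TangentSpace 𝓘(ℝ, E) x → ℝ}
    {β' : TangentSpace 𝓘(ℝ, E) x → TangentSpace 𝓘(ℝ, E) x → ℝ} {t : ℝ}
    (h : ∀ u v, HasDerivAt (fun s => β s u v) (β' u v) t) :
    HasDerivAt (fun s => trOn g x W (β s)) (trOn g x W β') t := by
  simp only [trOn, metricTrace, smul_eq_mul]
  exact HasDerivAt.fun_sum fun i _ => HasDerivAt.fun_sum fun j _ => (h _ _).const_mul _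

/-- By symmetry of `k`, the two halves of the product rule for a quadratic expression agree, leaving
twice the half in which the factor indexed by `a` is differentiated. The coefficients `2` and `-2`
are placed as in the two trace identities. -/
theorem sum_symm_mul {ι κ : Type*} [Fintype ι] [Fintype κ] (k : κ → κ → ℝ)
    (hk : ∀ a a', k a a' = k a' a) (A A' : κ → Matrix ι ι ℝ) :
    ∑ a, ∑ a', k a a' * ((A' a).trace * (A a').trace + (A a).trace * (A' a').trace
        - (A' a * A a' + A a * A' a').trace)
      = ∑ a, ∑ a', k a a' * ((2 * (A' a).trace) * (A a').trace + -2 * (A' a * A a').trace) := by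
  have hs : ∀ f : κ → κ → ℝ, ∑ a, ∑ a', k a a' * f a a' = ∑ a, ∑ a', k a a' * f a' a := by
    intro f
    rw [Finset.sum_comm]
    exact Finset.sum_congr rfl fun a _ => Finset.sum_congr rfl fun a' _ => by rw [hk]
  have h2 : ∀ a a', (A a').trace * (A' a).trace - (A a' * A' a).trace
      = (A' a).trace * (A a').trace - (A' a * A a').trace := fun a a' => by
    rw [mul_comm, Matrix.trace_mul_comm]
  have h1 : ∑ a, ∑ a', k a a' * ((A a).trace * (A' a').trace - (A a * A' a').trace)
      = ∑ a, ∑ a', k a a' * ((A' a).trace * (A a').trace - (A' a * A a').trace) :=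
    (hs _).trans (Finset.sum_congr rfl fun a _ => Finset.sum_congr rfl fun a' _ => by rw [h2])
  calc _ = ∑ a, ∑ a', k a a' * ((A' a).trace * (A a').trace - (A' a * A a').trace)
        + ∑ a, ∑ a', k a a' * ((A a).trace * (A' a').trace - (A a * A' a').trace) := by
        simp only [← Finset.sum_add_distrib, Matrix.trace_add]
        exact Finset.sum_congr rfl fun a _ => Finset.sum_congr rfl fun a' _ => by ring
    _ = _ := by
        rw [h1]
        simp only [← Finset.sum_add_distrib]
        exact Finset.sum_congr rfl fun a _ => Finset.sum_congr rfl fun a' _ => by ring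

namespace Splitting

variable {n p : ℕ} {S : Splitting E M n p} {g : ℝ → FormField E M} {t : ℝ}

/-- A smooth family of metrics adapted to a pair of distributions, near a parameter. -/
structure IsVariation (S : Splitting E M n p) (g : ℝ → FormField E M) (t : ℝ) : Prop where
  adapted : ∀ᶠ s in 𝓝 t, S.IsAdapted (g s)
  smooth : ∀ (y : M) (X Y : VField E M), CDiffField 2 X y → CDiffField 2 Y y →
    ContMDiffAt (𝓘(ℝ, ℝ).prod 𝓘(ℝ, E)) 𝓘(ℝ, ℝ) 2
      (fun q : ℝ × M => g q.1 q.2 (X q.2) (Y q.2)) (t, y)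

namespace IsVariation

theorem swap (h : S.IsVariation g t) : S.swap.IsVariation g t :=
  ⟨h.adapted.mono fun _ hs => hs.swap, h.smooth⟩

/-- `infVar` is a `deriv`, hence zero by convention where the derivative fails to exist; smoothness
of the family excludes this. -/
theorem hasDerivAt (h : S.IsVariation g t) (u v : TangentSpace 𝓘(ℝ, E) x) :
    HasDerivAt (fun s => g s x u v) (infVar g t x u v) t := by
  have := (mixed_partial (h.smooth x (ext u) (ext v) (cDiffField_ext 2 u)
    (cDiffField_ext 2 v))).1.self_of_nhds
  simp only [ext_self] at this
  exact this.hasDerivAt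

theorem isBilin_infVar (h : S.IsVariation g t) : IsBilin (infVar g t x) := by
  refine ⟨fun v => ⟨fun a b => ?_, fun c a => ?_⟩, fun u => ⟨fun a b => ?_, fun c a => ?_⟩⟩
  · refine (h.hasDerivAt (a + b) v).unique ?_
    simpa only [map_add, add_apply] using (h.hasDerivAt a v).fun_add (h.hasDerivAt b v)
  · refine (h.hasDerivAt (c • a) v).unique ?_
    simpa only [map_smul, smul_apply, smul_eq_mul] using (h.hasDerivAt a v).const_mul c
  · refine (h.hasDerivAt u (a + b)).unique ?_
    simpa only [map_add] using (h.hasDerivAt u a).fun_add (h.hasDerivAt u b)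
  · refine (h.hasDerivAt u (c • a)).unique ?_
    simpa only [map_smul, smul_eq_mul] using (h.hasDerivAt u a).const_mul c

theorem infVar_symm (h : S.IsVariation g t) (u v : TangentSpace 𝓘(ℝ, E) x) :
    infVar g t x u v = infVar g t x v u :=
  (h.hasDerivAt u v).unique ((h.hasDerivAt v u).congr_of_eventuallyEq
    (h.adapted.mono fun _ hs => hs.metric.symm x u v))

/-- The variation does not change the metric on the second distribution. -/
def PerpConst (S : Splitting E M n p) (g : ℝ → FormField E M) (t : ℝ) : Prop :=
  ∀ᶠ s in 𝓝 t, ∀ y, ∀ u ∈ S.perp y, ∀ v ∈ S.perp y, g s y u v = g t y u v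

/-- For `u` in `S.perp`, orthogonality for every nearby metric gives `g_s(u, v) = g_s(u, v^⊥)`,
which is constant in `s`. Hence `B` lives on `S.top` alone. -/
theorem isTopForm_infVar (h : S.IsVariation g t) (hc : PerpConst S g t) (y : M) :
    S.IsTopForm y (infVar g t y) := by
  refine ⟨h.isBilin_infVar, h.infVar_symm, fun u hu v => ?_⟩
  refine (h.hasDerivAt u v).unique ?_
  refine (hasDerivAt_const t (g t y u (S.projPerp y v))).congr_of_eventuallyEq ?_
  filter_upwards [h.adapted, hc] with s hs hcs
  rw [← hcs y u hu _ (S.projPerp_mem v), hs.metric_projPerp_right hu]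

section Frame

variable (b : Basis (Fin n) ℝ (S.top x)) {κ : Type*} [Fintype κ] [DecidableEq κ]
  (c : Basis κ ℝ (S.perp x))

theorem smooth_frame (h : S.IsVariation g t) (i j : Fin n) :
    ContMDiffAt (𝓘(ℝ, ℝ).prod 𝓘(ℝ, E)) 𝓘(ℝ, ℝ) 2
      (fun q : ℝ × M => g q.1 q.2 (S.extTop (b i : TangentSpace 𝓘(ℝ, E) x) q.2)
        (S.extTop (b j : TangentSpace 𝓘(ℝ, E) x) q.2)) (t, x) :=
  have ha := h.adapted.self_of_nhds
  h.smooth x _ _ (ha.cDiffField_extTop 2 _) (ha.cDiffField_extTop 2 _)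

theorem diffMat_frameForm (h : S.IsVariation g t) : DiffMat E (frameForm (infVar g t) b) x :=
  fun i j => (mixed_partial (h.smooth_frame b i j)).2.1

theorem hasMatDeriv_frameGram (h : S.IsVariation g t) :
    HasMatDeriv (fun s => frameGram (g s) b x) (frameForm (infVar g t) b x) t :=
  fun _ _ => h.hasDerivAt _ _

theorem hasMatDeriv_matDeriv_frameGram (h : S.IsVariation g t) (z : TangentSpace 𝓘(ℝ, E) x) :
    HasMatDeriv (fun s => matDeriv z (frameGram (g s) b))
      (matDeriv z (frameForm (infVar g t) b)) t :=
  fun i j => (mixed_partial (h.smooth_frame b i j)).2.2 z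

/-- In `compMatrix_h_eq` the bracket coefficients do not depend on the metric, so the formula is
linear in the metric and is differentiated term by term; `mixed_partial` handles the space
derivative. -/
theorem hasMatDeriv_compMatrix_h (h : S.IsVariation g t) {z : TangentSpace 𝓘(ℝ, E) x}
    (hz : z ∈ S.perp x) :
    HasMatDeriv
      (fun s => compMatrix (g s) (S.h (g s)) (fun i => (b i : TangentSpace 𝓘(ℝ, E) x)) z)
      (-(1 / 2 : ℝ) • (matDeriv z (frameForm (infVar g t) b)
        - (lieMatrix b z).transpose * frameForm (infVar g t) b x
        - frameForm (infVar g t) b x * lieMatrix b z)) t := by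
  have hG := h.hasMatDeriv_frameGram b
  have h1 := (HasMatDeriv.const (t := t) (lieMatrix b z).transpose).mul hG
  have h2 := hG.mul (HasMatDeriv.const (t := t) (lieMatrix b z))
  simp only [Matrix.zero_mul, Matrix.mul_zero, zero_add, add_zero] at h1 h2
  have h3 := (((h.hasMatDeriv_matDeriv_frameGram b z).sub h1).sub h2).smul (-(1 / 2))
  exact h3.congr (h.adapted.mono fun s hs => hs.compMatrix_h_eq b hz)

/-- The vectors `T(u, v)` are independent of the metric and lie where the metric is constant. -/
theorem compMatrix_T_eq (hc : PerpConst S g t)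
    {z : TangentSpace 𝓘(ℝ, E) x} (hz : z ∈ S.perp x) : ∀ᶠ s in 𝓝 t,
    compMatrix (g s) S.T (fun i => (b i : TangentSpace 𝓘(ℝ, E) x)) z
      = compMatrix (g t) S.T (fun i => (b i : TangentSpace 𝓘(ℝ, E) x)) z := by
  filter_upwards [hc] with s hs
  ext i j
  exact hs x _ (T_mem _ _) _ hz

theorem gramInv_perp_eq (hc : PerpConst S g t) :
    ∀ᶠ s in 𝓝 t, gramInv (g s) c = gramInv (g t) c := by
  filter_upwards [hc] with s hs
  rw [gramInv, gramInv]
  congr 1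
  ext a a'
  exact hs x _ (c a).2 _ (c a').2

end Frame

/-- The variation of the extrinsic scalar curvature of the distribution on which the metric
varies. -/
theorem hasDerivAt_Sex (h : S.IsVariation g t) (hc : PerpConst S g t) (x : M) :
    HasDerivAt (fun s => S.Sex (g s) x)
      (pairing (g t) (fun y u v => divField (g t) (S.H (g t)) y * S.swap.gPerp (g t) y u v
          - divTensor (g t) (S.h (g t)) y u v - flatTensor (g t) (S.KK (g t)) y u v)
          (infVar g t) x
        + divField (g t) (fun y => pairingVec (g t) (S.h (g t)) (infVar g t) y
            - trG (g t) (infVar g t) y • S.H (g t) y) x) t := by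
  obtain ⟨b⟩ := S.exists_basis_top x
  obtain ⟨c⟩ := S.exists_basis_perp x
  have ha := h.adapted.self_of_nhds
  have hB := h.isTopForm_infVar hc
  have hu := ha.isUnit_frameGram b
  rw [ha.pairing_variation b c (hB x), ha.divField_variation b c hB (h.diffMat_frameForm b)]
  simp only [dirDeriv_trace_inv_mul (ha.diffMat_frameGram b) (h.diffMat_frameForm b) hu,
    matDeriv_inv_mul_inv (ha.diffMat_frameGram b) (h.diffMat_frameForm b) hu]
  set gi := (frameGram (g t) b x)⁻¹ with hgi
  set G := frameGram (g t) b x with hG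
  set Bm := frameForm (infVar g t) b x with hBm
  set k := gramInv (g t) c with hk
  set η : ℝ → Fin p → Matrix (Fin n) (Fin n) ℝ := fun s a =>
    compMatrix (g s) (S.h (g s)) (fun i => (b i : TangentSpace 𝓘(ℝ, E) x)) (c a) with hη
  set η' : Fin p → Matrix (Fin n) (Fin n) ℝ := fun a => -(1 / 2 : ℝ) •
    (matDeriv (c a : TangentSpace 𝓘(ℝ, E) x) (frameForm (infVar g t) b)
      - (lieMatrix b (c a)).transpose * Bm - Bm * lieMatrix b (c a)) with hη'
  set A : Fin p → ℝ → Matrix (Fin n) (Fin n) ℝ := fun a s => (frameGram (g s) b x)⁻¹ * η s a with hA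
  set A' : Fin p → Matrix (Fin n) (Fin n) ℝ := fun a => -(gi * Bm * gi) * η t a + gi * η' a with hA'
  have hAd : ∀ a, HasMatDeriv (A a) (A' a) t := fun a =>
    ((h.hasMatDeriv_frameGram b).inv hu).mul (h.hasMatDeriv_compMatrix_h b (c a).2)
  -- Near `t` the inverse Gram matrix on `S.perp` is constant, so all dependence on `s` sits in the
  -- matrices `A a s`, the products of `G⁻¹` with the component of `h` along `c a`.
  have hF : (fun s => S.Sex (g s) x) =ᶠ[𝓝 t] fun s => ∑ a, ∑ a', k a a'
      * ((A a s).trace * (A a' s).trace - (A a s * A a' s).trace) := by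
    filter_upwards [h.adapted, gramInv_perp_eq c hc] with s hs hks
    rw [hs.Sex_eq b c, hks, gramInv_eq b]
  have hD : HasDerivAt (fun s => S.Sex (g s) x) (∑ a, ∑ a', k a a'
      * ((A' a).trace * (A a' t).trace + (A a t).trace * (A' a').trace
        - (A' a * A a' t + A a t * A' a').trace)) t :=
    (HasDerivAt.fun_sum fun a _ => HasDerivAt.fun_sum fun a' _ =>
      (((hAd a).trace.mul (hAd a').trace).sub ((hAd a).mul (hAd a')).trace).const_mul
        (k a a')).congr_of_eventuallyEq hF
  convert hD using 1
  have h1 : gi * G = 1 := Matrix.nonsing_inv_mul _ hu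
  have h2 : G * gi = 1 := Matrix.mul_nonsing_inv _ hu
  have hgis : gi.transpose = gi := by
    rw [hgi, hG, ← gramInv_eq b]
    exact ha.transpose_gramInv b
  have hBs : Bm.transpose = Bm := (hB x).transpose _
  have hηs : ∀ a, (η t a).transpose = η t a := fun a => transpose_compMatrix_h _ _
  have hGd : ∀ a, matDeriv (c a : TangentSpace 𝓘(ℝ, E) x) (frameGram (g t) b)
      = (lieMatrix b (c a)).transpose * G + G * lieMatrix b (c a) - (2 : ℝ) • η t a := by
    intro a
    have := ha.compMatrix_h_eq b (c a).2
    simp only [hη]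
    rw [this, smul_smul]
    norm_num
    abel
  have e1 : ∀ a, 2 * (A' a).trace = -_ := fun a => two_mul_trace_deriv h1 h2 (hGd a)
  have e2 : ∀ a a', -2 * (A' a * A a' t).trace = _ := fun a a' =>
    neg_two_mul_trace_deriv (τ := compMatrix (g t) S.T
      (fun i => (b i : TangentSpace 𝓘(ℝ, E) x)) (c a)) h1 h2 hgis hBs (hηs a) (hηs a')
      (transpose_compMatrix_T _ _) (hGd a)
  rw [sum_symm_mul k (fun a a' => gramInv_symm (S := S.swap) c ha.swap a a') (fun a => A a t) A']
  simp only [e1, e2]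
  simp only [nablaMatrix, gramInv_eq b]
  -- Here the terms with `div H` and with the divergences of the fields `h(Xᵢ, Xⱼ)` cancel between
  -- the pairing and the divergence.
  rw [show ∀ p q r s : ℝ, p - q + r + (q - p + s) = r + s from fun p q r s => by ring]
  simp only [← Finset.sum_add_distrib, ← mul_add]
  refine Finset.sum_congr rfl fun a _ => Finset.sum_congr rfl fun a' _ => ?_
  congr 1
  simp only [hη, hA]
  ring

/-- The left side is the product rule for `tr(G⁻¹ τ G⁻¹ τ'ᵀ)` with `D = G⁻¹BG⁻¹`; the factors `gi *
0` are the derivatives of the constant matrices. Antisymmetry of `τ'` absorbs the minus sign of the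
inverse. -/
theorem trace_mul_symm {ι : Type*} [Fintype ι] {gi D τ τ' : Matrix ι ι ℝ}
    (hτ' : τ'.transpose = -τ') :
    ((-D * τ + gi * 0) * (gi * τ'.transpose) + gi * τ * (-D * τ'.transpose + gi * 0)).trace
      = (D * (τ * gi * τ')).trace + (D * (τ' * gi * τ)).trace := by
  have h1 := Matrix.trace_mul_comm (gi * τ) (D * τ')
  simp only [Matrix.mul_assoc] at h1
  rw [hτ']
  simp only [Matrix.mul_zero, add_zero, Matrix.neg_mul, Matrix.mul_neg, neg_neg, Matrix.mul_assoc,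
    Matrix.trace_add, h1]

/-- The variation of the norm of the integrability tensor of the distribution on which the metric
varies. -/
theorem hasDerivAt_normSq_T (h : S.IsVariation g t) (hc : PerpConst S g t) (x : M) :
    HasDerivAt (fun s => S.normSq (g s) S.T x)
      (pairing (g t) (fun y u v => 2 * flatTensor (g t) (S.TT (g t)) y u v) (infVar g t) x) t := by
  obtain ⟨b⟩ := S.exists_basis_top x
  obtain ⟨c⟩ := S.exists_basis_perp x
  have ha := h.adapted.self_of_nhds
  have hB := h.isTopForm_infVar hc
  have hu := ha.isUnit_frameGram b
  have hA : IsBilin fun u v => 2 * flatTensor (g t) (S.TT (g t)) x u v :=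
    (isBilin_flatTensor ha.isLinearMap_TT).smul 2
  rw [ha.pairing_eq_trace b hA (hB x), gramInv_eq b, ← frameForm_self]
  set gi := (frameGram (g t) b x)⁻¹ with hgi
  set Bm := frameForm (infVar g t) b x with hBm
  set k := gramInv (g t) c with hk
  set τ : Fin p → Matrix (Fin n) (Fin n) ℝ := fun a =>
    compMatrix (g t) S.T (fun i => (b i : TangentSpace 𝓘(ℝ, E) x)) (c a) with hτ
  have hks : ∀ a a', k a a' = k a' a := fun a a' => gramInv_symm (S := S.swap) c ha.swap a a'
  have hsum : ∀ f : Fin p → Fin p → ℝ, ∑ a, ∑ a', k a a' * f a a' = ∑ a, ∑ a', k a a' * f a' a := by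
    intro f
    rw [Finset.sum_comm]
    exact Finset.sum_congr rfl fun a _ => Finset.sum_congr rfl fun a' _ => by rw [hks]
  have hm : formMatrix (fun u v => 2 * flatTensor (g t) (S.TT (g t)) x u v)
      (fun i => (b i : TangentSpace 𝓘(ℝ, E) x))
      = (2 : ℝ) • ∑ a, ∑ a', k a a' • (τ a' * gi * τ a) := by
    ext i j
    simp only [formMatrix, Matrix.of_apply, ha.flat_TT_eq b c, Matrix.smul_apply,
      Matrix.sum_apply, smul_eq_mul, gramInv_eq b]
    rfl
  have hF : (fun s => S.normSq (g s) S.T x) =ᶠ[𝓝 t] fun s => ∑ a, ∑ a', k a a'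
      * ((frameGram (g s) b x)⁻¹ * τ a * ((frameGram (g s) b x)⁻¹ * (τ a').transpose)).trace := by
    filter_upwards [h.adapted, gramInv_perp_eq c hc,
      Filter.eventually_all.2 fun a => compMatrix_T_eq b hc (c a).2] with s hs hks hτs
    rw [hs.normSq_eq b c hs.isBilin_T T_mem, hks, gramInv_eq b]
    simp only [hτs, Matrix.mul_assoc]
    rfl
  have hgd := (h.hasMatDeriv_frameGram b).inv hu
  have hd : ∀ N : Matrix (Fin n) (Fin n) ℝ, HasMatDeriv (fun s => (frameGram (g s) b x)⁻¹ * N)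
      (-(gi * Bm * gi) * N + gi * 0) t := fun N => hgd.mul (HasMatDeriv.const N)
  have hda : ∀ a a', HasDerivAt (fun s => ((frameGram (g s) b x)⁻¹ * τ a
      * ((frameGram (g s) b x)⁻¹ * (τ a').transpose)).trace)
      ((gi * Bm * gi * (τ a * gi * τ a')).trace + (gi * Bm * gi * (τ a' * gi * τ a)).trace) t := by
    intro a a'
    rw [← trace_mul_symm (transpose_compMatrix_T _ _)]
    exact ((hd (τ a)).mul (hd (τ a').transpose)).trace
  refine HasDerivAt.congr_deriv ((HasDerivAt.fun_sum (u := Finset.univ) fun a _ =>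
    HasDerivAt.fun_sum (u := Finset.univ) fun a' _ =>
      (hda a a').const_mul (k a a')).congr_of_eventuallyEq hF) ?_
  rw [hm]
  simp only [mul_add, Finset.sum_add_distrib]
  -- Renaming indices makes the two sums equal, which produces the factor `2` in front of `𝓣`.
  rw [hsum fun a a' => (gi * Bm * gi * (τ a * gi * τ a')).trace]
  simp only [Matrix.mul_smul, Matrix.mul_sum, Matrix.trace_smul, Matrix.trace_sum, smul_eq_mul]
  ring

/-- The variation of the scalar product of two vectors of the distribution on which the metric
varies, when their scalar products with fixed vectors do not change. -/
theorem hasDerivAt_metric (h : S.IsVariation g t) {α α' : ℝ → TangentSpace 𝓘(ℝ, E) x}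
    (hα : ∀ s, α s ∈ S.perp x) (hα' : ∀ s, α' s ∈ S.perp x)
    (hc : ∀ z ∈ S.perp x, ∀ᶠ s in 𝓝 t, g s x (α s) z = g t x (α t) z)
    (hc' : ∀ z ∈ S.perp x, ∀ᶠ s in 𝓝 t, g s x (α' s) z = g t x (α' t) z) :
    HasDerivAt (fun s => g s x (α s) (α' s)) (-infVar g t x (α t) (α' t)) t := by
  obtain ⟨c⟩ := S.exists_basis_perp x
  have ha := h.adapted.self_of_nhds
  set K : ℝ → Matrix (Fin p) (Fin p) ℝ := fun s =>
    gram (g s) x fun a => (c a : TangentSpace 𝓘(ℝ, E) x) with hK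
  set Bm := formMatrix (infVar g t x) fun a => (c a : TangentSpace 𝓘(ℝ, E) x) with hBm
  have hKd : HasMatDeriv K Bm t := fun a a' => h.hasDerivAt _ _
  have hKu : IsUnit (K t).det := IsAdapted.isUnit_gram (S := S.swap) ha.swap c
  -- The components of `α` and `α'` against `c` are constant, so only `K⁻¹` moves; its derivative
  -- `-K⁻¹BK⁻¹` is the source of the minus sign.
  have hF : (fun s => g s x (α s) (α' s)) =ᶠ[𝓝 t] fun s => ∑ a, ∑ a', (K s)⁻¹ a a'
      * (g t x (α' t) (c a) * g t x (α t) (c a')) := by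
    filter_upwards [h.adapted, Filter.eventually_all.2 fun a => hc _ (c a).2,
      Filter.eventually_all.2 fun a => hc' _ (c a).2] with s hs h1 h2
    rw [hs.metric_eq_sum_perp c _ (hα' s)]
    simp only [h1, h2]
    rfl
  have hD := (HasDerivAt.fun_sum (u := Finset.univ) fun a _ => HasDerivAt.fun_sum
    (u := Finset.univ) fun a' _ => ((hKd.inv hKu) a a').mul_const
      (g t x (α' t) (c a) * g t x (α t) (c a'))).congr_of_eventuallyEq hF
  refine hD.congr_deriv ?_
  have hb := h.isBilin_infVar (x := x)
  have hks : (K t)⁻¹.transpose = (K t)⁻¹ :=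
    IsAdapted.transpose_gramInv (S := S.swap) c ha.swap
  set k := (K t)⁻¹ with hk
  have e : ∀ (u : TangentSpace 𝓘(ℝ, E) x), u ∈ S.perp x → u = ∑ j,
      (k.mulVec fun i => g t x u (c i)) j • (c j : TangentSpace 𝓘(ℝ, E) x) := by
    intro u hu
    conv_lhs => rw [ha.projPerp_eq_sum c hu, Finset.sum_comm]
    simp only [← Finset.sum_smul]
    rw [← hks]
    rfl
  have e2 : ∀ u ∈ S.perp x, ∀ v ∈ S.perp x, infVar g t x u v
      = ∑ i, ∑ j, (k * Bm * k) i j * (g t x u (c i) * g t x v (c j)) := by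
    intro u hu v hv
    have e3 : infVar g t x u v = dotProduct (k.mulVec fun i => g t x u (c i))
        (Bm.mulVec (k.mulVec fun i => g t x v (c i))) := by
      conv_lhs => rw [e u hu, e v hv, hb.sum_left]
      simp only [hb.sum_right, smul_eq_mul]
      refine Finset.sum_congr rfl fun i _ => ?_
      congr 1
      exact Finset.sum_congr rfl fun j _ => mul_comm _ _
    have e4 : (k.mulVec fun i => g t x u (c i)) = Matrix.vecMul (fun i => g t x u (c i)) k := by
      rw [← Matrix.mulVec_transpose, hks]
    rw [e3, e4, ← Matrix.dotProduct_mulVec, Matrix.mulVec_mulVec, Matrix.mulVec_mulVec]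
    simp only [dotProduct, Matrix.mulVec, Finset.mul_sum, Matrix.mul_assoc]
    exact Finset.sum_congr rfl fun i _ => Finset.sum_congr rfl fun j _ => by ring
  rw [h.infVar_symm, e2 _ (hα' t) _ (hα t)]
  simp only [Matrix.neg_apply, neg_mul, Finset.sum_neg_distrib]

/-- A contraction over `S.top` uses the metric only through its restriction to `S.top`, which is the
part held fixed here. -/
theorem trOn_top_eq (hc : PerpConst S.swap g t) : ∀ᶠ s in 𝓝 t,
    ∀ β : TangentSpace 𝓘(ℝ, E) x → TangentSpace 𝓘(ℝ, E) x → ℝ,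
      trOn (g s) x (S.top x) β = trOn (g t) x (S.top x) β := by
  filter_upwards [hc] with s hs β
  have : ∀ i j, g s x (finBasis ℝ (S.top x) i) (finBasis ℝ (S.top x) j)
      = g t x (finBasis ℝ (S.top x) i) (finBasis ℝ (S.top x) j) := fun i j =>
    hs x _ (Subtype.mem _) _ (Subtype.mem _)
  simp only [trOn, metricTrace, this]

theorem exists_linearMap (h : S.IsVariation g t) :
    ∃ β : TangentSpace 𝓘(ℝ, E) x →ₗ[ℝ] TangentSpace 𝓘(ℝ, E) x →ₗ[ℝ] ℝ,
      ∀ u v, infVar g t x u v = β u v := by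
  have hb := h.isBilin_infVar (x := x)
  exact ⟨LinearMap.mk₂ ℝ (infVar g t x) (fun u u' v => (hb.left v).map_add u u')
    (fun c u v => (hb.left v).map_smul c u) (fun u v v' => (hb.right u).map_add v v')
    (fun c u v => (hb.right u).map_smul c v), fun u v => rfl⟩

/-- The variation of the norm of the integrability tensor of the distribution on which the metric
does not vary. -/
theorem hasDerivAt_normSq_T_of_const (h : S.IsVariation g t) (hc : PerpConst S.swap g t) (x : M) :
    HasDerivAt (fun s => S.normSq (g s) S.T x) (-pairing (g t) (S.PhiT (g t)) (infVar g t) x) t := by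
  have ha := h.adapted.self_of_nhds
  obtain ⟨β, hβ⟩ := h.exists_linearMap (x := x)
  rw [S.pairing_PhiT (g t) x (ha.metric.symm x) (ha.metric.nondegenerate x) _ β hβ h.infVar_symm,
    neg_neg]
  -- Neither the contraction nor the vectors `T(a, b)` depend on `s`: the derivative falls on the
  -- outer scalar product only.
  refine (hasDerivAt_trOn fun a a' => hasDerivAt_trOn fun b b' =>
    h.hasDerivAt (S.T x a b) (S.T x a' b')).congr_of_eventuallyEq ?_
  filter_upwards [trOn_top_eq (x := x) hc] with s hs
  simp only [normSq, hs]

/-- The Lie derivative formula involves metric-free brackets and the metric on `S.top` alone, once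
the brackets are projected to `S.top` by orthogonality. So the linear form `g(h(u, v), ·)` on
`S.perp` is constant although the vector `h(u, v)` is not. -/
theorem metric_h_eq (h : S.IsVariation g t) (hc : PerpConst S.swap g t)
    (u v : TangentSpace 𝓘(ℝ, E) x) {z : TangentSpace 𝓘(ℝ, E) x} (hz : z ∈ S.perp x) :
    ∀ᶠ s in 𝓝 t, g s x (S.h (g s) x u v) z = g t x (S.h (g t) x u v) z := by
  have hzx : S.swap.extTop z x = z := extTop_self_of_mem (S := S.swap) hz
  have key : ∀ s, S.IsAdapted (g s) → g s x (S.h (g s) x u v) z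
      = -(1 / 2) * (dirDeriv z (fun y => g s y (S.extTop u y) (S.extTop v y))
        - g s x (S.projTop x (VectorField.mlieBracket 𝓘(ℝ, E) (S.swap.extTop z) (S.extTop u) x))
          (S.extTop v x)
        - g s x (S.extTop u x)
          (S.projTop x (VectorField.mlieBracket 𝓘(ℝ, E) (S.swap.extTop z) (S.extTop v) x))) := by
    intro s hs
    have := hs.metric_h_eq_lie (hs.diffField_extTop u) (hs.diffField_extTop v)
      (hs.swap.diffField_extTop z) (extTop_mem _ _) (extTop_mem _ _)
      (Filter.Eventually.of_forall fun y => extTop_mem (S := S.swap) z y)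
    rw [hzx, extTop_self, extTop_self, hs.h_projTop] at this
    rw [this, extTop_self, extTop_self, hs.metric_projTop_left (S.projTop_mem v),
      hs.metric_projTop_right (S.projTop_mem u)]
  -- The neighbourhood of `t` in `PerpConst` is uniform over the manifold, so the functions `y ↦
  -- g_s(U, V)` coincide everywhere and so do their directional derivatives at `x`.
  filter_upwards [h.adapted, hc] with s hs hcs
  rw [key s hs, key t h.adapted.self_of_nhds, hcs x _ (S.projTop_mem _) _ (extTop_mem _ _),
    hcs x _ (extTop_mem _ _) _ (S.projTop_mem _),
    funext fun y => hcs y _ (extTop_mem (S := S) u y) _ (extTop_mem (S := S) v y)]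

/-- The variation of the extrinsic scalar curvature of the distribution on which the metric does not
vary. -/
theorem hasDerivAt_Sex_of_const (h : S.IsVariation g t) (hc : PerpConst S.swap g t) (x : M) :
    HasDerivAt (fun s => S.Sex (g s) x) (-pairing (g t) (S.PhiH (g t)) (infVar g t) x) t := by
  have ha := h.adapted.self_of_nhds
  obtain ⟨β, hβ⟩ := h.exists_linearMap (x := x)
  rw [S.pairing_PhiH (g t) x (ha.metric.symm x) (ha.metric.nondegenerate x) _ β hβ h.infVar_symm,
    neg_sub, ← neg_add_eq_sub, ← sub_neg_eq_add]
  obtain ⟨b⟩ := S.exists_basis_top x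
  -- `H` contracts `h` over `S.top` with a constant metric, so it inherits constant components
  -- against `S.perp`; this puts it within reach of `hasDerivAt_metric`.
  have hHz : ∀ z ∈ S.perp x, ∀ᶠ s in 𝓝 t, g s x (S.H (g s) x) z = g t x (S.H (g t) x) z := by
    intro z hz
    filter_upwards [h.adapted, trOn_top_eq (x := x) hc, Filter.eventually_all.2 fun i =>
      Filter.eventually_all.2 fun j => h.metric_h_eq hc (b i : TangentSpace 𝓘(ℝ, E) x) (b j) hz]
      with s hs hts hhs
    rw [H, H, ← trOn_map (isLinearMap_metric (g s) z), ← trOn_map (isLinearMap_metric (g t) z), hts,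
      ha.trOn_top b (hs.isBilin_h.map (isLinearMap_metric (g s) z)),
      ha.trOn_top b (ha.isBilin_h.map (isLinearMap_metric (g t) z))]
    simp only [hhs]
  have hd : ∀ a b a' b', HasDerivAt (fun s => g s x (S.h (g s) x a b) (S.h (g s) x a' b'))
      (-infVar g t x (S.h (g t) x a b) (S.h (g t) x a' b')) t := fun a b a' b' =>
    h.hasDerivAt_metric (fun s => h_mem a b) (fun s => h_mem a' b')
      (fun z hz => h.metric_h_eq hc a b hz) fun z hz => h.metric_h_eq hc a' b' hz
  have hH := h.hasDerivAt_metric (α := fun s => S.H (g s) x) (α' := fun s => S.H (g s) x)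
    (fun s => H_mem) (fun s => H_mem) hHz hHz
  have hN := hasDerivAt_trOn (g := g t) (W := S.top x) fun a a' =>
    hasDerivAt_trOn (g := g t) (W := S.top x) fun b b' => hd a b a' b'
  simp only [trOn_neg] at hN
  refine (hH.sub hN).congr_of_eventuallyEq ?_
  filter_upwards [trOn_top_eq (x := x) hc] with s hs
  simp only [Sex, normSq, hs]
  rfl

end IsVariation
end Splitting
end Variation

/-! ### From `g^⊥`-variations to the local setting. -/

section PerpVariation

variable {E : Type*} [NormedAddCommGroup E] [NormedSpace ℝ E] [FiniteDimensional ℝ E]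
  {M : Type*} [TopologicalSpace M] [ChartedSpace E M] [IsManifold 𝓘(ℝ, E) ∞ M]

namespace Splitting

variable {n p : ℕ} {S : Splitting E M n p} {g : ℝ → FormField E M} {t ε : ℝ}

namespace IsPerpVariation

theorem isAdapted (hg : S.IsPerpVariation ε g) (ht : t ∈ Ioo (-ε) ε) : S.IsAdapted (g t) := by
  refine ⟨⟨?_, hg.symm t ht, hg.nondegenerate t ht⟩, hg.adapted t ht⟩
  intro y
  have h1 : ContMDiffAt 𝓘(ℝ, E) (𝓘(ℝ, ℝ).prod 𝓘(ℝ, E)) ∞ (fun y : M => (t, y)) y :=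
    contMDiffAt_const.prodMk contMDiffAt_id
  exact ((hg.smooth.contMDiffAt (x := (t, y))
    (prod_mem_nhds (Ioo_mem_nhds ht.1 ht.2) Filter.univ_mem))).comp y h1

/-- Evaluating the jointly smooth family of forms on `C²` fields pulled back to time × space gives
functions that are jointly `C²`, the regularity required by `mixed_partial`. -/
theorem isVariation (hg : S.IsPerpVariation ε g) (ht : t ∈ Ioo (-ε) ε) : S.IsVariation g t := by
  refine ⟨Filter.mem_of_superset (Ioo_mem_nhds ht.1 ht.2) fun s hs => hg.isAdapted hs, ?_⟩
  intro y X Y hX hY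
  have h1 := ((hg.smooth.contMDiffAt (x := (t, y))
    (prod_mem_nhds (Ioo_mem_nhds ht.1 ht.2) Filter.univ_mem))).of_le
      (m := 2) (by have : ((2 : ℕ∞) : ℕ∞ω) ≤ ∞ := by exact_mod_cast le_top
                   exact this)
  have hsnd : ContMDiffAt (𝓘(ℝ, ℝ).prod 𝓘(ℝ, E)) 𝓘(ℝ, E) 2 (fun q : ℝ × M => q.2) (t, y) :=
    contMDiffAt_snd
  have h2 : ContMDiffAt (𝓘(ℝ, ℝ).prod 𝓘(ℝ, E)) (𝓘(ℝ, E).prod 𝓘(ℝ, E)) 2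
      (fun q : ℝ × M => TotalSpace.mk' E q.2 (X q.2)) (t, y) :=
    ContMDiffAt.comp (t, y) (g := fun y => TotalSpace.mk' E y (X y)) hX hsnd
  have h3 : ContMDiffAt (𝓘(ℝ, ℝ).prod 𝓘(ℝ, E)) (𝓘(ℝ, E).prod 𝓘(ℝ, E)) 2
      (fun q : ℝ × M => TotalSpace.mk' E q.2 (Y q.2)) (t, y) :=
    ContMDiffAt.comp (t, y) (g := fun y => TotalSpace.mk' E y (Y y)) hY hsnd
  have : ContMDiffAt (𝓘(ℝ, ℝ).prod 𝓘(ℝ, E)) (𝓘(ℝ, E).prod 𝓘(ℝ)) 2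
      (fun q : ℝ × M => TotalSpace.mk' ℝ (E := Bundle.Trivial M ℝ) q.2
        (g q.1 q.2 (X q.2) (Y q.2))) (t, y) := by
    apply ContMDiffAt.clm_bundle_apply₂ (F₁ := E) (F₂ := E)
    · exact h1
    · exact h2
    · exact h3
  simp only [contMDiffAt_totalSpace] at this
  exact this.2

theorem perpConst_swap (hg : S.IsPerpVariation ε g) (ht : t ∈ Ioo (-ε) ε) :
    IsVariation.PerpConst S.swap g t := by
  refine Filter.mem_of_superset (Ioo_mem_nhds ht.1 ht.2) fun s hs y u hu v hv => ?_
  rw [hg.top_const s hs y u hu v hv, hg.top_const t ht y u hu v hv]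

end IsPerpVariation
end Splitting
end PerpVariation

end AlmostProduct

end

theorem mainTheorem2 {E : Type*} [NormedAddCommGroup E] [NormedSpace ℝ E] [FiniteDimensional ℝ E]
    {M : Type*} [TopologicalSpace M] [T2Space M] [SecondCountableTopology M]
    [ChartedSpace E M] [IsManifold 𝓘(ℝ, E) ∞ M] {n p : ℕ}
    (S : AlmostProduct.Splitting E M n p) (ε : ℝ) (g : ℝ → AlmostProduct.FormField E M)
    (hg : S.IsPerpVariation ε g) (t : ℝ) (ht : t ∈ Ioo (-ε) ε) (x : M) :
    HasDerivAt (fun s => S.swap.Sex (g s) x)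
      (AlmostProduct.pairing (g t)
          (fun y u v => AlmostProduct.divField (g t) (S.swap.H (g t)) y * S.gPerp (g t) y u v
            - AlmostProduct.divTensor (g t) (S.swap.h (g t)) y u v
            - AlmostProduct.flatTensor (g t) (S.swap.KK (g t)) y u v)
          (AlmostProduct.infVar g t) x
        + AlmostProduct.divField (g t)
          (fun y => AlmostProduct.pairingVec (g t) (S.swap.h (g t)) (AlmostProduct.infVar g t) y
            - AlmostProduct.trG (g t) (AlmostProduct.infVar g t) y • S.swap.H (g t) y) x) t ∧
    HasDerivAt (fun s => S.Sex (g s) x)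
      (-AlmostProduct.pairing (g t) (S.PhiH (g t)) (AlmostProduct.infVar g t) x) t ∧
    HasDerivAt (fun s => S.swap.normSq (g s) S.swap.T x)
      (AlmostProduct.pairing (g t)
        (fun y u v => 2 * AlmostProduct.flatTensor (g t) (S.swap.TT (g t)) y u v)
        (AlmostProduct.infVar g t) x) t ∧
    HasDerivAt (fun s => S.normSq (g s) S.T x)
      (-AlmostProduct.pairing (g t) (S.PhiT (g t)) (AlmostProduct.infVar g t) x) t := by
  have h := hg.isVariation ht
  have hc := hg.perpConst_swap ht
  -- The single fact `hc`, constancy on `S.top = S.swap.perp`, plays both roles: for `S.swap` the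
  -- metric varies on the distribution studied, and for `S` on its complement.
  exact ⟨h.swap.hasDerivAt_Sex hc x, h.hasDerivAt_Sex_of_const hc x,
    h.swap.hasDerivAt_normSq_T hc x, h.hasDerivAt_normSq_T_of_const hc x⟩
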